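/- **Setting.** A collection of sets is a family indexed by IDs (sets with different IDs may coincide). For a collection $\mathcal C$ of subsets of a universe of $n$ elements, the cover $\psi(\mathcal C)$ is the union of its sets, and the unique cover $\tilde\psi(\mathcal C)$ is the set of elements that lie in exactly one set of $\mathcal C$. Given a collection $\mathcal V$ of $m$ sets and $k\le m$, Max Unique Coverage asks for a subcollection $\mathcal B\subseteq\mathcal V$ (given by its IDs) with $|\mathcal B|\le k$ that maximizes $|\tilde\psi(\mathcal B)|$; let $\mathrm{OPT}$ be the maximum. An $\alpha$-approximation is a $\mathcal B\subseteq\mathcal V$ with $|\mathcal B|\le k$ and $|\tilde\psi(\mathcal B)|\ge\alpha\,\mathrm{OPT}$. The maximum frequency is the largest number of sets that share an element. Algorithms are programs of a random access machine with logarithmic cost; space is the number of bits in use (lengths of addresses and contents of all nonzero cells). A single-pass streaming algorithm knows $n$, $m$, $k$ and $\lceil 1/\varepsilon\rceil$ in advance, reads the sets one after another, element by element, once and in the given order, may flip fair coins (a flip is forgotten unless it is stored), and after the pass computes its output from its memory. **Theorem.** Let $\textsc{Alg}$ be an offline algorithm that takes a collection $\mathcal C$ of $\ell$ subsets of a universe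 of $n$ elements and returns a subcollection $\mathcal B\subseteq\mathcal C$ in time polynomial in $\ell$ and $n$. Suppose that it has unique coverage ratio $\varphi=\varphi(k,r,d)$: for all $k,r,d\ge2$ and every collection $\mathcal C$ of at most $k$ sets, with maximum frequency at most $r$ and maximum set size at most $d$, the returned $\mathcal B$ satisfies $|\psi(\mathcal C)|\le\varphi(k,r,d)\,|\tilde\psi(\mathcal B)|$. Then for every constant $c\in\mathbb N$ there are a single-pass streaming algorithm and a constant $K\in\mathbb N$ such that the following holds for every stream $\mathcal V$ of $m$ subsets of a universe of $n$ elements with maximum frequency $r\ge2$ and maximum set size $d\ge2$, every $k$ with $2\le k\le m$, and every real $\varepsilon\in(0,1)$. 1. With probability at least $1-1/m^{c}$ the algorithm returns a $\left(\frac1{2\varphi(k,r,d)}-3\varepsilon\right)$-approximation for Max Unique Coverage on $\mathcal V$. 2. On all outcomes of its coin flips, its running time is at most $K(m+n+1/\varepsilon)^K$. 3. On all outcomes of its coin flips, its space throughout the pass is at most $K\,\frac{k^2}{\varepsilon^3}\log^K\!\left(\frac{mn}{\varepsilon}\right)=\tilde O(k^2/\varepsilon^3)$ bits. 4. On all outcomes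 of its coin flips, its space after the pass is at most $K\,\frac{k^2}{\varepsilon^3}\log^K\!\left(\frac{mn}{\varepsilon}\right)$ bits plus the space that $\textsc{Alg}$ uses on some collection of at most $k$ subsets of the universe of total size at most $K\,\frac{k^2}{\varepsilon^2}\log^K\!\left(\frac{mn}{\varepsilon}\right)$. In particular, the total space is $\tilde O(k^2/\varepsilon^3)$ if the space that $\textsc{Alg}$ uses is linear in the size of its input up to polylogarithmic factors. -/

import Mathlib

/-! ## Coverage and unique coverage of an indexed family of finite sets

A collection is a family `S : ι → Finset α`; the index is the ID of the set, and a subcollection is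
a finite set of IDs. -/

namespace MUC

section Coverage

variable {ι α : Type*} [DecidableEq ι] [DecidableEq α]

/-- The elements that lie in at least one set of the subcollection `B`. -/
def cover (S : ι → Finset α) (B : Finset ι) : Finset α :=
  B.biUnion S

/-- The elements that lie in exactly one set of the subcollection `B`: the cover without all
intersections of two sets of `B` with different IDs. -/
def uniqueCover (S : ι → Finset α) (B : Finset ι) : Finset α :=
  cover S B \ B.offDiag.biUnion (fun p => S p.1 ∩ S p.2)

/-- The number of sets of the family that contain `x`. -/
def freq [Fintype ι] (S : ι → Finset α) (x : α) : ℕ :=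
  (Finset.univ.filter (fun i => x ∈ S i)).card

/-- The maximum frequency of an element. -/
def maxFreq [Fintype ι] [Fintype α] (S : ι → Finset α) : ℕ :=
  Finset.univ.sup (freq S)

/-- The maximum size of a set of the family. -/
def maxSize [Fintype ι] (S : ι → Finset α) : ℕ :=
  Finset.univ.sup (fun i => (S i).card)

/-- The maximum unique coverage of a subcollection of at most `k` sets. -/
def opt [Fintype ι] (S : ι → Finset α) (k : ℕ) : ℕ :=
  ((Finset.univ : Finset (Finset ι)).filter (fun B => B.card ≤ k)).sup
    (fun B => (uniqueCover S B).card)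

/-- `B` is an `a`-approximate solution of Max Unique Coverage with cardinality constraint `k`. -/
def IsApprox [Fintype ι] (S : ι → Finset α) (k : ℕ) (a : ℝ) (B : Finset ι) : Prop :=
  B.card ≤ k ∧ a * (opt S k : ℝ) ≤ ((uniqueCover S B).card : ℝ)

end Coverage

/-! ## Encoding of families -/

/-- `m` subsets of the universe `{0, …, n - 1}`, each listed in an arbitrary order without
repetition. The sets themselves need not be distinct. -/
structure Family (n m : ℕ) where
  elems : Fin m → List (Fin n)
  nodup : ∀ i, (elems i).Nodup

namespace Family

variable {n m : ℕ}

/-- The sets of the family. -/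
def sets (V : Family n m) (i : Fin m) : Finset (Fin n) :=
  (V.elems i).toFinset

/-- The family as a sequence of numbers, set after set: an element `x` is written `x + 1`, and each
set is closed by `0`. -/
def tokens (V : Family n m) : List ℕ :=
  (List.ofFn V.elems).flatMap (fun l => l.map (fun x => x.val + 1) ++ [0])

/-- The sum of the sizes of the sets. -/
def totalSize (V : Family n m) : ℕ :=
  ∑ i, (V.sets i).card

end Family

/-! ## The machine model: a random access machine with logarithmic cost

Memory consists of arrays `0, 1, 2, …` of natural numbers, of which a program names finitely many;
all cells not set initially are `0`. The program reads an input stream from left to right, once, and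
flips fair coins, each of which is lost unless its value is stored. -/

/-- A memory: the cell `i` of the array `a` holds the number at `(a, i)`. -/
abbrev Mem : Type := ℕ × ℕ →₀ ℕ

/-- The number of bits in use: for each nonzero cell, the binary lengths of its address and of its
content. -/
noncomputable def Mem.bits (μ : Mem) : ℕ :=
  μ.sum (fun p v => Nat.size p.2 + Nat.size v)

/-- The memory with the list `l` in the array `a`, and `0` elsewhere. -/
noncomputable def Mem.ofList (a : ℕ) (l : List ℕ) : Mem :=
  ∑ i ∈ Finset.range l.length, Finsupp.single (a, i) (l.getD i 0)

/-- Arithmetic operations and comparisons of natural numbers. -/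
inductive Op where
  | add | sub | mul | div | mod | lt | eq

/-- Truncated subtraction, division rounding down, and truth values `0` and `1`. -/
def Op.eval : Op → ℕ → ℕ → ℕ
  | .add, x, y => x + y
  | .sub, x, y => x - y
  | .mul, x, y => x * y
  | .div, x, y => x / y
  | .mod, x, y => x % y
  | .lt, x, y => if x < y then 1 else 0
  | .eq, x, y => if x = y then 1 else 0

/-- Expressions: constants, array cells `a[e]`, and operations. -/
inductive Expr where
  | lit (c : ℕ)
  | get (a : ℕ) (e : Expr)
  | bin (o : Op) (e₁ e₂ : Expr)

namespace Expr

/-- The value of an expression. -/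
def eval (μ : Mem) : Expr → ℕ
  | .lit c => c
  | .get a e => μ (a, e.eval μ)
  | .bin o e₁ e₂ => o.eval (e₁.eval μ) (e₂.eval μ)

/-- The logarithmic cost of evaluating an expression: each step costs one plus the binary lengths of
the addresses and operands involved. -/
def cost (μ : Mem) : Expr → ℕ
  | .lit c => 1 + Nat.size c
  | .get a e => 1 + e.cost μ + Nat.size (e.eval μ) + Nat.size (μ (a, e.eval μ))
  | .bin _ e₁ e₂ => 1 + e₁.cost μ + e₂.cost μ + Nat.size (e₁.eval μ) + Nat.size (e₂.eval μ)

end Expr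

/-- Programs. `assign a i e` is `a[i] := e`; `read a i` moves the next number of the input stream to
`a[i]` (or `0` if the stream has ended); `flip a i` stores a fresh coin flip in `a[i]`. -/
inductive Prog where
  | skip
  | assign (a : ℕ) (i e : Expr)
  | read (a : ℕ) (i : Expr)
  | flip (a : ℕ) (i : Expr)
  | seq (p q : Prog)
  | ite (e : Expr) (p q : Prog)
  | while (e : Expr) (p : Prog)

/-- A state: the memory, the unread part of the input stream, and the coin flips to come. -/
structure State where
  mem : Mem
  input : List ℕ
  coins : ℕ → Bool

/-- `Exec p s s' t b`: the program `p`, started in the state `s`, halts in the state `s'` after time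
`t` (logarithmic cost), and the largest number of bits of memory in use at any moment is `b`. -/
inductive Exec : Prog → State → State → ℕ → ℕ → Prop
  | skip (s : State) : Exec .skip s s 1 s.mem.bits
  | assign (s : State) (a : ℕ) (i e : Expr) (μ : Mem)
      (hμ : μ = s.mem.update (a, i.eval s.mem) (e.eval s.mem)) :
      Exec (.assign a i e) s ⟨μ, s.input, s.coins⟩
        (1 + i.cost s.mem + e.cost s.mem + Nat.size (i.eval s.mem) + Nat.size (e.eval s.mem))
        (max s.mem.bits μ.bits)
  | read (s : State) (a : ℕ) (i : Expr) (μ : Mem)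
      (hμ : μ = s.mem.update (a, i.eval s.mem) (s.input.headD 0)) :
      Exec (.read a i) s ⟨μ, s.input.tail, s.coins⟩
        (1 + i.cost s.mem + Nat.size (i.eval s.mem) + Nat.size (s.input.headD 0))
        (max s.mem.bits μ.bits)
  | flip (s : State) (a : ℕ) (i : Expr) (μ : Mem)
      (hμ : μ = s.mem.update (a, i.eval s.mem) (s.coins 0).toNat) :
      Exec (.flip a i) s ⟨μ, s.input, fun j => s.coins (j + 1)⟩
        (2 + i.cost s.mem + Nat.size (i.eval s.mem))
        (max s.mem.bits μ.bits)
  | seq {p q : Prog} {s s' s'' : State} {t t' b b' : ℕ} :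
      Exec p s s' t b → Exec q s' s'' t' b' → Exec (.seq p q) s s'' (t + t') (max b b')
  | ite_true {e : Expr} {p q : Prog} {s s' : State} {t b : ℕ} :
      e.eval s.mem ≠ 0 → Exec p s s' t b → Exec (.ite e p q) s s' (1 + e.cost s.mem + t) b
  | ite_false {e : Expr} {p q : Prog} {s s' : State} {t b : ℕ} :
      e.eval s.mem = 0 → Exec q s s' t b → Exec (.ite e p q) s s' (1 + e.cost s.mem + t) b
  | while_true {e : Expr} {p : Prog} {s s' s'' : State} {t t' b b' : ℕ} :
      e.eval s.mem ≠ 0 → Exec p s s' t b → Exec (.while e p) s' s'' t' b' →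
      Exec (.while e p) s s'' (1 + e.cost s.mem + t + t') (max b b')
  | while_false {e : Expr} {p : Prog} {s : State} :
      e.eval s.mem = 0 → Exec (.while e p) s s (1 + e.cost s.mem) s.mem.bits

/-- The output: the IDs `i < m` whose cell in the array `2` is nonzero. -/
def State.selected (s : State) (m : ℕ) : Finset (Fin m) :=
  Finset.univ.filter (fun i => s.mem (2, i.val) ≠ 0)

/-! ## Offline algorithms -/

/-- The start of an offline algorithm on a family `C` of `l` subsets of a universe of size `n`: the
array `0` holds `n, l`, and the array `1` holds the tokens of `C`. The input stream is empty. -/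
noncomputable def offlineStart {n l : ℕ} (C : Family n l) (ω : ℕ → Bool) : State :=
  ⟨Mem.ofList 0 [n, l] + Mem.ofList 1 C.tokens, [], ω⟩

/-- `A` is a polynomial-time algorithm: its running time on `l` subsets of a universe of size `n` is
bounded by a polynomial in `l` and `n`, on any coin flips (a deterministic program ignores them). -/
def PolyTime (A : Prog) : Prop :=
  ∃ K : ℕ, ∀ (n l : ℕ) (C : Family n l) (ω : ℕ → Bool),
    ∃ s t b, Exec A (offlineStart C ω) s t b ∧ t ≤ K * (n + l + 1) ^ K

/-- `A` has unique coverage ratio `φ`: whenever `C` consists of at most `k` sets of size at most `d`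
such that no element has a frequency of more than `r`, the subcollection `B` of `C` that `A` returns
satisfies `|cover C| ≤ φ k r d * |uniqueCover B|`. -/
def HasUniqueCoverageRatio (A : Prog) (φ : ℕ → ℕ → ℕ → ℝ) : Prop :=
  ∀ k r d : ℕ, 2 ≤ k → 2 ≤ r → 2 ≤ d →
    ∀ (n l : ℕ) (C : Family n l) (ω : ℕ → Bool),
      l ≤ k → maxFreq C.sets ≤ r → maxSize C.sets ≤ d →
      ∃ s t b, Exec A (offlineStart C ω) s t b ∧
        ((cover C.sets Finset.univ).card : ℝ)
          ≤ φ k r d * ((uniqueCover C.sets (s.selected l)).card : ℝ)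

/-! ## Single-pass streaming algorithms -/

/-- A single-pass streaming algorithm: a program for the pass over the stream, and a program that
computes the output after it, without access to the stream. -/
structure StreamAlg where
  pass : Prog
  post : Prog

/-- The start of a streaming algorithm: the array `0` holds `n, m, k, ⌈1/ε⌉`, and the stream of the
sets is unread. -/
noncomputable def streamStart {n m : ℕ} (V : Family n m) (k : ℕ) (ε : ℝ) (ω : ℕ → Bool) : State :=
  ⟨Mem.ofList 0 [n, m, k, ⌈1 / ε⌉₊], V.tokens, ω⟩

/-- `P`, started in `s`, halts in `s'` after time `t`, with a peak memory of `b` bits until the end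
of the pass, and of `b'` bits from then on. -/
def StreamAlg.Run (P : StreamAlg) (s s' : State) (t b b' : ℕ) : Prop :=
  ∃ (s₁ : State) (t₁ t₂ : ℕ), Exec P.pass s s₁ t₁ b ∧
    Exec P.post ⟨s₁.mem, [], s₁.coins⟩ s' t₂ b' ∧ t = t₁ + t₂

/-- The law of an infinite sequence of independent fair coin flips. -/
noncomputable def coinLaw : MeasureTheory.Measure (ℕ → Bool) :=
  MeasureTheory.Measure.infinitePi (fun _ : ℕ => (PMF.uniformOfFintype Bool).toMeasure)

end MUC

/-!
# Max Unique Coverage in one pass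

The algorithm guesses the optimum `OPT` up to a factor of `1 + 1 / E`, where `E = ⌈1 / ε⌉`, and runs
one instance for each of the `s * E` guesses, `s = O(log (m * n))`. An instance with a guess `v` of
size about `2 ^ j` samples the universe with probability `p ≈ Λ / 2 ^ j`, where `Λ` is
`Θ(k * s * E ^ 2)`, by means of a hash function that all instances share: a polynomial of degree
less than `t = Θ(k * s)` over a prime field, with coefficients from the coins. During the pass it
keeps the sampled part of a set whenever it has fewer than `k` sets so far, the sampled part is not
too large, and it adds at least `p * v / (2 * k)` elements to the sampled cover. After the pass, the
last instance whose sampled cover has about `p * v / 2` elements is chosen, and the offline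
algorithm `A` runs on its log; the sets that `A` selects are the output.

*Approximation.* By a moment bound (`card_large_dev_le`), which transfers from independent values
because `t`-th moments involve at most `t` hash values at a time (`moment_eq`), and a union bound
over all subcollections of at most `k` sets, samples of unique covers are accurate on all scales
with probability at least `1 - 1 / m ^ c` (`Params.good_probability`). Then the instance with the
right guess is successful: either it has `k` sets, each of which adds `p * v / (2 * k)` elements, or
every set of an optimal solution adds less than that to its cover (`sieve_cover`,
`Params.succ_of_guess`). A successful instance has a sampled cover of about `p * v / 2` elements, so
that the sets returned by `A` cover uniquely about `p * v / (2 * φ)` elements of the sample, and by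
accuracy about `v / (2 * φ)` elements of the universe (`Params.isApprox_of_good`). A ratio `φ` is
always at least `1` (`one_le_ratio`).

*Time and space.* A program logic (`Wp`) certifies that a program, run inside a finite region of
memory with bounded numbers, halts within a polynomial time bound that is read off its syntax
(`Prog.timeBound`), and that its memory never exceeds the size of the region. The region of the pass
is dominated by the logs of the instances, which take `s * E * k * O(Λ)` words of logarithmic length
(`Params.space_le`). The program `A` is run with its arrays renumbered, next to the memory of the
streaming algorithm (`Exec.frame`); this memory is added to that of `A`, and `Params.exists_run`
puts the parts together.
-/

namespace MUC

/-! ### Time and space of programs whose memory stays within a fixed region -/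

/-- A bound, in units of the word length, on the cost and on the length of the value of an
expression in a memory whose cells hold single words. -/
def Expr.weight : Expr → ℕ
  | .lit c => 1 + Nat.size c
  | .get _ e => 2 + 2 * e.weight
  | .bin _ e₁ e₂ => 1 + 2 * e₁.weight + 2 * e₂.weight

theorem size_add_le (x y : ℕ) : Nat.size (x + y) ≤ Nat.size x + Nat.size y + 1 := by
  rw [Nat.size_le]
  have hx := Nat.lt_size_self x
  have hy := Nat.lt_size_self y
  have h1 : 2 ^ Nat.size x ≤ 2 ^ (Nat.size x + Nat.size y) :=
    Nat.pow_le_pow_right (by norm_num) (by omega)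
  have h2 : 2 ^ Nat.size y ≤ 2 ^ (Nat.size x + Nat.size y) :=
    Nat.pow_le_pow_right (by norm_num) (by omega)
  rw [pow_succ]
  omega

theorem size_mul_le (x y : ℕ) : Nat.size (x * y) ≤ Nat.size x + Nat.size y := by
  rw [Nat.size_le, pow_add]
  exact Nat.mul_lt_mul'' (Nat.lt_size_self x) (Nat.lt_size_self y)

theorem size_op_le (o : Op) (x y : ℕ) :
    Nat.size (o.eval x y) ≤ Nat.size x + Nat.size y + 1 := by
  have h1 : Nat.size 1 = 1 := Nat.size_one
  have h0 : Nat.size 0 = 0 := Nat.size_zero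
  cases o <;> simp only [Op.eval]
  · exact size_add_le x y
  · have := Nat.size_le_size (Nat.sub_le x y); omega
  · have := size_mul_le x y; omega
  · have := Nat.size_le_size (Nat.div_le_self x y); omega
  · have := Nat.size_le_size (Nat.mod_le x y); omega
  · split_ifs <;> omega
  · split_ifs <;> omega

theorem Expr.cost_size_le {μ : Mem} {w : ℕ} (hw : 1 ≤ w) (hμ : ∀ p, Nat.size (μ p) ≤ w)
    (e : Expr) : e.cost μ ≤ e.weight * w ∧ Nat.size (e.eval μ) ≤ e.weight * w := by
  induction e with
  | lit c =>
    simp only [Expr.cost, Expr.eval, Expr.weight]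
    constructor <;> nlinarith
  | get a e ih =>
    have := hμ (a, e.eval μ)
    simp only [Expr.cost, Expr.eval, Expr.weight]
    constructor <;> nlinarith [ih.1, ih.2]
  | bin o e₁ e₂ ih₁ ih₂ =>
    have := size_op_le o (e₁.eval μ) (e₂.eval μ)
    simp only [Expr.cost, Expr.eval, Expr.weight]
    constructor <;> nlinarith [ih₁.1, ih₁.2, ih₂.1, ih₂.2]

/-- A time bound for a program all of whose loops are run at most `N` times, in a memory with words
of length `w`. -/
def Prog.timeBound (N w : ℕ) : Prog → ℕ
  | .skip => w
  | .assign _ i e => (1 + 2 * i.weight + 2 * e.weight) * w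
  | .read _ i => (2 + 2 * i.weight) * w
  | .flip _ i => (2 + 2 * i.weight) * w
  | .seq p q => p.timeBound N w + q.timeBound N w
  | .ite e p q => (1 + e.weight) * w + p.timeBound N w + q.timeBound N w
  | .while e p => (N + 1) * ((1 + e.weight) * w + p.timeBound N w)

theorem Prog.timeBound_poly (p : Prog) :
    ∃ K : ℕ, ∀ N w : ℕ, p.timeBound N w ≤ K * (N + 1) ^ K * w := by
  have lin : ∀ a : ℕ, ∃ K : ℕ, ∀ N w : ℕ, a * w ≤ K * (N + 1) ^ K * w := fun a =>
    ⟨a, fun N w => Nat.mul_le_mul_right _ (Nat.le_mul_of_pos_right _ (by positivity))⟩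
  have mono : ∀ {K K' : ℕ} (N w : ℕ), K ≤ K' → K * (N + 1) ^ K * w ≤ K * (N + 1) ^ K' * w :=
    fun N w h => Nat.mul_le_mul_right _ (Nat.mul_le_mul_left _
      (Nat.pow_le_pow_right (Nat.succ_pos _) h))
  induction p with
  | skip => simpa [Prog.timeBound] using lin 1
  | assign a i e => exact lin _
  | read a i => exact lin _
  | flip a i => exact lin _
  | seq p q hp hq =>
    obtain ⟨K₁, h₁⟩ := hp
    obtain ⟨K₂, h₂⟩ := hq
    refine ⟨K₁ + K₂, fun N w => ?_⟩
    have a := (h₁ N w).trans (mono (K' := K₁ + K₂) N w (by omega))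
    have b := (h₂ N w).trans (mono (K' := K₁ + K₂) N w (by omega))
    simp only [Prog.timeBound]
    calc _ ≤ _ := add_le_add a b
      _ = _ := by ring
  | ite e p q hp hq =>
    obtain ⟨K₀, h₀⟩ := lin (1 + e.weight)
    obtain ⟨K₁, h₁⟩ := hp
    obtain ⟨K₂, h₂⟩ := hq
    refine ⟨K₀ + K₁ + K₂, fun N w => ?_⟩
    have z := (h₀ N w).trans (mono (K' := K₀ + K₁ + K₂) N w (by omega))
    have a := (h₁ N w).trans (mono (K' := K₀ + K₁ + K₂) N w (by omega))
    have b := (h₂ N w).trans (mono (K' := K₀ + K₁ + K₂) N w (by omega))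
    simp only [Prog.timeBound]
    calc _ ≤ _ := add_le_add (add_le_add z a) b
      _ = _ := by ring
  | _ e p hp =>
    obtain ⟨K₀, h₀⟩ := lin (1 + e.weight)
    obtain ⟨K₁, h₁⟩ := hp
    refine ⟨K₀ + K₁ + 1, fun N w => ?_⟩
    have z := (h₀ N w).trans (mono (K' := K₀ + K₁) N w (by omega))
    have a := (h₁ N w).trans (mono (K' := K₀ + K₁) N w (by omega))
    simp only [Prog.timeBound]
    calc _ ≤ (N + 1) * ((K₀ + K₁) * (N + 1) ^ (K₀ + K₁) * w) :=
          Nat.mul_le_mul_left _ ((add_le_add z a).trans (le_of_eq (by ring)))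
      _ = (K₀ + K₁) * (N + 1) ^ (K₀ + K₁ + 1) * w := by ring
      _ ≤ _ := Nat.mul_le_mul_right _ (Nat.mul_le_mul_right _ (by omega))

/-- A region of the memory for a program to work in: cells of `F` may hold numbers up to `N`, and
all other cells keep the contents they have in `ν`. All contents have length at most `w`. -/
structure Region where
  F : Finset (ℕ × ℕ)
  N : ℕ
  w : ℕ
  ν : Mem
  one_le : 1 ≤ w
  size_N : Nat.size N ≤ w
  size_ν : ∀ p, Nat.size (ν p) ≤ w

/-- The memory `μ` uses the region `L` as allowed. -/
def Region.Fits (L : Region) (μ : Mem) : Prop :=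
  (∀ p ∈ L.F, μ p ≤ L.N) ∧ ∀ p ∉ L.F, μ p = L.ν p

/-- The largest number of bits of a memory that fits the region. -/
noncomputable def Region.bits (L : Region) : ℕ :=
  ∑ p ∈ L.F, (Nat.size p.2 + Nat.size L.N) + L.ν.bits

variable {L : Region} {s : State} {Q Q' : State → Prop} {p q : Prog}

theorem Region.Fits.size_le {μ : Mem} (h : L.Fits μ) (x : ℕ × ℕ) : Nat.size (μ x) ≤ L.w := by
  by_cases hx : x ∈ L.F
  · exact (Nat.size_le_size (h.1 x hx)).trans L.size_N
  · rw [h.2 x hx]; exact L.size_ν x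

theorem Region.Fits.bits_le {μ : Mem} (h : L.Fits μ) : μ.bits ≤ L.bits := by
  classical
  unfold Mem.bits Region.bits Mem.bits Finsupp.sum
  rw [← Finset.sum_filter_add_sum_filter_not μ.support (fun x => x ∈ L.F)]
  refine add_le_add ?_ ?_
  · refine (Finset.sum_le_sum (g := fun x => Nat.size x.2 + Nat.size L.N) fun x hx => ?_).trans
      (Finset.sum_le_sum_of_subset fun x hx => (Finset.mem_filter.1 hx).2)
    exact Nat.add_le_add_left (Nat.size_le_size (h.1 x (Finset.mem_filter.1 hx).2)) _
  · have hν : ∀ x ∈ μ.support.filter (fun x => x ∉ L.F), μ x = L.ν x :=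
      fun x hx => h.2 x (Finset.mem_filter.1 hx).2
    refine (Finset.sum_le_sum (g := fun x => Nat.size x.2 + Nat.size (L.ν x)) fun x hx => ?_).trans
      (Finset.sum_le_sum_of_subset fun x hx => ?_)
    · rw [hν x hx]
    · rw [Finsupp.mem_support_iff, ← hν x hx]
      exact Finsupp.mem_support_iff.1 (Finset.mem_filter.1 hx).1

theorem Region.Fits.update {μ : Mem} (h : L.Fits μ) {x : ℕ × ℕ} {v : ℕ} (hx : x ∈ L.F)
    (hv : v ≤ L.N) : L.Fits (μ.update x v) := by
  constructor
  · intro y hy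
    rw [Finsupp.coe_update, Function.update_apply]
    split_ifs with e
    exacts [hv, h.1 y hy]
  · intro y hy
    rw [Finsupp.coe_update, Function.update_of_ne (by rintro rfl; exact hy hx)]
    exact h.2 y hy

/-! ### A program logic -/

/-- Started in `s` within the region `L`, the program `p` halts within its time bound in a state
with the property `Q`, and never leaves the region. -/
def Wp (L : Region) (p : Prog) (Q : State → Prop) (s : State) : Prop :=
  L.Fits s.mem → ∃ s' t b, Exec p s s' t b ∧ t ≤ p.timeBound L.N L.w ∧ b ≤ L.bits ∧
    L.Fits s'.mem ∧ Q s'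

theorem Wp.mono (h : Wp L p Q s) (hQ : ∀ s', L.Fits s'.mem → Q s' → Q' s') : Wp L p Q' s := by
  intro hs
  obtain ⟨s', t, b, h1, h2, h3, h4, h5⟩ := h hs
  exact ⟨s', t, b, h1, h2, h3, h4, hQ s' h4 h5⟩

theorem wp_skip (h : Q s) : Wp L .skip Q s := fun hs =>
  ⟨s, _, _, .skip s, L.one_le, hs.bits_le, hs, h⟩

theorem wp_assign {a : ℕ} {i e : Expr} (hi : (a, i.eval s.mem) ∈ L.F) (he : e.eval s.mem ≤ L.N)
    (h : Q ⟨s.mem.update (a, i.eval s.mem) (e.eval s.mem), s.input, s.coins⟩) :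
    Wp L (.assign a i e) Q s := by
  intro hs
  have hs' := hs.update hi he
  refine ⟨_, _, _, .assign s a i e _ rfl, ?_, max_le hs.bits_le hs'.bits_le, hs', h⟩
  have h1 := i.cost_size_le L.one_le hs.size_le
  have h2 := e.cost_size_le L.one_le hs.size_le
  have := L.one_le
  simp only [Prog.timeBound]
  nlinarith [h1.1, h1.2, h2.1, h2.2]

theorem wp_read {a : ℕ} {i : Expr} (hi : (a, i.eval s.mem) ∈ L.F) (he : s.input.headD 0 ≤ L.N)
    (h : Q ⟨s.mem.update (a, i.eval s.mem) (s.input.headD 0), s.input.tail, s.coins⟩) :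
    Wp L (.read a i) Q s := by
  intro hs
  have hs' := hs.update hi he
  refine ⟨_, _, _, .read s a i _ rfl, ?_, max_le hs.bits_le hs'.bits_le, hs', h⟩
  have h1 := i.cost_size_le L.one_le hs.size_le
  have h2 := (Nat.size_le_size he).trans L.size_N
  have := L.one_le
  simp only [Prog.timeBound]
  nlinarith [h1.1, h1.2]

theorem wp_flip {a : ℕ} {i : Expr} (hi : (a, i.eval s.mem) ∈ L.F) (hN : 1 ≤ L.N)
    (h : Q ⟨s.mem.update (a, i.eval s.mem) (s.coins 0).toNat, s.input,
      fun j => s.coins (j + 1)⟩) :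
    Wp L (.flip a i) Q s := by
  intro hs
  have hs' := hs.update hi ((Bool.toNat_le (s.coins 0)).trans hN)
  refine ⟨_, _, _, .flip s a i _ rfl, ?_, max_le hs.bits_le hs'.bits_le, hs', h⟩
  have h1 := i.cost_size_le L.one_le hs.size_le
  have := L.one_le
  simp only [Prog.timeBound]
  nlinarith [h1.1, h1.2]

theorem wp_seq (h : Wp L p (Wp L q Q) s) : Wp L (.seq p q) Q s := by
  intro hs
  obtain ⟨s', t, b, h1, h2, h3, h4, h5⟩ := h hs
  obtain ⟨s'', t', b', g1, g2, g3, g4, g5⟩ := h5 h4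
  exact ⟨s'', _, _, .seq h1 g1, add_le_add h2 g2, max_le h3 g3, g4, g5⟩

theorem wp_ite {e : Expr} (h1 : e.eval s.mem ≠ 0 → Wp L p Q s)
    (h0 : e.eval s.mem = 0 → Wp L q Q s) : Wp L (.ite e p q) Q s := by
  intro hs
  have hc := (e.cost_size_le L.one_le hs.size_le).1
  have := L.one_le
  by_cases he : e.eval s.mem = 0
  · obtain ⟨s', t, b, g1, g2, g3, g4, g5⟩ := h0 he hs
    refine ⟨s', _, b, .ite_false he g1, ?_, g3, g4, g5⟩
    simp only [Prog.timeBound]; nlinarith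
  · obtain ⟨s', t, b, g1, g2, g3, g4, g5⟩ := h1 he hs
    refine ⟨s', _, b, .ite_true he g1, ?_, g3, g4, g5⟩
    simp only [Prog.timeBound]; nlinarith

/-- The rule for loops: `J i` holds after `i` rounds, and there are at most `R ≤ N` of them. -/
theorem wp_while {e : Expr} (J : ℕ → State → Prop) (R : ℕ) (hR : R ≤ L.N) (h0 : J 0 s)
    (hJ : ∀ i s, L.Fits s.mem → J i s → (e.eval s.mem = 0 → Q s) ∧
      (e.eval s.mem ≠ 0 → i < R ∧ Wp L p (J (i + 1)) s)) :
    Wp L (.while e p) Q s := by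
  have key : ∀ d i s, d + i = R → J i s → L.Fits s.mem →
      ∃ s' t b, Exec (.while e p) s s' t b ∧
        t ≤ (d + 1) * ((1 + e.weight) * L.w + p.timeBound L.N L.w) ∧ b ≤ L.bits ∧
        L.Fits s'.mem ∧ Q s' := by
    intro d
    have := L.one_le
    induction d with
    | zero =>
      intro i s hi hs hF
      have hc := (e.cost_size_le L.one_le hF.size_le).1
      by_cases he : e.eval s.mem = 0
      · refine ⟨s, _, _, .while_false he, ?_, hF.bits_le, hF, (hJ i s hF hs).1 he⟩
        nlinarith
      · exact absurd ((hJ i s hF hs).2 he).1 (by omega)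
    | succ d ih =>
      intro i s hi hs hF
      have hc := (e.cost_size_le L.one_le hF.size_le).1
      by_cases he : e.eval s.mem = 0
      · refine ⟨s, _, _, .while_false he, ?_, hF.bits_le, hF, (hJ i s hF hs).1 he⟩
        nlinarith
      · obtain ⟨s', t, b, g1, g2, g3, g4, g5⟩ := ((hJ i s hF hs).2 he).2 hF
        obtain ⟨s'', t', b', k1, k2, k3, k4, k5⟩ := ih (i + 1) s' (by omega) g5 g4
        refine ⟨s'', _, _, .while_true he g1 k1, ?_, max_le g3 k3, k4, k5⟩
        have : 1 + e.cost s.mem ≤ (1 + e.weight) * L.w := by nlinarith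
        nlinarith
  intro hs
  obtain ⟨s', t, b, g1, g2, g3⟩ := key R 0 s (by omega) h0 hs
  refine ⟨s', t, b, g1, g2.trans ?_, g3⟩
  simp only [Prog.timeBound]
  exact Nat.mul_le_mul_right _ (by omega)

/-- The loop `for x = 0, 1, …` while `x < e`, whose counter is the cell `x` of the array `4`. -/
def Prog.loop (x : ℕ) (e : Expr) (p : Prog) : Prog :=
  .seq (.assign 4 (.lit x) (.lit 0))
    (.while (.bin .lt (.get 4 (.lit x)) e)
      (.seq p (.assign 4 (.lit x) (.bin .add (.get 4 (.lit x)) (.lit 1)))))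

theorem wp_loop {x : ℕ} {e : Expr} (J : ℕ → State → Prop) (R : ℕ) (hR : R ≤ L.N)
    (hx : (4, x) ∈ L.F)
    (h0 : J 0 ⟨s.mem.update (4, x) 0, s.input, s.coins⟩)
    (he : ∀ i s, J i s → e.eval s.mem = R)
    (hJ : ∀ i s, L.Fits s.mem → i < R → s.mem (4, x) = i → J i s →
      Wp L p (fun s' => s'.mem (4, x) = i ∧
        J (i + 1) ⟨s'.mem.update (4, x) (i + 1), s'.input, s'.coins⟩) s)
    (hQ : ∀ s, L.Fits s.mem → s.mem (4, x) = R → J R s → Q s) :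
    Wp L (.loop x e p) Q s := by
  refine wp_seq (wp_assign hx (Nat.zero_le _) ?_)
  refine wp_while (fun i s => s.mem (4, x) = i ∧ i ≤ R ∧ J i s) R hR
    ⟨by simp [Expr.eval], Nat.zero_le _, h0⟩ ?_
  rintro i s hF ⟨h1, h2, h3⟩
  have ev : (Expr.bin .lt (.get 4 (.lit x)) e).eval s.mem = if i < R then 1 else 0 := by
    simp [Expr.eval, Op.eval, h1, he i s h3]
  rw [ev]
  constructor
  · intro h
    have hi : i = R := by
      by_contra hne
      rw [if_pos (by omega)] at h
      omega
    subst hi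
    exact hQ s hF h1 h3
  · intro h
    have hi : i < R := by
      by_contra hne
      rw [if_neg hne] at h
      omega
    refine ⟨hi, wp_seq ((hJ i s hF hi h1 h3).mono ?_)⟩
    rintro s' hF' ⟨g1, g2⟩
    refine wp_assign hx ?_ ⟨?_, hi, ?_⟩
    · simp [Expr.eval, Op.eval, g1]; omega
    · simp [Expr.eval, Op.eval, g1]
    · simpa [Expr.eval, Op.eval, g1] using g2

/-! ### Bits along an execution -/

theorem bits_update_le (μ : Mem) (x : ℕ × ℕ) (v : ℕ) :
    Mem.bits (μ.update x v) ≤ μ.bits + (Nat.size x.2 + Nat.size v) := by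
  classical
  unfold Mem.bits Finsupp.sum
  have hsub : (μ.update x v).support ⊆ insert x (μ.support.erase x) := by
    intro y hy
    rw [Finsupp.mem_support_iff, Finsupp.coe_update, Function.update_apply] at hy
    split_ifs at hy with e
    · simp [e]
    · simp [e, hy]
  refine (Finset.sum_le_sum_of_subset hsub).trans ?_
  rw [Finset.sum_insert (by simp), add_comm]
  refine add_le_add ?_ (by simp)
  refine (Finset.sum_le_sum_of_subset (Finset.erase_subset x μ.support)).trans' ?_
  refine Finset.sum_le_sum fun y hy => ?_
  rw [Finsupp.coe_update, Function.update_of_ne (Finset.ne_of_mem_erase hy)]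

theorem Exec.bits_le {s' : State} {t b : ℕ} (h : Exec p s s' t b) :
    s'.mem.bits ≤ b ∧ b ≤ s.mem.bits + t ∧ s'.mem.bits ≤ s.mem.bits + t := by
  induction h with
  | skip s => omega
  | assign s a i e μ hμ =>
    have := bits_update_le s.mem (a, i.eval s.mem) (e.eval s.mem)
    subst hμ
    refine ⟨le_max_right _ _, max_le (by omega) ?_, ?_⟩ <;> dsimp at * <;> omega
  | read s a i μ hμ =>
    have := bits_update_le s.mem (a, i.eval s.mem) (s.input.headD 0)
    subst hμ
    refine ⟨le_max_right _ _, max_le (by omega) ?_, ?_⟩ <;> dsimp at * <;> omega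
  | flip s a i μ hμ =>
    have := bits_update_le s.mem (a, i.eval s.mem) (s.coins 0).toNat
    have h1 : Nat.size (s.coins 0).toNat ≤ 1 :=
      (Nat.size_le_size (Bool.toNat_le _)).trans Nat.size_one.le
    subst hμ
    refine ⟨le_max_right _ _, max_le (by omega) ?_, ?_⟩ <;> dsimp at * <;> omega
  | seq _ _ ih₁ ih₂ => refine ⟨le_max_of_le_right ih₂.1, max_le ?_ ?_, ?_⟩ <;> omega
  | ite_true _ _ ih => omega
  | ite_false _ _ ih => omega
  | while_true _ _ _ ih₁ ih₂ => refine ⟨le_max_of_le_right ih₂.1, max_le ?_ ?_, ?_⟩ <;> omega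
  | while_false => omega

theorem size_le_bits (μ : Mem) (x : ℕ × ℕ) : Nat.size (μ x) ≤ μ.bits := by
  by_cases h : μ x = 0
  · simp [h]
  · refine le_trans ?_ (Finset.single_le_sum
      (f := fun y => Nat.size y.2 + Nat.size (μ y)) (fun _ _ => Nat.zero_le _)
      (Finsupp.mem_support_iff.2 h))
    exact Nat.le_add_left _ _

/-! ### Running a program in arrays of its own -/

/-- The expression with all arrays renumbered by `d`. -/
def Expr.shift (d : ℕ) : Expr → Expr
  | .lit c => .lit c
  | .get a e => .get (a + d) (e.shift d)
  | .bin o e₁ e₂ => .bin o (e₁.shift d) (e₂.shift d)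

/-- The program with all arrays renumbered by `d`. -/
def Prog.shift (d : ℕ) : Prog → Prog
  | .skip => .skip
  | .assign a i e => .assign (a + d) (i.shift d) (e.shift d)
  | .read a i => .read (a + d) (i.shift d)
  | .flip a i => .flip (a + d) (i.shift d)
  | .seq p q => .seq (p.shift d) (q.shift d)
  | .ite e p q => .ite (e.shift d) (p.shift d) (q.shift d)
  | .while e p => .while (e.shift d) (p.shift d)

/-- Renumbering of the arrays, on cells. -/
def shiftCell (d : ℕ) : ℕ × ℕ ↪ ℕ × ℕ :=
  ⟨fun x => (x.1 + d, x.2), fun x y h => by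
    simp only [Prod.mk.injEq] at h
    exact Prod.ext (by omega) h.2⟩

/-- The memory with all arrays renumbered by `d`. -/
noncomputable def Mem.shift (d : ℕ) (μ : Mem) : Mem := μ.embDomain (shiftCell d)

theorem Mem.shift_apply (d : ℕ) (μ : Mem) (a i : ℕ) : μ.shift d (a + d, i) = μ (a, i) :=
  Finsupp.embDomain_apply_self (shiftCell d) μ (a, i)

theorem Mem.shift_of_lt (d : ℕ) (μ : Mem) {a : ℕ} (i : ℕ) (ha : a < d) : μ.shift d (a, i) = 0 := by
  refine Finsupp.embDomain_of_notMem_range _ _ _ ?_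
  rintro ⟨x, hx⟩
  have : x.1 + d = a := congrArg Prod.fst hx
  omega

theorem bits_shift (d : ℕ) (μ : Mem) : (μ.shift d).bits = μ.bits := by
  unfold Mem.bits Mem.shift
  rw [Finsupp.sum_embDomain]
  rfl

section Frame

variable {d : ℕ} {ν : Mem}

theorem bits_frame (hν : ∀ a i, d ≤ a → ν (a, i) = 0) (μ : Mem) :
    (ν + μ.shift d).bits = ν.bits + μ.bits := by
  rw [← bits_shift d μ]
  unfold Mem.bits
  refine Finsupp.sum_add_index_of_disjoint ?_ _
  rw [Finset.disjoint_left]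
  rintro ⟨a, i⟩ h1 h2
  rw [Finsupp.mem_support_iff] at h1 h2
  by_cases ha : d ≤ a
  · exact h1 (hν a i ha)
  · exact h2 (Mem.shift_of_lt d μ i (by omega))

theorem frame_apply (hν : ∀ a i, d ≤ a → ν (a, i) = 0) (μ : Mem) (a i : ℕ) :
    (ν + μ.shift d) (a + d, i) = μ (a, i) := by
  rw [Finsupp.add_apply, hν _ _ (by omega), Mem.shift_apply, zero_add]

theorem frame_update (hν : ∀ a i, d ≤ a → ν (a, i) = 0) (μ : Mem) (a i v : ℕ) :
    (ν + μ.shift d).update (a + d, i) v = ν + Mem.shift d (μ.update (a, i) v) := by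
  ext ⟨b, j⟩
  rw [Finsupp.coe_update, Function.update_apply]
  by_cases hb : d ≤ b
  · obtain ⟨b, rfl⟩ := Nat.exists_eq_add_of_le' hb
    rw [frame_apply hν, frame_apply hν, Finsupp.coe_update, Function.update_apply]
    simp
  · rw [if_neg (by simp; omega), Finsupp.add_apply, Finsupp.add_apply,
      Mem.shift_of_lt _ _ _ (by omega), Mem.shift_of_lt _ _ _ (by omega)]

theorem Expr.shift_eval_cost (hν : ∀ a i, d ≤ a → ν (a, i) = 0) (μ : Mem) (e : Expr) :
    (e.shift d).eval (ν + μ.shift d) = e.eval μ ∧ (e.shift d).cost (ν + μ.shift d) = e.cost μ := by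
  induction e with
  | lit c => exact ⟨rfl, rfl⟩
  | get a e ih => simp only [Expr.shift, Expr.eval, Expr.cost, ih.1, ih.2, frame_apply hν, true_and]
  | bin o e₁ e₂ ih₁ ih₂ =>
    simp only [Expr.shift, Expr.eval, Expr.cost, ih₁.1, ih₁.2, ih₂.1, ih₂.2, true_and]

/-- The renumbered program behaves as the program, next to any memory in the arrays below `d`. -/
theorem Exec.frame (hν : ∀ a i, d ≤ a → ν (a, i) = 0) {s' : State} {t b : ℕ}
    (h : Exec p s s' t b) :
    Exec (p.shift d) ⟨ν + s.mem.shift d, s.input, s.coins⟩ ⟨ν + s'.mem.shift d, s'.input, s'.coins⟩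
      t (ν.bits + b) := by
  have ev := fun μ e => (Expr.shift_eval_cost hν μ e).1
  have co := fun μ e => (Expr.shift_eval_cost hν μ e).2
  induction h with
  | skip s =>
    rw [← bits_frame hν]
    exact .skip _
  | assign s a i e μ hμ =>
    have := Exec.assign ⟨ν + s.mem.shift d, s.input, s.coins⟩ (a + d) (i.shift d) (e.shift d) _ rfl
    simp only [ev, co, frame_update hν, ← hμ, bits_frame hν, max_add_add_left] at this
    exact this
  | read s a i μ hμ =>
    have := Exec.read ⟨ν + s.mem.shift d, s.input, s.coins⟩ (a + d) (i.shift d) _ rfl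
    simp only [ev, co, frame_update hν, ← hμ, bits_frame hν, max_add_add_left] at this
    exact this
  | flip s a i μ hμ =>
    have := Exec.flip ⟨ν + s.mem.shift d, s.input, s.coins⟩ (a + d) (i.shift d) _ rfl
    simp only [ev, co, frame_update hν, ← hμ, bits_frame hν, max_add_add_left] at this
    exact this
  | seq _ _ ih₁ ih₂ =>
    rw [← max_add_add_left]
    exact .seq ih₁ ih₂
  | @ite_true e p q s s' t b he _ ih =>
    rw [← co s.mem e]
    exact .ite_true (by simpa only [ev] using he) ih
  | @ite_false e p q s s' t b he _ ih =>
    rw [← co s.mem e]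
    exact .ite_false (by simpa only [ev] using he) ih
  | @while_true e p s s' s'' t t' b b' he _ _ ih₁ ih₂ =>
    rw [← co s.mem e, ← max_add_add_left]
    exact .while_true (by simpa only [ev] using he) ih₁ ih₂
  | @while_false e p s he =>
    rw [← co s.mem e, ← bits_frame hν]
    exact .while_false (by simpa only [ev] using he)

end Frame

end MUC

namespace MUC

/-! ### Hash functions of limited independence -/

section Hash

/-- A surjective homomorphism of finite groups maps the uniform distribution to the uniform
distribution. -/
theorem card_mul_sum_comp {A B : Type*} [AddCommGroup A] [Fintype A] [AddCommGroup B] [Fintype B]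
    (f : A →+ B) (hf : Function.Surjective f) (Φ : B → ℝ) :
    (Fintype.card B : ℝ) * ∑ a, Φ (f a) = Fintype.card A * ∑ b, Φ b := by
  classical
  have hfib : ∀ b, (Finset.univ.filter (fun a => f a = b)).card =
      (Finset.univ.filter (fun a => f a = 0)).card := fun b =>
    AddMonoidHom.card_fiber_eq_of_mem_range f (hf b) (hf 0)
  have hsum : ∀ Ψ : B → ℝ, ∑ a, Ψ (f a) =
      ((Finset.univ.filter (fun a => f a = 0)).card : ℝ) * ∑ b, Ψ b := by
    intro Ψ
    rw [← Finset.sum_fiberwise (s := Finset.univ) (g := f), Finset.mul_sum]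
    refine Finset.sum_congr rfl fun b _ => ?_
    rw [Finset.sum_congr rfl (g := fun _ => Ψ b)
      (fun a ha => by rw [(Finset.mem_filter.1 ha).2]), Finset.sum_const, hfib b, nsmul_eq_mul]
  have hA := hsum (fun _ => 1)
  simp only [Finset.sum_const, Finset.card_univ, nsmul_eq_mul, mul_one] at hA
  rw [hsum, hA]
  ring

variable {P : ℕ} [Fact P.Prime] {t : ℕ}

/-- The hash function with the coefficients `α`: a polynomial of degree less than `t`. -/
def hash (α : Fin t → ZMod P) (x : ZMod P) : ZMod P := ∑ i : Fin t, α i * x ^ (t - 1 - i.val)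

/-- The hash values of finitely many points, as a homomorphism in the coefficients. -/
def hashHom {τ : Type*} (pt : τ → ZMod P) : (Fin t → ZMod P) →+ (τ → ZMod P) where
  toFun α := fun j => hash α (pt j)
  map_zero' := by ext; simp [hash]
  map_add' α β := by ext; simp [hash, add_mul, Finset.sum_add_distrib]

theorem hashHom_surjective {τ : Type*} [Fintype τ] (pt : τ → ZMod P)
    (hpt : Function.Injective pt) (ht : Fintype.card τ ≤ t) :
    Function.Surjective (hashHom (t := t) pt) := by
  classical
  intro y
  let f := Lagrange.interpolate Finset.univ pt y
  have hinj : Set.InjOn pt (Finset.univ : Finset τ) := hpt.injOn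
  have hdeg : f.degree < t := (Lagrange.degree_interpolate_lt y hinj).trans_le
    (by rw [Finset.card_univ]; exact_mod_cast ht)
  refine ⟨fun i => f.coeff (t - 1 - i.val), funext fun j => ?_⟩
  have hev : f.eval (pt j) = y j := Lagrange.eval_interpolate_at_node y hinj (Finset.mem_univ j)
  rcases Nat.eq_zero_or_pos t with h0 | h0
  · subst h0
    exact ((Fintype.card_eq_zero_iff.1 (Nat.le_zero.1 ht)).false j).elim
  · have hnat : f.natDegree < t := by
      by_cases hf : f = 0
      · simpa [hf] using h0
      · exact (Polynomial.natDegree_lt_iff_degree_lt hf).2 hdeg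
    rw [← hev, Polynomial.eval_eq_sum_range' hnat, ← Finset.sum_range_reflect,
      ← Fin.sum_univ_eq_sum_range (fun i => f.coeff (t - 1 - i) * pt j ^ (t - 1 - i)) t]
    rfl

/-- The `t`-th moment of a sum over hash values is what it is for independent values, since it
involves at most `t` hash values at a time. -/
theorem moment_eq {ι : Type*} [Fintype ι] [DecidableEq ι] (pt : ι → ZMod P)
    (hpt : Function.Injective pt) (Y : ZMod P → ℝ) :
    (P : ℝ) ^ Fintype.card ι * ∑ α : Fin t → ZMod P, (∑ i, Y (hash α (pt i))) ^ t =
      (P : ℝ) ^ t * ∑ g : ι → ZMod P, (∑ i, Y (g i)) ^ t := by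
  classical
  simp only [Fintype.sum_pow]
  rw [Finset.sum_comm, Finset.sum_comm (s := (Finset.univ : Finset (ι → ZMod P))), Finset.mul_sum,
    Finset.mul_sum]
  refine Finset.sum_congr rfl fun f _ => ?_
  let τ := {x // x ∈ Finset.univ.image f}
  let Φ : (τ → ZMod P) → ℝ := fun b =>
    ∏ i, Y (b ⟨f i, Finset.mem_image_of_mem f (Finset.mem_univ i)⟩)
  have hcard : Fintype.card τ ≤ t := by
    rw [Fintype.card_coe]
    exact Finset.card_image_le.trans (by simp)
  have h1 := card_mul_sum_comp (hashHom (t := t) (fun j : τ => pt j.1))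
    (hashHom_surjective _ (hpt.comp Subtype.val_injective) hcard) Φ
  let res : (ι → ZMod P) →+ (τ → ZMod P) :=
    { toFun := fun g j => g j.1, map_zero' := rfl, map_add' := fun _ _ => rfl }
  have h2 := card_mul_sum_comp res (fun b =>
    ⟨fun i => if h : i ∈ Finset.univ.image f then b ⟨i, h⟩ else 0, funext fun j => by
      simp only [res, AddMonoidHom.coe_mk, ZeroHom.coe_mk]
      rw [dif_pos j.2]⟩) Φ
  simp only [Fintype.card_fun, ZMod.card, Fintype.card_fin, Nat.cast_pow] at h1 h2
  have hP : (P : ℝ) ^ Fintype.card τ ≠ 0 :=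
    pow_ne_zero _ (Nat.cast_ne_zero.2 (Fact.out : P.Prime).ne_zero)
  refine mul_left_cancel₀ hP ?_
  calc _ = (P : ℝ) ^ Fintype.card ι * ((P : ℝ) ^ Fintype.card τ *
        ∑ α : Fin t → ZMod P, Φ (hashHom (fun j : τ => pt j.1) α)) := by
        rw [mul_left_comm]; rfl
    _ = (P : ℝ) ^ t * ((P : ℝ) ^ Fintype.card τ * ∑ g : ι → ZMod P, Φ (res g)) := by
        rw [h1, h2]; ring
    _ = _ := by rw [mul_left_comm]; rfl

/-- The deviation of the indicator of the event `y < T` from its mean `T / P`. -/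
noncomputable def dev (P T : ℕ) (y : ZMod P) : ℝ := (if y.val < T then 1 else 0) - (T : ℝ) / P

theorem sum_exp_dev_le {T : ℕ} (hT : T ≤ P) {lam : ℝ} (hl : |lam| ≤ 1) :
    ∑ y : ZMod P, Real.exp (lam * dev P T y) ≤ P * Real.exp (lam ^ 2 * ((T : ℝ) / P)) := by
  have hP : (0 : ℝ) < P := Nat.cast_pos.2 (Fact.out : P.Prime).pos
  set p : ℝ := (T : ℝ) / P with hp
  have hp0 : 0 ≤ p := by positivity
  have hcard : ((Finset.univ.filter (fun y : ZMod P => y.val < T)).card : ℝ) = T := by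
    have : (Finset.univ.filter (fun y : ZMod P => y.val < T)).card = (Finset.range T).card := by
      refine Finset.card_bij (fun y _ => y.val) (fun y hy => ?_) (fun y _ z _ h => ?_)
        (fun b hb => ?_)
      · simpa using hy
      · exact ZMod.val_injective P h
      · have hb' : b < T := by simpa using hb
        have hv : (b : ZMod P).val = b := ZMod.val_cast_of_lt (hb'.trans_le hT)
        exact ⟨(b : ZMod P), by simp [hv, hb'], hv⟩
    rw [this, Finset.card_range]
  have e1 : ∀ y : ZMod P, Real.exp (lam * dev P T y) =
      Real.exp (-(lam * p)) * (1 + (if y.val < T then (Real.exp lam - 1) else 0)) := by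
    intro y
    unfold dev
    split_ifs
    · rw [add_sub_cancel, ← Real.exp_add]; congr 1; ring
    · rw [add_zero, mul_one]; congr 1; ring
  have e2 : ∑ y : ZMod P, Real.exp (lam * dev P T y) =
      P * (Real.exp (-(lam * p)) * (1 + p * (Real.exp lam - 1))) := by
    simp only [e1]
    rw [← Finset.mul_sum, Finset.sum_add_distrib, ← Finset.sum_filter, Finset.sum_const,
      Finset.sum_const, nsmul_eq_mul, nsmul_eq_mul, hcard, Finset.card_univ, ZMod.card, hp]
    field_simp
  rw [e2]
  refine mul_le_mul_of_nonneg_left ?_ hP.le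
  have h3 : Real.exp lam - 1 ≤ lam + lam ^ 2 := by
    have := (abs_le.1 (Real.abs_exp_sub_one_sub_id_le hl)).2
    linarith
  calc Real.exp (-(lam * p)) * (1 + p * (Real.exp lam - 1))
      ≤ Real.exp (-(lam * p)) * Real.exp (p * (lam + lam ^ 2)) := by
        refine mul_le_mul_of_nonneg_left ?_ (Real.exp_pos _).le
        refine le_trans ?_ (Real.add_one_le_exp _)
        nlinarith [mul_le_mul_of_nonneg_left h3 hp0]
    _ = _ := by rw [← Real.exp_add]; congr 1; ring

theorem sum_exp_sum_dev_le {ι : Type*} [Fintype ι] [DecidableEq ι] {T : ℕ} (hT : T ≤ P) {lam : ℝ}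
    (hl : |lam| ≤ 1) :
    ∑ g : ι → ZMod P, Real.exp (lam * ∑ i, dev P T (g i)) ≤
      (P : ℝ) ^ Fintype.card ι * Real.exp (lam ^ 2 * ((T : ℝ) / P) * Fintype.card ι) := by
  classical
  have h : ∑ g : ι → ZMod P, Real.exp (lam * ∑ i, dev P T (g i)) =
      (∑ y : ZMod P, Real.exp (lam * dev P T y)) ^ Fintype.card ι := by
    rw [← Finset.card_univ, ← Finset.prod_const,
      Finset.prod_univ_sum (fun _ : ι => (Finset.univ : Finset (ZMod P)))
        (fun _ y => Real.exp (lam * dev P T y)), Fintype.piFinset_univ]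
    refine Finset.sum_congr rfl fun g _ => ?_
    rw [Finset.mul_sum, Real.exp_sum]
  rw [h]
  refine (pow_le_pow_left₀ (Finset.sum_nonneg fun _ _ => (Real.exp_pos _).le)
    (sum_exp_dev_le hT hl) _).trans (le_of_eq ?_)
  rw [mul_pow, ← Real.exp_nat_mul]
  congr 2
  ring

theorem pow_le_factorial_mul_exp {t : ℕ} {lam : ℝ} (hl : 0 < lam) (z : ℝ) :
    |z| ^ t ≤ (t.factorial : ℝ) / lam ^ t * (Real.exp (lam * z) + Real.exp (-lam * z)) := by
  have h1 := Real.pow_div_factorial_le_exp (x := lam * |z|) (by positivity) t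
  have h2 : Real.exp (lam * |z|) ≤ Real.exp (lam * z) + Real.exp (-lam * z) := by
    rcases abs_cases z with ⟨h, _⟩ | ⟨h, _⟩ <;> rw [h]
    · linarith [Real.exp_pos (-lam * z)]
    · rw [mul_neg, ← neg_mul]; linarith [Real.exp_pos (lam * z)]
  have hf : (0 : ℝ) < t.factorial := by positivity
  have hlt : 0 < lam ^ t := by positivity
  rw [div_mul_eq_mul_div, le_div_iff₀ hlt]
  rw [div_le_iff₀ hf, mul_pow] at h1
  nlinarith [mul_le_mul_of_nonneg_left h2 hf.le]

/-- The tail bound for a sum over hash values, from its `t`-th moment, which is estimated by the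
moment generating function of independent values. -/
theorem card_large_dev_le {ι : Type*} [Fintype ι] [DecidableEq ι] (pt : ι → ZMod P)
    (hpt : Function.Injective pt)
    {T : ℕ} (hT : T ≤ P) (ht : Even t) {lam D : ℝ} (hl : 0 < lam) (hl1 : lam ≤ 1) (hD : 0 < D) :
    ((Finset.univ.filter (fun α : Fin t → ZMod P => D ≤ |∑ i, dev P T (hash α (pt i))|)).card : ℝ) ≤
      (P : ℝ) ^ t * ((t.factorial : ℝ) / (lam * D) ^ t *
        (2 * Real.exp (lam ^ 2 * ((T : ℝ) / P) * Fintype.card ι))) := by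
  have hP : (0 : ℝ) < P := Nat.cast_pos.2 (Fact.out : P.Prime).pos
  have hPi : (0 : ℝ) < (P : ℝ) ^ Fintype.card ι := by positivity
  have hDt : 0 < D ^ t := by positivity
  have h1 : ((Finset.univ.filter (fun α : Fin t → ZMod P =>
      D ≤ |∑ i, dev P T (hash α (pt i))|)).card : ℝ) * D ^ t ≤
      ∑ α : Fin t → ZMod P, (∑ i, dev P T (hash α (pt i))) ^ t := by
    rw [← nsmul_eq_mul, ← Finset.sum_const]
    refine (Finset.sum_le_sum fun α hα => ?_).trans
      (Finset.sum_le_univ_sum_of_nonneg fun α => ht.pow_nonneg _)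
    exact (pow_le_pow_left₀ hD.le (Finset.mem_filter.1 hα).2 t).trans (ht.pow_abs _).le
  have h2 : ∑ g : ι → ZMod P, (∑ i, dev P T (g i)) ^ t ≤ (t.factorial : ℝ) / lam ^ t *
      ((P : ℝ) ^ Fintype.card ι * (2 * Real.exp (lam ^ 2 * ((T : ℝ) / P) * Fintype.card ι))) := by
    have ha : |lam| ≤ 1 := by rwa [abs_of_pos hl]
    have ha' : |-lam| ≤ 1 := by rwa [abs_neg]
    calc _ ≤ ∑ g : ι → ZMod P, (t.factorial : ℝ) / lam ^ t *
          (Real.exp (lam * ∑ i, dev P T (g i)) + Real.exp (-lam * ∑ i, dev P T (g i))) :=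
          Finset.sum_le_sum fun g _ => by
            rw [← ht.pow_abs]; exact pow_le_factorial_mul_exp hl _
      _ = (t.factorial : ℝ) / lam ^ t * (∑ g : ι → ZMod P, Real.exp (lam * ∑ i, dev P T (g i)) +
            ∑ g : ι → ZMod P, Real.exp (-lam * ∑ i, dev P T (g i))) := by
          rw [← Finset.mul_sum, Finset.sum_add_distrib]
      _ ≤ _ := by
          refine mul_le_mul_of_nonneg_left ?_ (by positivity)
          have b1 := sum_exp_sum_dev_le (ι := ι) hT ha
          have b2 := sum_exp_sum_dev_le (ι := ι) hT ha'
          rw [neg_sq] at b2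
          linarith
  have h3 := moment_eq (t := t) pt hpt (dev P T)
  have h4 : ∑ α : Fin t → ZMod P, (∑ i, dev P T (hash α (pt i))) ^ t ≤ (P : ℝ) ^ t *
      ((t.factorial : ℝ) / lam ^ t *
        (2 * Real.exp (lam ^ 2 * ((T : ℝ) / P) * Fintype.card ι))) := by
    refine le_of_mul_le_mul_left ?_ hPi
    rw [h3]
    refine (mul_le_mul_of_nonneg_left h2 (by positivity)).trans (le_of_eq ?_)
    ring
  rw [← mul_le_mul_iff_left₀ hDt]
  refine h1.trans (h4.trans (le_of_eq ?_))
  rw [mul_pow]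
  field_simp

end Hash

/-! ### Reading the coefficients from the coins -/

section Coins

open MeasureTheory

/-- The number with the binary digits `ω off, …, ω (off + w - 1)`, the highest first. -/
def draw (ω : ℕ → Bool) (off : ℕ) : ℕ → ℕ
  | 0 => 0
  | w + 1 => 2 * draw ω off w + (ω (off + w)).toNat

theorem draw_lt (ω : ℕ → Bool) (off w : ℕ) : draw ω off w < 2 ^ w := by
  induction w with
  | zero => simp [draw]
  | succ w ih =>
    have := Bool.toNat_le (ω (off + w))
    rw [draw, pow_succ]
    omega

theorem draw_inj {ω ω' : ℕ → Bool} {off w : ℕ} (h : draw ω off w = draw ω' off w) :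
    ∀ i < w, ω (off + i) = ω' (off + i) := by
  induction w with
  | zero => simp
  | succ w ih =>
    have h1 := Bool.toNat_le (ω (off + w))
    have h2 := Bool.toNat_le (ω' (off + w))
    simp only [draw] at h
    have h3 : (ω (off + w)).toNat = (ω' (off + w)).toNat := by omega
    intro i hi
    rcases Nat.lt_succ_iff_lt_or_eq.1 hi with hi | rfl
    · exact ih (by omega) i hi
    · cases h4 : ω (off + i) <;> cases h5 : ω' (off + i) <;> simp_all

theorem coinLaw_draw_le (t w : ℕ) (y : Fin t → ℕ) :
    coinLaw {ω | ∀ q : Fin t, draw ω (q * w) w = y q} ≤ (2⁻¹ : ENNReal) ^ (w * t) := by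
  by_cases hne : ∃ ω₀ : ℕ → Bool, ∀ q : Fin t, draw ω₀ (q * w) w = y q
  · obtain ⟨ω₀, h₀⟩ := hne
    have hsub : {ω : ℕ → Bool | ∀ q : Fin t, draw ω (q * w) w = y q} ⊆
        Set.pi (Finset.range (w * t) : Finset ℕ) (fun i => {ω₀ i}) := by
      intro ω hω i hi
      have hi' : i < w * t := by simpa using hi
      have hw : 0 < w := Nat.pos_of_ne_zero (by rintro rfl; simp at hi')
      have hq : i / w < t := Nat.div_lt_of_lt_mul hi'
      have h := draw_inj ((hω ⟨i / w, hq⟩).trans (h₀ ⟨i / w, hq⟩).symm) (i % w) (Nat.mod_lt _ hw)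
      simpa [Nat.div_add_mod'] using h
    refine (measure_mono hsub).trans ?_
    unfold coinLaw
    rw [Measure.infinitePi_pi _ (fun _ _ => MeasurableSet.singleton _)]
    have : ∀ i ∈ Finset.range (w * t),
        (PMF.uniformOfFintype Bool).toMeasure {ω₀ i} = (2⁻¹ : ENNReal) := by
      intro i _
      rw [PMF.toMeasure_apply_singleton _ _ (MeasurableSet.singleton _)]
      simp
    rw [Finset.prod_congr rfl this, Finset.prod_const, Finset.card_range]
  · have : {ω : ℕ → Bool | ∀ q : Fin t, draw ω (q * w) w = y q} = ∅ :=
      Set.eq_empty_of_forall_notMem fun ω hω => hne ⟨ω, hω⟩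
    rw [this]
    simp

theorem card_residue_le {P w : ℕ} [NeZero P] (h : P ≤ 2 ^ w) (a : ZMod P) :
    ((Finset.range (2 ^ w)).filter (fun u : ℕ => (u : ZMod P) = a)).card * P ≤ 2 * 2 ^ w := by
  have hinj : ((Finset.range (2 ^ w)).filter (fun u : ℕ => (u : ZMod P) = a)).card ≤
      (Finset.range (2 ^ w / P + 1)).card := by
    refine Finset.card_le_card_of_injOn (fun u => u / P) (fun u hu => ?_) (fun u hu v hv huv => ?_)
    · have : u < 2 ^ w := by simpa using (Finset.mem_filter.1 hu).1
      simp only [Finset.coe_range, Set.mem_Iio]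
      exact Nat.lt_succ_of_le (Nat.div_le_div_right this.le)
    · have h1 := (Finset.mem_filter.1 hu).2
      have h2 := (Finset.mem_filter.1 hv).2
      have h3 : u % P = v % P := (ZMod.natCast_eq_natCast_iff' _ _ _).1 (h1.trans h2.symm)
      rw [← Nat.div_add_mod u P, ← Nat.div_add_mod v P, h3]
      simp only at huv
      rw [huv]
  rw [Finset.card_range] at hinj
  have := Nat.div_mul_le_self (2 ^ w) P
  nlinarith

/-- The coefficients drawn from the coins: numbers of `w` random bits, modulo `P`. -/
def coeffs (P t w : ℕ) (ω : ℕ → Bool) : Fin t → ZMod P := fun q => (draw ω (q * w) w : ℕ)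

/-- Numbers of `w` random bits modulo `P ≤ 2 ^ w` take each value with at most twice the
probability `1 / P` of the uniform distribution. -/
theorem coinLaw_coeffs_le {P t w : ℕ} [NeZero P] (h : P ≤ 2 ^ w)
    (Bad : Finset (Fin t → ZMod P)) :
    coinLaw.real {ω | coeffs P t w ω ∈ Bad} ≤ 2 ^ t * ((Bad.card : ℝ) / (P : ℝ) ^ t) := by
  classical
  have hP : (0 : ℝ) < P := Nat.cast_pos.2 (NeZero.pos P)
  let Y : Finset (Fin t → ℕ) := Bad.biUnion fun α =>
    Fintype.piFinset fun q => (Finset.range (2 ^ w)).filter (fun u : ℕ => (u : ZMod P) = α q)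
  have hY : (Y.card : ℝ) * (P : ℝ) ^ t ≤ Bad.card * (2 * 2 ^ w) ^ t := by
    have h1 : Y.card * P ^ t ≤ Bad.card * (2 * 2 ^ w) ^ t := by
      refine (Nat.mul_le_mul_right _ Finset.card_biUnion_le).trans ?_
      rw [Finset.sum_mul]
      refine (Finset.sum_le_sum (g := fun _ => (2 * 2 ^ w) ^ t) fun α _ => ?_).trans (by simp)
      rw [Fintype.card_piFinset]
      have : P ^ t = ∏ _q : Fin t, P := by simp
      rw [this, ← Finset.prod_mul_distrib]
      refine (Finset.prod_le_prod' fun q _ => card_residue_le h (α q)).trans (by simp)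
    exact_mod_cast h1
  have hsub : {ω | coeffs P t w ω ∈ Bad} ⊆
      ⋃ y ∈ Y, {ω | ∀ q : Fin t, draw ω (q * w) w = y q} := by
    intro ω hω
    refine Set.mem_biUnion (x := fun q : Fin t => draw ω (q * w) w) ?_ (fun q => rfl)
    refine Finset.mem_biUnion.2 ⟨_, hω, Fintype.mem_piFinset.2 fun q => ?_⟩
    exact Finset.mem_filter.2 ⟨Finset.mem_range.2 (draw_lt _ _ _), rfl⟩
  have hE : coinLaw {ω | coeffs P t w ω ∈ Bad} ≤ Y.card * (2⁻¹ : ENNReal) ^ (w * t) := by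
    refine (measure_mono hsub).trans ((measure_biUnion_finset_le _ _).trans ?_)
    refine (Finset.sum_le_sum fun y _ => coinLaw_draw_le t w y).trans ?_
    rw [Finset.sum_const, nsmul_eq_mul]
  have hR : coinLaw.real {ω | coeffs P t w ω ∈ Bad} ≤ Y.card * (2⁻¹ : ℝ) ^ (w * t) := by
    have := ENNReal.toReal_mono (by finiteness) hE
    simpa [Measure.real] using this
  refine hR.trans ?_
  have h2 : (0 : ℝ) < 2 ^ (w * t) := by positivity
  have hPt : (0 : ℝ) < (P : ℝ) ^ t := by positivity
  rw [inv_pow, ← div_eq_mul_inv, div_le_iff₀ h2, mul_div_assoc', div_mul_eq_mul_div,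
    le_div_iff₀ hPt]
  refine hY.trans (le_of_eq ?_)
  rw [mul_pow, ← pow_mul]
  ring

end Coins

end MUC

namespace MUC

/-! ### The parameters of the streaming algorithm -/

/-- The input of the streaming algorithm apart from the stream, with the exponent `c` of the error
probability: universe size `n`, number of sets `m`, cardinality bound `k`, and `E = ⌈1 / ε⌉`. -/
structure Params where
  c : ℕ
  n : ℕ
  m : ℕ
  k : ℕ
  E : ℕ
  two_le_n : 2 ≤ n
  two_le_k : 2 ≤ k
  k_le_m : k ≤ m
  two_le_E : 2 ≤ E

namespace Params

variable (I : Params)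

/-- The number of scales `2 ^ j` on which the optimum is guessed. -/
def s : ℕ := Nat.size (I.m * I.n)

/-- The degree of independence of the hash function: `2 ^ t` exceeds the number of events in the
union bound by a factor of `m ^ c`. -/
def t : ℕ := 2 * (I.c + 2) * I.k * I.s

/-- The number of elements that are to be sampled from a set of size `2 ^ j`, large enough for
deviations by a factor of `1 / E` to have probability at most `2 * (1 / 4) ^ t`. -/
def Λ : ℕ := 4096 * I.t * I.E * I.E

/-- The least prime that exceeds `m * n`. -/
noncomputable def P : ℕ := Nat.find (Nat.exists_infinite_primes (I.m * I.n + 1))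

/-- The largest number of elements sampled from one set that an instance stores. A set of size at
most `2 ^ (j + 1)` has at most `2 * (Λ + 1)` sampled elements on average, and `Λ + 1` are left for
the deviation. -/
def cap : ℕ := 3 * (I.Λ + 1)

/-- The space for the elements stored by one instance. -/
def C : ℕ := (I.k + 1) * (I.cap + 1)

/-- The number of instances: instance `g` works on the scale `2 ^ (g / E)`. -/
def G : ℕ := I.s * I.E

/-- An element is sampled on the scale `2 ^ j` if its hash value is below `T j`. -/
noncomputable def T (j : ℕ) : ℕ := min I.P (I.P * I.Λ / 2 ^ j + 1)

/-- The guess of the optimum made by the instance `g`, times `E`. -/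
def v (g : ℕ) : ℕ := (g % I.E + I.E) * 2 ^ (g / I.E)

theorem two_le_m : 2 ≤ I.m := I.two_le_k.trans I.k_le_m

theorem P_prime : I.P.Prime := (Nat.find_spec (Nat.exists_infinite_primes (I.m * I.n + 1))).2

theorem lt_P : I.m * I.n < I.P := (Nat.find_spec (Nat.exists_infinite_primes (I.m * I.n + 1))).1

instance : Fact I.P.Prime := ⟨I.P_prime⟩

theorem four_le : 4 ≤ I.m * I.n := Nat.mul_le_mul I.two_le_m I.two_le_n

theorem P_le : I.P ≤ 2 * (I.m * I.n) := by
  obtain ⟨p, hp, h1, h2⟩ := Nat.exists_prime_lt_and_le_two_mul (I.m * I.n)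
    (by have := I.four_le; omega)
  exact (Nat.find_min' _ ⟨h1, hp⟩).trans h2

theorem lt_two_pow_s : I.m * I.n < 2 ^ I.s := Nat.lt_size_self _

theorem s_pos : 0 < I.s := Nat.size_pos.2 (by have := I.four_le; omega)

theorem two_pow_le {j : ℕ} (hj : j < I.s) : 2 ^ j ≤ I.m * I.n := Nat.lt_size.1 hj

theorem two_pow_s_le : 2 ^ I.s ≤ 2 * (I.m * I.n) := by
  obtain ⟨j, hj⟩ : ∃ j, I.s = j + 1 := ⟨I.s - 1, by have := I.s_pos; omega⟩
  have := I.two_pow_le (j := j) (by omega)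
  rw [hj, pow_succ]
  omega

theorem P_le_two_pow : I.P ≤ 2 ^ (I.s + 1) := by
  have := I.P_le
  have := I.lt_two_pow_s
  rw [pow_succ]
  omega

theorem t_pos : 0 < I.t := by
  have := I.s_pos
  have := I.two_le_k
  unfold t
  positivity

theorem even_t : Even I.t := ⟨(I.c + 2) * I.k * I.s, by unfold t; ring⟩

theorem T_pos (j : ℕ) : 0 < I.T j := lt_min I.P_prime.pos (Nat.succ_pos _)

theorem T_le (j : ℕ) : I.T j ≤ I.P := min_le_left _ _

theorem T_mul_le {j : ℕ} (hj : j < I.s) : I.T j * 2 ^ j ≤ I.P * (I.Λ + 1) := by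
  have h1 : I.T j ≤ I.P * I.Λ / 2 ^ j + 1 := min_le_right _ _
  have h2 := Nat.div_mul_le_self (I.P * I.Λ) (2 ^ j)
  have h3 := I.two_pow_le hj
  have h4 := I.lt_P
  calc I.T j * 2 ^ j ≤ (I.P * I.Λ / 2 ^ j + 1) * 2 ^ j := Nat.mul_le_mul_right _ h1
    _ ≤ _ := by rw [add_mul, mul_add]; omega

theorem le_T_mul {j : ℕ} (hT : I.T j < I.P) : I.P * I.Λ ≤ I.T j * 2 ^ j := by
  have h1 : I.T j = I.P * I.Λ / 2 ^ j + 1 := by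
    unfold T at hT ⊢
    exact min_eq_right (by by_contra h; rw [min_eq_left (by omega)] at hT; omega)
  have h2 := Nat.lt_div_mul_add (a := I.P * I.Λ) (b := 2 ^ j) (by positivity)
  rw [h1, add_mul]
  omega

end Params

/-! ### Concentration of the sampled unique coverage -/

theorem card_filter_card_le (m k : ℕ) :
    ((Finset.univ : Finset (Finset (Fin m))).filter (fun B => B.card ≤ k)).card ≤ (m + 1) ^ k := by
  classical
  have h : ((Finset.univ : Finset (Finset (Fin m))).filter (fun B => B.card ≤ k)) ⊆
      (Finset.univ : Finset (Fin k → Option (Fin m))).image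
        (fun f => Finset.univ.filter (fun i => ∃ j, f j = some i)) := by
    intro B hB
    have hB' : B.card ≤ k := (Finset.mem_filter.1 hB).2
    refine Finset.mem_image.2 ⟨fun j => B.toList[j.val]?, Finset.mem_univ _, ?_⟩
    ext i
    simp only [Finset.mem_filter, Finset.mem_univ, true_and]
    rw [← Finset.mem_toList, List.mem_iff_getElem?]
    constructor
    · rintro ⟨j, hj⟩; exact ⟨j, hj⟩
    · rintro ⟨j, hj⟩
      have : j < B.toList.length := (List.getElem?_eq_some_iff.1 hj).1
      rw [Finset.length_toList] at this
      exact ⟨⟨j, by omega⟩, hj⟩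
  refine (Finset.card_le_card h).trans (Finset.card_image_le.trans ?_)
  simp

namespace Params

variable (I : Params)

/-- The token `x` is sampled on the scale `2 ^ j` under the hash function with coefficients `α`. -/
def Smp (α : Fin I.t → ZMod I.P) (j x : ℕ) : Prop := (hash α (x : ZMod I.P)).val < I.T j

noncomputable instance (α : Fin I.t → ZMod I.P) (j x : ℕ) : Decidable (I.Smp α j x) := by
  unfold Smp; infer_instance

/-- The sampled part of a set of elements. -/
noncomputable def sampled (α : Fin I.t → ZMod I.P) (j : ℕ) (U : Finset (Fin I.n)) :
    Finset (Fin I.n) := U.filter (fun x => I.Smp α j (x.val + 1))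

/-- On the scale `2 ^ j`, the sample of `U` is as large as expected, up to a small multiple of the
expected size of a sample of `2 ^ j` elements. -/
def Accurate (α : Fin I.t → ZMod I.P) (j : ℕ) (U : Finset (Fin I.n)) : Prop :=
  |((I.sampled α j U).card : ℝ) - (I.T j : ℝ) / I.P * U.card| <
    (I.T j : ℝ) / I.P * 2 ^ j / (2 * I.E)

theorem token_injective : Function.Injective (fun x : Fin I.n => ((x.val + 1 : ℕ) : ZMod I.P)) := by
  intro x y h
  have hP := I.lt_P
  have hn : I.n ≤ I.m * I.n := Nat.le_mul_of_pos_left _ (by have := I.two_le_m; omega)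
  have hx := x.isLt
  have hy := y.isLt
  have := (ZMod.natCast_eq_natCast_iff' _ _ _).1 h
  rw [Nat.mod_eq_of_lt (by omega), Nat.mod_eq_of_lt (by omega)] at this
  exact Fin.ext (by omega)

theorem sum_dev (α : Fin I.t → ZMod I.P) (j : ℕ) (U : Finset (Fin I.n)) :
    ∑ x : U, dev I.P (I.T j) (hash α ((x.1.val + 1 : ℕ) : ZMod I.P)) =
      ((I.sampled α j U).card : ℝ) - (I.T j : ℝ) / I.P * U.card := by
  rw [Finset.sum_coe_sort U (fun x => dev I.P (I.T j) (hash α ((x.val + 1 : ℕ) : ZMod I.P)))]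
  have h : ∀ x : Fin I.n, dev I.P (I.T j) (hash α ((x.val + 1 : ℕ) : ZMod I.P)) =
      (if I.Smp α j (x.val + 1) then 1 else 0) - (I.T j : ℝ) / I.P := fun x => by
    unfold dev
    congr 1
  rw [Finset.sum_congr rfl fun x _ => h x, Finset.sum_sub_distrib, Finset.sum_const, nsmul_eq_mul,
    sampled, Finset.card_filter, mul_comm (U.card : ℝ)]
  push_cast
  rfl

open Classical in
/-- Few hash functions are inaccurate on a given set. The factor `(1 / 4) ^ t` has to outweigh both
the bias `2 ^ t` of the coefficients and the number of sets. -/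
theorem card_not_accurate_le {j : ℕ} (hj : j < I.s) (U : Finset (Fin I.n))
    (hU : U.card ≤ 2 ^ (j + 1)) :
    ((Finset.univ.filter (fun α : Fin I.t → ZMod I.P => ¬ I.Accurate α j U)).card : ℝ) ≤
      (I.P : ℝ) ^ I.t * (2 * (1 / 4) ^ I.t) := by
  have hP : (0 : ℝ) < I.P := Nat.cast_pos.2 I.P_prime.pos
  have hT : (0 : ℝ) < I.T j := Nat.cast_pos.2 (I.T_pos j)
  have hE : (2 : ℝ) ≤ I.E := by exact_mod_cast I.two_le_E
  have ht : (0 : ℝ) < I.t := Nat.cast_pos.2 I.t_pos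
  rcases (I.T_le j).eq_or_lt with hTP | hTP
  -- If `T j = P`, everything is sampled, and the sample is exact.
  · have : Finset.univ.filter (fun α : Fin I.t → ZMod I.P => ¬ I.Accurate α j U) = ∅ := by
      refine Finset.filter_eq_empty_iff.2 fun α _ => ?_
      have hs : I.sampled α j U = U :=
        Finset.filter_true_of_mem fun x _ => by unfold Smp; rw [hTP]; exact ZMod.val_lt _
      rw [not_not, Accurate, hs, hTP, div_self hP.ne', one_mul, sub_self, abs_zero]
      positivity
    rw [this]
    simp only [Finset.card_empty, Nat.cast_zero]
    positivity
  · set M : ℝ := (I.T j : ℝ) / I.P * 2 ^ j with hM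
    have hΛ : (I.Λ : ℝ) = 4096 * I.t * I.E * I.E := by unfold Λ; push_cast; ring
    have hΛ1 : (1 : ℝ) ≤ I.Λ := by
      have : 0 < I.Λ := by
        have := I.t_pos
        have := I.two_le_E
        unfold Λ
        positivity
      exact_mod_cast this
    have hM1 : (I.Λ : ℝ) ≤ M := by
      have : (I.P : ℝ) * I.Λ ≤ I.T j * 2 ^ j := by exact_mod_cast I.le_T_mul hTP
      rw [hM, div_mul_eq_mul_div, le_div_iff₀ hP]
      linarith
    have hM2 : M ≤ 2 * I.Λ := by
      have : (I.T j : ℝ) * 2 ^ j ≤ I.P * (I.Λ + 1) := by exact_mod_cast I.T_mul_le hj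
      rw [hM, div_mul_eq_mul_div, div_le_iff₀ hP]
      nlinarith
    -- The parameter of the moment generating function is chosen such that its exponent is `t`.
    set lam : ℝ := 1 / (128 * I.E) with hlam
    have hl0 : 0 < lam := by positivity
    have hl1 : lam ≤ 1 := by
      rw [hlam, div_le_one (by positivity)]
      linarith
    have hD : 0 < M / (2 * I.E) := by positivity
    have hbase := card_large_dev_le (t := I.t) (fun x : U => ((x.1.val + 1 : ℕ) : ZMod I.P))
      (I.token_injective.comp Subtype.val_injective) (I.T_le j) I.even_t hl0 hl1 hD
    have hset : Finset.univ.filter (fun α : Fin I.t → ZMod I.P => ¬ I.Accurate α j U) =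
        Finset.univ.filter (fun α : Fin I.t → ZMod I.P => M / (2 * I.E) ≤
          |∑ x : U, dev I.P (I.T j) (hash α ((x.1.val + 1 : ℕ) : ZMod I.P))|) := by
      refine Finset.filter_congr fun α _ => ?_
      rw [sum_dev, Accurate, not_lt]
    rw [hset]
    refine hbase.trans (mul_le_mul_of_nonneg_left ?_ (by positivity))
    have e1 : (I.t.factorial : ℝ) / (lam * (M / (2 * I.E))) ^ I.t ≤ (1 / 16) ^ I.t := by
      have h16 : 16 * (I.t : ℝ) ≤ lam * (M / (2 * I.E)) := by
        rw [hlam, div_mul_div_comm, one_mul, le_div_iff₀ (by positivity)]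
        nlinarith
      have hf : (I.t.factorial : ℝ) ≤ (I.t : ℝ) ^ I.t := by exact_mod_cast Nat.factorial_le_pow _
      calc _ ≤ (I.t : ℝ) ^ I.t / (16 * (I.t : ℝ)) ^ I.t := by gcongr
        _ = _ := by rw [← div_pow]; congr 1; field_simp
    have e2 : Real.exp (lam ^ 2 * ((I.T j : ℝ) / I.P) * Fintype.card U) ≤ 4 ^ I.t := by
      have hUc : (Fintype.card U : ℝ) ≤ 2 * 2 ^ j := by
        rw [Fintype.card_coe]
        calc (U.card : ℝ) ≤ ((2 ^ (j + 1) : ℕ) : ℝ) := by exact_mod_cast hU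
          _ = _ := by push_cast; ring
      have hexp : lam ^ 2 * ((I.T j : ℝ) / I.P) * Fintype.card U ≤ I.t * 1 := by
        calc _ ≤ lam ^ 2 * ((I.T j : ℝ) / I.P) * (2 * 2 ^ j) := by gcongr
          _ = lam ^ 2 * (2 * M) := by rw [hM]; ring
          _ ≤ lam ^ 2 * (2 * (2 * I.Λ)) := by gcongr
          _ = I.t * 1 := by
            rw [hlam, hΛ]
            field_simp
            norm_num
      refine (Real.exp_le_exp.2 hexp).trans ?_
      rw [Real.exp_nat_mul]
      have := Real.exp_one_lt_d9
      exact pow_le_pow_left₀ (Real.exp_pos _).le (by linarith) _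
    calc _ ≤ (1 / 16 : ℝ) ^ I.t * (2 * 4 ^ I.t) := by gcongr
      _ = 2 * (1 / 4) ^ I.t := by
        rw [mul_left_comm, ← mul_pow]
        norm_num

/-- On every scale, the samples of the unique covers of all small subcollections are accurate. -/
def Good (S : Fin I.m → Finset (Fin I.n)) (α : Fin I.t → ZMod I.P) : Prop :=
  ∀ j < I.s, ∀ B : Finset (Fin I.m), B.card ≤ I.k → (uniqueCover S B).card ≤ 2 ^ (j + 1) →
    I.Accurate α j (uniqueCover S B)

/-- The union bound over the scales and the subcollections of at most `k` sets, with the factor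
`2 ^ t` for the bias of the coefficients. -/
theorem failure_le : 2 ^ I.t * (I.s * ((I.m + 1 : ℕ) : ℝ) ^ I.k * (2 * (1 / 4) ^ I.t)) ≤
    1 / (I.m : ℝ) ^ I.c := by
  have hm : (0 : ℝ) < I.m := by
    have := I.two_le_m
    exact_mod_cast (by omega : 0 < I.m)
  rw [le_div_iff₀ (by positivity)]
  have h1 : I.m + 1 ≤ 2 ^ I.s := by
    have := I.lt_two_pow_s
    have := I.two_le_n
    have := I.two_le_m
    nlinarith
  have h2 : I.s * (I.m + 1) ^ I.k * 2 * I.m ^ I.c ≤ 2 ^ I.t := by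
    calc I.s * (I.m + 1) ^ I.k * 2 * I.m ^ I.c
        ≤ 2 ^ I.s * (2 ^ I.s) ^ I.k * 2 ^ 1 * (2 ^ I.s) ^ I.c := by
          gcongr
          · exact Nat.lt_two_pow_self.le
          · norm_num
          · omega
      _ = 2 ^ (I.s + I.s * I.k + 1 + I.s * I.c) := by
          rw [← pow_mul, ← pow_mul, ← pow_add, ← pow_add, ← pow_add]
      _ ≤ 2 ^ I.t := by
          refine Nat.pow_le_pow_right (by norm_num) ?_
          have := I.s_pos
          have := I.two_le_k
          unfold t
          have h3 : I.s * 2 ≤ I.s * I.k := Nat.mul_le_mul_left _ I.two_le_k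
          have h4 : I.s * I.c * 2 ≤ I.s * I.c * I.k := Nat.mul_le_mul_left _ I.two_le_k
          nlinarith
  have h3 : (I.s : ℝ) * ((I.m + 1 : ℕ) : ℝ) ^ I.k * 2 * (I.m : ℝ) ^ I.c ≤ 2 ^ I.t := by
    exact_mod_cast h2
  have h4 : (2 : ℝ) ^ I.t * (1 / 4) ^ I.t * 2 ^ I.t = 1 := by
    rw [← mul_pow, ← mul_pow]; norm_num
  calc _ = (2 : ℝ) ^ I.t * (1 / 4) ^ I.t *
        (I.s * ((I.m + 1 : ℕ) : ℝ) ^ I.k * 2 * (I.m : ℝ) ^ I.c) := by ring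
    _ ≤ (2 : ℝ) ^ I.t * (1 / 4) ^ I.t * 2 ^ I.t := by gcongr
    _ = 1 := h4

theorem good_probability (S : Fin I.m → Finset (Fin I.n)) :
    1 - 1 / (I.m : ℝ) ^ I.c ≤
      coinLaw.real {ω | I.Good S (coeffs I.P I.t (I.s + 1) ω)} := by
  classical
  have hP : (0 : ℝ) < I.P := Nat.cast_pos.2 I.P_prime.pos
  let Bs := (Finset.univ : Finset (Finset (Fin I.m))).filter (fun B => B.card ≤ I.k)
  let bad : ℕ → Finset (Fin I.m) → Finset (Fin I.t → ZMod I.P) := fun j B =>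
    if (uniqueCover S B).card ≤ 2 ^ (j + 1) then
      Finset.univ.filter (fun α => ¬ I.Accurate α j (uniqueCover S B)) else ∅
  let Bad := (Finset.range I.s).biUnion fun j => Bs.biUnion fun B => bad j B
  have hbad : ∀ j < I.s, ∀ B, ((bad j B).card : ℝ) ≤ (I.P : ℝ) ^ I.t * (2 * (1 / 4) ^ I.t) := by
    intro j hj B
    simp only [bad]
    split_ifs with h
    · exact I.card_not_accurate_le hj _ h
    · simp only [Finset.card_empty, Nat.cast_zero]; positivity
  have hBad : (Bad.card : ℝ) ≤
      I.s * ((I.m + 1 : ℕ) : ℝ) ^ I.k * ((I.P : ℝ) ^ I.t * (2 * (1 / 4) ^ I.t)) := by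
    have hBs : (Bs.card : ℝ) ≤ ((I.m + 1 : ℕ) : ℝ) ^ I.k := by
      exact_mod_cast card_filter_card_le I.m I.k
    calc (Bad.card : ℝ) ≤ ∑ j ∈ Finset.range I.s, ∑ B ∈ Bs, ((bad j B).card : ℝ) := by
          exact_mod_cast Finset.card_biUnion_le.trans
            (Finset.sum_le_sum fun j _ => Finset.card_biUnion_le)
      _ ≤ ∑ j ∈ Finset.range I.s, ∑ B ∈ Bs, (I.P : ℝ) ^ I.t * (2 * (1 / 4) ^ I.t) :=
          Finset.sum_le_sum fun j hj => Finset.sum_le_sum fun B _ =>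
            hbad j (Finset.mem_range.1 hj) B
      _ = I.s * (Bs.card * ((I.P : ℝ) ^ I.t * (2 * (1 / 4) ^ I.t))) := by simp
      _ ≤ I.s * (((I.m + 1 : ℕ) : ℝ) ^ I.k * ((I.P : ℝ) ^ I.t * (2 * (1 / 4) ^ I.t))) := by
          gcongr
      _ = _ := by ring
  have hfail : coinLaw.real {ω | coeffs I.P I.t (I.s + 1) ω ∈ Bad} ≤ 1 / (I.m : ℝ) ^ I.c := by
    refine (coinLaw_coeffs_le I.P_le_two_pow Bad).trans (le_trans ?_ I.failure_le)
    gcongr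
    rw [div_le_iff₀ (by positivity)]
    refine hBad.trans (le_of_eq ?_)
    ring
  have hprob : MeasureTheory.IsProbabilityMeasure coinLaw := by
    unfold coinLaw; infer_instance
  have hcov : (Set.univ : Set (ℕ → Bool)) ⊆ {ω | coeffs I.P I.t (I.s + 1) ω ∈ Bad} ∪
      {ω | I.Good S (coeffs I.P I.t (I.s + 1) ω)} := by
    intro ω _
    by_cases h : coeffs I.P I.t (I.s + 1) ω ∈ Bad
    · exact Or.inl h
    · refine Or.inr fun j hj B hB hU => ?_
      by_contra hacc
      refine h (Finset.mem_biUnion.2 ⟨j, Finset.mem_range.2 hj, Finset.mem_biUnion.2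
        ⟨B, Finset.mem_filter.2 ⟨Finset.mem_univ _, hB⟩, ?_⟩⟩)
      simp only [bad, if_pos hU]
      exact Finset.mem_filter.2 ⟨Finset.mem_univ _, hacc⟩
  have h1 : (1 : ℝ) ≤ coinLaw.real {ω | coeffs I.P I.t (I.s + 1) ω ∈ Bad} +
      coinLaw.real {ω | I.Good S (coeffs I.P I.t (I.s + 1) ω)} := by
    refine le_trans (le_of_eq ?_) ((MeasureTheory.measureReal_mono hcov).trans
      (MeasureTheory.measureReal_union_le _ _))
    simp
  linarith

end Params

end MUC

namespace MUC

/-! ### Coverage of images and samples of families -/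

section Coverage

variable {ι κ α : Type*} [DecidableEq ι] [DecidableEq κ] [DecidableEq α]

theorem mem_uniqueCover {S : ι → Finset α} {B : Finset ι} {x : α} :
    x ∈ uniqueCover S B ↔ ∃ i ∈ B, x ∈ S i ∧ ∀ j ∈ B, x ∈ S j → j = i := by
  simp only [uniqueCover, cover, Finset.mem_sdiff, Finset.mem_biUnion, Finset.mem_offDiag,
    Finset.mem_inter, not_exists, not_and, and_imp, Prod.forall]
  constructor
  · rintro ⟨⟨i, hi, hx⟩, h⟩
    refine ⟨i, hi, hx, fun j hj hxj => ?_⟩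
    by_contra hne
    exact h j i hj hi hne hxj hx
  · rintro ⟨i, hi, hx, h⟩
    refine ⟨⟨i, hi, hx⟩, fun a b ha hb hne hxa hxb => hne ?_⟩
    rw [h a ha hxa, h b hb hxb]

omit [DecidableEq ι] in
theorem uniqueCover_subset_cover (S : ι → Finset α) (B : Finset ι) :
    uniqueCover S B ⊆ cover S B := Finset.sdiff_subset

theorem uniqueCover_singleton (S : ι → Finset α) (i : ι) : uniqueCover S {i} = S i := by
  ext x
  simp [mem_uniqueCover]

/-- Distinct members of a family, restricted to the elements with the property `p`, cover uniquely
what the members cover uniquely among these elements. -/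
theorem uniqueCover_image_filter (S : ι → Finset α) (e : κ ↪ ι) (p : α → Prop) [DecidablePred p]
    (B : Finset κ) :
    uniqueCover (fun q => (S (e q)).filter p) B = (uniqueCover S (B.map e)).filter p := by
  ext x
  simp only [mem_uniqueCover, Finset.mem_filter, Finset.mem_map]
  constructor
  · rintro ⟨i, hi, ⟨hx, hp⟩, h⟩
    refine ⟨⟨e i, ⟨i, hi, rfl⟩, hx, ?_⟩, hp⟩
    rintro _ ⟨j, hj, rfl⟩ hxj
    rw [h j hj ⟨hxj, hp⟩]
  · rintro ⟨⟨_, ⟨i, hi, rfl⟩, hx, h⟩, hp⟩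
    exact ⟨i, hi, ⟨hx, hp⟩, fun j hj hxj => e.injective (h _ ⟨j, hj, rfl⟩ hxj.1)⟩

omit [DecidableEq ι] [DecidableEq κ] in
theorem cover_image_filter (S : ι → Finset α) (e : κ ↪ ι) (p : α → Prop) [DecidablePred p]
    (B : Finset κ) :
    cover (fun q => (S (e q)).filter p) B = (cover S (B.map e)).filter p := by
  ext x
  simp only [cover, Finset.mem_biUnion, Finset.mem_filter, Finset.mem_map]
  constructor
  · rintro ⟨i, hi, hx, hp⟩
    exact ⟨⟨e i, ⟨i, hi, rfl⟩, hx⟩, hp⟩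
  · rintro ⟨⟨_, ⟨i, hi, rfl⟩, hx⟩, hp⟩
    exact ⟨i, hi, hx, hp⟩

omit [DecidableEq ι] in
theorem card_uniqueCover_le_opt [Fintype ι] (S : ι → Finset α) {k : ℕ} {B : Finset ι}
    (hB : B.card ≤ k) : (uniqueCover S B).card ≤ opt S k :=
  Finset.le_sup (f := fun B => (uniqueCover S B).card)
    (Finset.mem_filter.2 ⟨Finset.mem_univ _, hB⟩)

omit [DecidableEq ι] in
theorem exists_card_uniqueCover_eq_opt [Fintype ι] (S : ι → Finset α) (k : ℕ) :
    ∃ B : Finset ι, B.card ≤ k ∧ (uniqueCover S B).card = opt S k := by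
  obtain ⟨B, hB, h⟩ := Finset.exists_mem_eq_sup
    ((Finset.univ : Finset (Finset ι)).filter (fun B => B.card ≤ k)) ⟨∅, by simp⟩
    (fun B => (uniqueCover S B).card)
  exact ⟨B, (Finset.mem_filter.1 hB).2, h.symm⟩

end Coverage

/-! ### Greedy selection with a threshold -/

/-- Sets listed one after another, each closed by `0`. -/
def logOf (S : ℕ → List ℕ) (ch : List ℕ) : List ℕ := ch.flatMap (fun i => S i ++ [0])

/-- The number of entries of `l` that are not in `log`. -/
def newCount (log l : List ℕ) : ℕ := l.countP (fun x => decide (x ∉ log))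

/-- The list of the IDs selected from the first `i` sets, and the size of their cover. A set is
selected if there are fewer than `k` sets so far, it has at most `cap` elements, and it covers at
least `W / u` new elements. -/
def sieve (k cap W u : ℕ) (S : ℕ → List ℕ) : ℕ → List ℕ × ℕ
  | 0 => ([], 0)
  | i + 1 =>
    let a := sieve k cap W u S i
    if a.1.length < k ∧ (S i).length ≤ cap ∧ W ≤ u * newCount (logOf S a.1) (S i) then
      (a.1 ++ [i], a.2 + newCount (logOf S a.1) (S i))
    else a

section Sieve

variable {k cap W u : ℕ} {S : ℕ → List ℕ}

theorem logOf_append (ch : List ℕ) (i : ℕ) : logOf S (ch ++ [i]) = logOf S ch ++ (S i ++ [0]) := by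
  simp [logOf]

theorem newCount_append (log l : List ℕ) (x : ℕ) :
    newCount log (l ++ [x]) = newCount log l + if x ∈ log then 0 else 1 := by
  unfold newCount
  rw [List.countP_append]
  by_cases h : x ∈ log <;> simp [h]

/-- The union of the listed sets. -/
def unionOf (S : ℕ → List ℕ) (B : Finset ℕ) : Finset ℕ := B.biUnion (fun i => (S i).toFinset)

theorem newCount_eq_card (h0 : ∀ i, 0 ∉ S i) (hS : ∀ i, (S i).Nodup) (ch : List ℕ) (i : ℕ) :
    newCount (logOf S ch) (S i) = ((S i).toFinset \ unionOf S ch.toFinset).card := by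
  have hmem : ∀ x ∈ S i, x ∈ logOf S ch ↔ x ∈ unionOf S ch.toFinset := by
    intro x hx
    have : x ≠ 0 := by rintro rfl; exact h0 i hx
    simp [logOf, unionOf, this]
  unfold newCount
  rw [List.countP_eq_length_filter, ← List.toFinset_card_of_nodup ((hS i).filter _)]
  congr 1
  ext x
  simp only [List.mem_toFinset, List.mem_filter, decide_eq_true_eq, Finset.mem_sdiff]
  exact and_congr_right fun hx => not_congr (hmem x hx)

theorem sieve_succ_of_pos {i : ℕ} (h : (sieve k cap W u S i).1.length < k ∧ (S i).length ≤ cap ∧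
    W ≤ u * newCount (logOf S (sieve k cap W u S i).1) (S i)) :
    sieve k cap W u S (i + 1) = ((sieve k cap W u S i).1 ++ [i],
      (sieve k cap W u S i).2 + newCount (logOf S (sieve k cap W u S i).1) (S i)) := by
  rw [sieve]; exact if_pos h

theorem sieve_succ_of_neg {i : ℕ} (h : ¬ ((sieve k cap W u S i).1.length < k ∧
    (S i).length ≤ cap ∧ W ≤ u * newCount (logOf S (sieve k cap W u S i).1) (S i))) :
    sieve k cap W u S (i + 1) = sieve k cap W u S i := by
  rw [sieve]; exact if_neg h

theorem sieve_basic (i : ℕ) : (sieve k cap W u S i).1.length ≤ k ∧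
    (∀ q ∈ (sieve k cap W u S i).1, q < i) ∧ (sieve k cap W u S i).1.Nodup ∧
    (logOf S (sieve k cap W u S i).1).length ≤ (sieve k cap W u S i).1.length * (cap + 1) ∧
    W * (sieve k cap W u S i).1.length ≤ u * (sieve k cap W u S i).2 := by
  induction i with
  | zero => simp [sieve, logOf]
  | succ i ih =>
    obtain ⟨h1, h2, h3, h4, h5⟩ := ih
    by_cases h : (sieve k cap W u S i).1.length < k ∧ (S i).length ≤ cap ∧
        W ≤ u * newCount (logOf S (sieve k cap W u S i).1) (S i)
    · rw [sieve_succ_of_pos h]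
      refine ⟨by simpa using h.1, fun q hq => ?_, ?_, ?_, ?_⟩
      · rcases List.mem_append.1 hq with hq | hq
        · exact (h2 q hq).trans (Nat.lt_succ_self i)
        · rw [List.mem_singleton.1 hq]; exact Nat.lt_succ_self i
      · refine h3.append (List.nodup_singleton i) ?_
        rw [List.disjoint_singleton]
        exact fun hi => (h2 i hi).false
      · rw [logOf_append]
        simp only [List.length_append, List.length_singleton, add_mul, one_mul]
        have := h.2.1
        omega
      · simp only [List.length_append, List.length_singleton]
        have := h.2.2
        nlinarith
    · rw [sieve_succ_of_neg h]
      exact ⟨h1, fun q hq => (h2 q hq).trans (Nat.lt_succ_self i), h3, h4, h5⟩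

theorem sieve_card (h0 : ∀ i, 0 ∉ S i) (hS : ∀ i, (S i).Nodup) (i : ℕ) :
    (sieve k cap W u S i).2 = (unionOf S (sieve k cap W u S i).1.toFinset).card := by
  induction i with
  | zero => simp [sieve, unionOf]
  | succ i ih =>
    by_cases h : (sieve k cap W u S i).1.length < k ∧ (S i).length ≤ cap ∧
        W ≤ u * newCount (logOf S (sieve k cap W u S i).1) (S i)
    · rw [sieve_succ_of_pos h, newCount_eq_card h0 hS, ih, ← Finset.card_union_of_disjoint
        (Finset.disjoint_sdiff), Finset.union_sdiff_self_eq_union]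
      refine congrArg Finset.card ?_
      ext x
      simp [unionOf, or_comm]
    · rw [sieve_succ_of_neg h, ih]

theorem sieve_prefix (S : ℕ → List ℕ) {i j : ℕ} (hij : i ≤ j) :
    (sieve k cap W u S i).1 <+: (sieve k cap W u S j).1 := by
  induction j, hij using Nat.le_induction with
  | base => exact List.prefix_rfl
  | succ j _ ih =>
    refine ih.trans ?_
    by_cases h : (sieve k cap W u S j).1.length < k ∧ (S j).length ≤ cap ∧
        W ≤ u * newCount (logOf S (sieve k cap W u S j).1) (S j)
    · rw [sieve_succ_of_pos h]; exact List.prefix_append _ _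
    · rw [sieve_succ_of_neg h]

theorem unionOf_mono {B B' : Finset ℕ} (h : B ⊆ B') : unionOf S B ⊆ unionOf S B' :=
  Finset.biUnion_subset_biUnion_of_subset_left _ h

/-- A set that was not selected, although there was room for it, adds few elements to the final
cover. -/
theorem sieve_rest (h0 : ∀ i, 0 ∉ S i) (hS : ∀ i, (S i).Nodup) {N i : ℕ} (hi : i < N)
    (hlen : (sieve k cap W u S N).1.length < k) (hcap : (S i).length ≤ cap) :
    u * ((S i).toFinset \ unionOf S (sieve k cap W u S N).1.toFinset).card ≤ W := by
  have hpre := sieve_prefix (k := k) (cap := cap) (W := W) (u := u) S (Nat.succ_le_of_lt hi)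
  have hpre' := sieve_prefix (k := k) (cap := cap) (W := W) (u := u) S hi.le
  by_cases h : (sieve k cap W u S i).1.length < k ∧ (S i).length ≤ cap ∧
      W ≤ u * newCount (logOf S (sieve k cap W u S i).1) (S i)
  · have hmem : i ∈ (sieve k cap W u S N).1 := by
      refine hpre.subset ?_
      rw [Nat.succ_eq_add_one, sieve_succ_of_pos h]
      simp
    have hsub : (S i).toFinset ⊆ unionOf S (sieve k cap W u S N).1.toFinset :=
      Finset.subset_biUnion_of_mem (fun i => (S i).toFinset) (List.mem_toFinset.2 hmem)
    rw [Finset.sdiff_eq_empty_iff_subset.2 hsub]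
    simp
  · have hl : (sieve k cap W u S i).1.length < k := hpre'.length_le.trans_lt hlen
    have hlt : u * newCount (logOf S (sieve k cap W u S i).1) (S i) < W := by
      by_contra hge
      exact h ⟨hl, hcap, not_lt.1 hge⟩
    rw [newCount_eq_card h0 hS] at hlt
    refine le_trans (Nat.mul_le_mul_left _ (Finset.card_le_card ?_)) hlt.le
    refine Finset.sdiff_subset_sdiff le_rfl (unionOf_mono ?_)
    exact fun x hx => List.mem_toFinset.2 (hpre'.subset (List.mem_toFinset.1 hx))

/-- The guarantee of the threshold rule: the cover reaches `W / u'`, or it falls short of the cover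
of any `k` sets by at most `W / u'`. -/
theorem sieve_cover (h0 : ∀ i, 0 ∉ S i) (hS : ∀ i, (S i).Nodup) {N u' : ℕ} (hk : 0 < k)
    {O : Finset ℕ} (hO : O.card ≤ k) (hON : ∀ i ∈ O, i < N) (hcap : ∀ i ∈ O, (S i).length ≤ cap) :
    W ≤ u' * (sieve k cap W (k * u') S N).2 ∨
      u' * (unionOf S O).card ≤ u' * (sieve k cap W (k * u') S N).2 + W := by
  obtain ⟨h1, -, -, -, h5⟩ := sieve_basic (k := k) (cap := cap) (W := W) (u := k * u') (S := S) N
  rcases h1.eq_or_lt with h | h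
  · left
    rw [h] at h5
    refine Nat.le_of_mul_le_mul_left ?_ hk
    linarith
  · right
    set a := sieve k cap W (k * u') S N with ha
    have hsub : unionOf S O ⊆ unionOf S a.1.toFinset ∪
        O.biUnion (fun i => (S i).toFinset \ unionOf S a.1.toFinset) := by
      intro x hx
      obtain ⟨i, hi, hxi⟩ := Finset.mem_biUnion.1 hx
      by_cases hxa : x ∈ unionOf S a.1.toFinset
      · exact Finset.mem_union_left _ hxa
      · exact Finset.mem_union_right _ (Finset.mem_biUnion.2 ⟨i, hi, Finset.mem_sdiff.2 ⟨hxi, hxa⟩⟩)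
    have hc : (unionOf S O).card ≤
        a.2 + ∑ i ∈ O, ((S i).toFinset \ unionOf S a.1.toFinset).card := by
      rw [ha, sieve_card h0 hS N, ← ha]
      exact (Finset.card_le_card hsub).trans ((Finset.card_union_le _ _).trans
        (Nat.add_le_add_left Finset.card_biUnion_le _))
    have hsum : k * u' * ∑ i ∈ O, ((S i).toFinset \ unionOf S a.1.toFinset).card ≤ k * W := by
      rw [Finset.mul_sum]
      refine (Finset.sum_le_card_nsmul O _ W fun i hi =>
        sieve_rest h0 hS (hON i hi) h (hcap i hi)).trans ?_
      rw [smul_eq_mul]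
      exact Nat.mul_le_mul_right _ hO
    have hsum' : u' * ∑ i ∈ O, ((S i).toFinset \ unionOf S a.1.toFinset).card ≤ W :=
      Nat.le_of_mul_le_mul_left (by rw [← mul_assoc]; exact hsum) hk
    calc u' * (unionOf S O).card
        ≤ u' * (a.2 + ∑ i ∈ O, ((S i).toFinset \ unionOf S a.1.toFinset).card) :=
          Nat.mul_le_mul_left _ hc
      _ ≤ _ := by rw [mul_add]; omega

end Sieve

/-- The last of the first `G` indices that has the property `p`, or `0`. -/
def lastIndex (p : ℕ → Prop) [DecidablePred p] : ℕ → ℕ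
  | 0 => 0
  | g + 1 => if p g then g else lastIndex p g

theorem lastIndex_spec (p : ℕ → Prop) [DecidablePred p] {G g : ℕ} (hg : g < G) (hp : p g) :
    g ≤ lastIndex p G ∧ p (lastIndex p G) := by
  induction G with
  | zero => omega
  | succ G ih =>
    rw [lastIndex]
    split_ifs with h
    · exact ⟨by omega, h⟩
    · refine ih ?_
      rcases Nat.lt_succ_iff_lt_or_eq.1 hg with hg | rfl
      · exact hg
      · exact absurd hp h

theorem lastIndex_lt (p : ℕ → Prop) [DecidablePred p] {G : ℕ} (hG : 0 < G) : lastIndex p G < G := by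
  have : ∀ g, lastIndex p g ≤ g - 1 := by
    intro g
    induction g with
    | zero => exact le_rfl
    | succ g ih => rw [lastIndex]; split_ifs <;> omega
  have := this G
  omega

end MUC

namespace MUC

/-! ### The selection made by the instances -/

/-- The tokens of the `i`-th set of a family, without the closing `0`. -/
def tok {n m : ℕ} (V : Family n m) (i : ℕ) : List ℕ :=
  if h : i < m then (V.elems ⟨i, h⟩).map (fun x => x.val + 1) else []

section Tok

variable {n m : ℕ} (V : Family n m)

theorem tok_nodup (i : ℕ) : (tok V i).Nodup := by
  unfold tok
  split_ifs with h
  · exact (V.nodup ⟨i, h⟩).map fun x y hxy => Fin.ext (by simpa using hxy)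
  · exact List.nodup_nil

theorem mem_tok {i x : ℕ} (hx : x ∈ tok V i) : 1 ≤ x ∧ x ≤ n := by
  unfold tok at hx
  split_ifs at hx with h
  · obtain ⟨y, -, rfl⟩ := List.mem_map.1 hx
    have := y.isLt
    omega
  · simp at hx

theorem length_tok_le (i : ℕ) : (tok V i).length ≤ n := by
  unfold tok
  split_ifs with h
  · rw [List.length_map]
    simpa using (V.nodup ⟨i, h⟩).length_le_card
  · simp

end Tok

namespace Params

variable (I : Params) (V : Family I.n I.m) (α : Fin I.t → ZMod I.P)

/-- The sampled tokens of the `i`-th set on the scale of the instance `g`. -/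
noncomputable def smp (g i : ℕ) : List ℕ := (tok V i).filter (fun x => I.Smp α (g / I.E) x)

/-- The state of the instance `g` after `i` sets: the selected IDs and the size of the cover of the
sampled sets. Sets are selected if the sampled elements that they add, divided by the sampling
probability, are at least the `2k`-th part of the guess `v g / E`. -/
noncomputable def run (g i : ℕ) : List ℕ × ℕ :=
  sieve I.k I.cap (I.T (g / I.E) * I.v g) (I.k * (2 * I.E * I.P)) (I.smp V α g) i

/-- The instance `g` has reached about half of its guess. -/
def Succ (g : ℕ) : Prop :=
  I.T (g / I.E) * I.v g * (I.E - 1) ≤ 2 * I.E * I.E * I.P * (I.run V α g I.m).2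

noncomputable instance : DecidablePred (I.Succ V α) := fun g => by unfold Succ; infer_instance

/-- The last successful instance, which is the one with the largest guess. -/
noncomputable def best : ℕ := lastIndex (I.Succ V α) I.G

variable {V α}

theorem smp_nodup (g i : ℕ) : (I.smp V α g i).Nodup := (tok_nodup V i).filter _

theorem zero_notMem_smp (g i : ℕ) : 0 ∉ I.smp V α g i := fun h => by
  have := (mem_tok V (List.mem_filter.1 h).1).1
  omega

theorem E_pos : 0 < I.E := by have := I.two_le_E; omega

theorem G_pos : 0 < I.G := Nat.mul_pos I.s_pos I.E_pos

theorem best_lt : I.best V α < I.G := lastIndex_lt _ I.G_pos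

theorem v_mono : Monotone I.v := by
  refine monotone_nat_of_le_succ fun g => ?_
  have hE := I.E_pos
  unfold v
  rw [Nat.succ_div]
  split_ifs with h
  · rw [Nat.mod_eq_zero_of_dvd h, pow_succ]
    have := Nat.mod_lt g hE
    nlinarith [Nat.two_pow_pos (g / I.E)]
  · have hlt : g % I.E + 1 < I.E := by
      have := Nat.mod_lt g hE
      by_contra hge
      refine h ⟨g / I.E + 1, ?_⟩
      have := Nat.div_add_mod g I.E
      rw [mul_add]
      omega
    rw [add_zero, Nat.add_mod, Nat.mod_eq_of_lt (by omega : 1 < I.E), Nat.mod_eq_of_lt hlt]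
    exact Nat.mul_le_mul_right _ (by omega)

/-- The IDs selected by the instance `g`, in the order of the stream. -/
noncomputable def ids (V : Family I.n I.m) (α : Fin I.t → ZMod I.P) (g : ℕ) : List ℕ :=
  (I.run V α g I.m).1

theorem ids_lt {g q : ℕ} (hq : q ∈ I.ids V α g) : q < I.m := (sieve_basic I.m).2.1 q hq

theorem ids_nodup (g : ℕ) : (I.ids V α g).Nodup := (sieve_basic I.m).2.2.1

theorem ids_length_le (g : ℕ) : (I.ids V α g).length ≤ I.k := (sieve_basic I.m).1

/-- The IDs of the selected sets. -/
noncomputable def idEmb (V : Family I.n I.m) (α : Fin I.t → ZMod I.P) (g : ℕ) :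
    Fin (I.ids V α g).length ↪ Fin I.m :=
  ⟨fun q => ⟨(I.ids V α g)[q], I.ids_lt (List.getElem_mem _)⟩, fun p q h => by
    have := congrArg Fin.val h
    exact Fin.ext ((I.ids_nodup g).getElem_inj_iff.1 this)⟩

/-- The selected sets of the instance `g`, restricted to the sampled elements. -/
noncomputable def family (V : Family I.n I.m) (α : Fin I.t → ZMod I.P) (g : ℕ) :
    Family I.n (I.ids V α g).length where
  elems q := (V.elems (I.idEmb V α g q)).filter (fun x => I.Smp α (g / I.E) (x.val + 1))
  nodup _ := (V.nodup _).filter _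

theorem family_sets (g : ℕ) (q : Fin (I.ids V α g).length) :
    (I.family V α g).sets q = (V.sets (I.idEmb V α g q)).filter
      (fun x => I.Smp α (g / I.E) (x.val + 1)) := by
  ext x
  simp [Family.sets, family]

theorem smp_eq_map (g : ℕ) (i : Fin I.m) : I.smp V α g i =
    ((V.elems i).filter (fun x => I.Smp α (g / I.E) (x.val + 1))).map (fun x => x.val + 1) := by
  unfold smp tok
  rw [dif_pos i.isLt, List.filter_map]
  rfl

theorem family_tokens (g : ℕ) :
    (I.family V α g).tokens = logOf (I.smp V α g) (I.ids V α g) := by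
  have h : I.ids V α g =
      (List.ofFn fun q : Fin (I.ids V α g).length => q).map (fun q => (I.idEmb V α g q).val) := by
    rw [List.map_ofFn]
    exact (List.ofFn_getElem).symm
  unfold Family.tokens logOf
  conv_rhs => rw [h]
  rw [List.flatMap_map, show (I.family V α g).elems =
    (I.family V α g).elems ∘ fun q => q from rfl, ← List.map_ofFn, List.flatMap_map]
  refine List.flatMap_congr fun q _ => ?_
  rw [smp_eq_map]
  rfl

/-- Covers of sampled sets, in terms of tokens. -/
theorem unionOf_smp (g : ℕ) (B : Finset (Fin I.m)) :
    (unionOf (I.smp V α g) (B.image Fin.val)).card =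
      (I.sampled α (g / I.E) (cover V.sets B)).card := by
  have : unionOf (I.smp V α g) (B.image Fin.val) =
      (I.sampled α (g / I.E) (cover V.sets B)).image (fun x => x.val + 1) := by
    ext y
    simp only [unionOf, Finset.mem_biUnion, Finset.mem_image, List.mem_toFinset, sampled, cover,
      Finset.mem_filter]
    constructor
    · rintro ⟨_, ⟨i, hi, rfl⟩, hy⟩
      rw [smp_eq_map] at hy
      obtain ⟨x, hx, rfl⟩ := List.mem_map.1 hy
      obtain ⟨hx1, hx2⟩ := List.mem_filter.1 hx
      exact ⟨x, ⟨⟨i, hi, List.mem_toFinset.2 hx1⟩, by simpa using hx2⟩, rfl⟩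
    · rintro ⟨x, ⟨⟨i, hi, hx⟩, hs⟩, rfl⟩
      refine ⟨i, ⟨i, hi, rfl⟩, ?_⟩
      rw [smp_eq_map]
      exact List.mem_map.2 ⟨x, List.mem_filter.2 ⟨List.mem_toFinset.1 hx, by simpa using hs⟩, rfl⟩
  rw [this, Finset.card_image_of_injective]
  intro x y h
  exact Fin.ext (by simpa using h)

theorem ids_toFinset (g : ℕ) :
    (I.ids V α g).toFinset = (Finset.univ.map (I.idEmb V α g)).image Fin.val := by
  ext i
  simp only [List.mem_toFinset, Finset.mem_image, Finset.mem_map, Finset.mem_univ, true_and,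
    exists_exists_eq_and, List.mem_iff_getElem]
  constructor
  · rintro ⟨q, hq, rfl⟩; exact ⟨⟨q, hq⟩, rfl⟩
  · rintro ⟨q, rfl⟩; exact ⟨q, q.isLt, rfl⟩

theorem run_snd (g : ℕ) : (I.run V α g I.m).2 =
    (cover (I.family V α g).sets Finset.univ).card := by
  have h := sieve_card (k := I.k) (cap := I.cap) (W := I.T (g / I.E) * I.v g)
    (u := I.k * (2 * I.E * I.P)) (S := I.smp V α g) (I.zero_notMem_smp g) (I.smp_nodup g) I.m
  have h' : (I.run V α g I.m).2 = (unionOf (I.smp V α g) (I.ids V α g).toFinset).card := h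
  rw [h', ids_toFinset, unionOf_smp, sampled, ← cover_image_filter]
  congr 2
  funext q
  rw [family_sets]

theorem card_uniqueCover_family (g : ℕ) (B : Finset (Fin (I.ids V α g).length)) :
    uniqueCover (I.family V α g).sets B =
      I.sampled α (g / I.E) (uniqueCover V.sets (B.map (I.idEmb V α g))) := by
  rw [sampled, ← uniqueCover_image_filter]
  congr 1
  funext q
  rw [family_sets]

theorem family_maxFreq_le (g : ℕ) : maxFreq (I.family V α g).sets ≤ maxFreq V.sets := by
  refine Finset.sup_le fun x _ => le_trans ?_ (Finset.le_sup (f := freq V.sets) (Finset.mem_univ x))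
  unfold freq
  refine Finset.card_le_card_of_injOn (I.idEmb V α g) (fun q hq => ?_)
    ((I.idEmb V α g).injective.injOn)
  have := (Finset.mem_filter.1 hq).2
  rw [family_sets] at this
  exact Finset.mem_filter.2 ⟨Finset.mem_univ _, (Finset.mem_filter.1 this).1⟩

theorem family_maxSize_le (g : ℕ) : maxSize (I.family V α g).sets ≤ maxSize V.sets := by
  refine Finset.sup_le fun q _ => le_trans ?_
    (Finset.le_sup (f := fun i => (V.sets i).card) (Finset.mem_univ (I.idEmb V α g q)))
  rw [family_sets]
  exact Finset.card_filter_le _ _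

theorem logOf_length_le (g i : ℕ) :
    (logOf (I.smp V α g) (I.run V α g i).1).length ≤ I.k * (I.cap + 1) := by
  obtain ⟨h1, -, -, h4, -⟩ := sieve_basic (k := I.k) (cap := I.cap)
    (W := I.T (g / I.E) * I.v g) (u := I.k * (2 * I.E * I.P)) (S := I.smp V α g) i
  exact h4.trans (Nat.mul_le_mul_right _ h1)

theorem family_totalSize_le (g : ℕ) : (I.family V α g).totalSize ≤ I.k * (I.cap + 1) := by
  refine le_trans ?_ (I.logOf_length_le (V := V) (α := α) g I.m)
  change _ ≤ (logOf (I.smp V α g) (I.ids V α g)).length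
  rw [← family_tokens]
  unfold Family.totalSize Family.tokens
  rw [List.length_flatMap, List.map_ofFn, List.sum_ofFn]
  refine Finset.sum_le_sum fun q _ => ?_
  refine (List.toFinset_card_le _).trans ?_
  simp

/-! ### The approximation ratio -/

/-- The instance whose guess is the optimum, rounded down. -/
theorem exists_guess {o : ℕ} (ho : 0 < o) (hn : o ≤ I.n) :
    ∃ g < I.G, 2 ^ (g / I.E) ≤ o ∧ o < 2 ^ (g / I.E + 1) ∧ I.v g ≤ o * I.E ∧
      o * I.E ≤ I.v g + 2 ^ (g / I.E) := by
  have hE := I.E_pos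
  set j := Nat.log 2 o with hj
  have h1 : 2 ^ j ≤ o := Nat.pow_log_le_self 2 ho.ne'
  have h2 : o < 2 ^ (j + 1) := Nat.lt_pow_succ_log_self (by norm_num) o
  have hpos := Nat.two_pow_pos j
  set i := o * I.E / 2 ^ j with hi
  have hi1 : I.E ≤ i := by
    rw [hi, Nat.le_div_iff_mul_le hpos, mul_comm]
    exact Nat.mul_le_mul_right _ h1
  have hi2 : i < 2 * I.E := by
    rw [hi, Nat.div_lt_iff_lt_mul hpos]
    rw [pow_succ] at h2
    nlinarith
  have hg1 : (j * I.E + (i - I.E)) / I.E = j := by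
    rw [add_comm, Nat.add_mul_div_right _ _ hE, Nat.div_eq_of_lt (by omega), zero_add]
  have hg2 : (j * I.E + (i - I.E)) % I.E = i - I.E := by
    rw [add_comm, Nat.add_mul_mod_self_right, Nat.mod_eq_of_lt (by omega)]
  have hjs : j < I.s := by
    have := I.lt_two_pow_s
    have : I.n ≤ I.m * I.n := Nat.le_mul_of_pos_left _ (by have := I.two_le_m; omega)
    exact (Nat.pow_lt_pow_iff_right (a := 2) (by norm_num)).1 (by omega)
  refine ⟨j * I.E + (i - I.E), ?_, ?_⟩
  · unfold G
    calc _ < j * I.E + I.E := by omega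
      _ = (j + 1) * I.E := by ring
      _ ≤ _ := Nat.mul_le_mul_right _ hjs
  · have hv : I.v (j * I.E + (i - I.E)) = i * 2 ^ j := by
      unfold v
      rw [hg1, hg2, Nat.sub_add_cancel hi1]
    rw [hg1, hv]
    refine ⟨h1, h2, Nat.div_mul_le_self _ _, ?_⟩
    exact (Nat.lt_div_mul_add hpos).le

theorem two_pow_mul_E_le_v (g : ℕ) : 2 ^ (g / I.E) * I.E ≤ I.v g := by
  unfold v
  nlinarith [Nat.zero_le (g % I.E * 2 ^ (g / I.E))]

theorem div_lt_s {g : ℕ} (hg : g < I.G) : g / I.E < I.s :=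
  Nat.div_lt_of_lt_mul (by rw [mul_comm]; exact hg)

/-- The instance that guesses right is successful: the sampled sets of an optimal solution fit into
its memory and cover about as much as the guess, and the threshold rule keeps half of it. -/
theorem succ_of_guess (hGood : I.Good V.sets α) {g : ℕ} (hg : g < I.G)
    (h2 : opt V.sets I.k < 2 ^ (g / I.E + 1)) (hv : I.v g ≤ opt V.sets I.k * I.E) :
    I.Succ V α g := by
  obtain ⟨O, hO, hopt⟩ := exists_card_uniqueCover_eq_opt V.sets I.k
  have hk : 0 < I.k := by have := I.two_le_k; omega
  have hPn := I.P_prime.pos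
  have hP : (0 : ℝ) < I.P := Nat.cast_pos.2 hPn
  have hT : (0 : ℝ) < I.T (g / I.E) := Nat.cast_pos.2 (I.T_pos _)
  have hE : (2 : ℝ) ≤ I.E := by exact_mod_cast I.two_le_E
  have hj := I.div_lt_s hg
  set j := g / I.E with hjdef
  have hcap : ∀ i ∈ O.image Fin.val, (I.smp V α g i).length ≤ I.cap := by
    intro i hi
    obtain ⟨i, -, rfl⟩ := Finset.mem_image.1 hi
    have hU : (uniqueCover V.sets {i}).card ≤ opt V.sets I.k :=
      card_uniqueCover_le_opt V.sets (by simp; omega)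
    have hacc := hGood j hj {i} (by simp; omega) (by omega)
    have hlen : (I.smp V α g i).length = (I.sampled α j (uniqueCover V.sets {i})).card := by
      rw [← List.toFinset_card_of_nodup (I.smp_nodup g i), uniqueCover_singleton]
      have := I.unionOf_smp (V := V) (α := α) g {i}
      simpa [unionOf, cover] using this
    rw [hlen]
    have hacc' := (abs_lt.1 hacc).2
    have hU' : ((uniqueCover V.sets {i}).card : ℝ) ≤ 2 * 2 ^ j := by
      have : (uniqueCover V.sets {i}).card ≤ 2 ^ (j + 1) := by omega
      calc ((uniqueCover V.sets {i}).card : ℝ) ≤ ((2 ^ (j + 1) : ℕ) : ℝ) := by exact_mod_cast this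
        _ = _ := by push_cast; ring
    have hM : (I.T j : ℝ) / I.P * 2 ^ j ≤ I.Λ + 1 := by
      have : (I.T j : ℝ) * 2 ^ j ≤ I.P * (I.Λ + 1) := by exact_mod_cast I.T_mul_le hj
      rw [div_mul_eq_mul_div, div_le_iff₀ hP]
      linarith
    have hM0 : 0 ≤ (I.T j : ℝ) / I.P * 2 ^ j := by positivity
    have hdev : (I.T j : ℝ) / I.P * 2 ^ j / (2 * I.E) ≤ (I.T j : ℝ) / I.P * 2 ^ j :=
      div_le_self hM0 (by linarith)
    have hmean : (I.T j : ℝ) / I.P * (uniqueCover V.sets {i}).card ≤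
        2 * ((I.T j : ℝ) / I.P * 2 ^ j) := by
      calc _ ≤ (I.T j : ℝ) / I.P * (2 * 2 ^ j) := by gcongr
        _ = _ := by ring
    have : ((I.sampled α j (uniqueCover V.sets {i})).card : ℝ) ≤ ((3 * (I.Λ + 1) : ℕ) : ℝ) := by
      push_cast
      linarith
    exact_mod_cast this
  have hs := sieve_cover (W := I.T j * I.v g) (S := I.smp V α g) (N := I.m)
    (u' := 2 * I.E * I.P) (I.zero_notMem_smp g) (I.smp_nodup g) hk (O := O.image Fin.val)
    (Finset.card_image_le.trans hO) (fun i hi => by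
      obtain ⟨i, -, rfl⟩ := Finset.mem_image.1 hi; exact i.isLt) hcap
  change _ ≤ 2 * I.E * I.P * (I.run V α g I.m).2 ∨
    _ ≤ 2 * I.E * I.P * (I.run V α g I.m).2 + _ at hs
  have hE1 : ((I.E - 1 : ℕ) : ℝ) = I.E - 1 := by
    rw [Nat.cast_sub I.E_pos, Nat.cast_one]
  have hgoal : (I.T j : ℝ) * I.v g * (I.E - 1) ≤ 2 * I.E * I.E * I.P * (I.run V α g I.m).2 := by
    rcases hs with hs | hs
    · have hs' : (I.T j : ℝ) * I.v g ≤ 2 * I.E * I.P * (I.run V α g I.m).2 := by exact_mod_cast hs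
      have h0 : (0 : ℝ) ≤ (I.T j : ℝ) * I.v g := by positivity
      nlinarith
    · rw [unionOf_smp] at hs
      have hacc := (abs_lt.1 (hGood j hj O hO (by omega))).1
      have hsub : ((I.sampled α j (uniqueCover V.sets O)).card : ℝ) ≤
          (I.sampled α j (cover V.sets O)).card := by
        exact_mod_cast Finset.card_le_card
          (Finset.filter_subset_filter _ (uniqueCover_subset_cover V.sets O))
      have hs' : 2 * I.E * I.P * ((I.sampled α j (cover V.sets O)).card : ℝ) ≤
          2 * I.E * I.P * (I.run V α g I.m).2 + I.T j * I.v g := by exact_mod_cast hs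
      rw [hopt] at hacc
      have hvR : (I.v g : ℝ) ≤ opt V.sets I.k * I.E := by exact_mod_cast hv
      have hpR : (2 : ℝ) ^ j * I.E ≤ I.v g := by exact_mod_cast I.two_pow_mul_E_le_v g
      have hX : 2 * I.E * (I.T j * (opt V.sets I.k : ℝ)) - I.T j * 2 ^ j ≤
          2 * I.E * I.P * ((I.sampled α j (cover V.sets O)).card : ℝ) := by
        have e : 2 * (I.E : ℝ) * I.P * ((I.T j : ℝ) / I.P * (opt V.sets I.k : ℝ) -
            (I.T j : ℝ) / I.P * 2 ^ j / (2 * I.E)) =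
            2 * I.E * (I.T j * (opt V.sets I.k : ℝ)) - I.T j * 2 ^ j := by
          field_simp
        rw [← e]
        refine mul_le_mul_of_nonneg_left ?_ (by positivity)
        linarith
      have hX' : 2 * I.E * (I.T j * (opt V.sets I.k : ℝ)) - I.T j * 2 ^ j - I.T j * I.v g ≤
          2 * I.E * I.P * (I.run V α g I.m).2 := by linarith
      have hX2 : I.E * (2 * I.E * (I.T j * (opt V.sets I.k : ℝ)) - I.T j * 2 ^ j -
          I.T j * I.v g) ≤ 2 * I.E * I.E * I.P * (I.run V α g I.m).2 := by
        have := mul_le_mul_of_nonneg_left hX' (by linarith : (0 : ℝ) ≤ I.E)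
        linarith
      have hX3 : (I.T j : ℝ) * (2 * I.E * I.v g) ≤ I.T j * (2 * I.E * (opt V.sets I.k * I.E)) := by
        gcongr
      have hX4 : (I.T j : ℝ) * (2 ^ j * I.E) ≤ I.T j * I.v g := by gcongr
      linarith
  unfold Succ
  rw [← hjdef, ← Nat.cast_le (α := ℝ)]
  push_cast [hE1]
  exact hgoal

theorem opt_le_n : opt V.sets I.k ≤ I.n := by
  obtain ⟨O, -, hopt⟩ := exists_card_uniqueCover_eq_opt V.sets I.k
  rw [← hopt]
  exact (Finset.card_le_univ _).trans (by simp)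

theorem opt_pos (hd : 2 ≤ maxSize V.sets) : 0 < opt V.sets I.k := by
  obtain ⟨i, -, hi⟩ := Finset.lt_sup_iff.1 (show 1 < Finset.univ.sup (fun i => (V.sets i).card)
    from hd)
  have := card_uniqueCover_le_opt V.sets (k := I.k) (B := {i})
    (by simp; have := I.two_le_k; omega)
  rw [uniqueCover_singleton] at this
  omega

/-- The loss in the ratio, where `b = 1 / φ` and `η = 1 / E`: the guess `v` is within a factor
`1 - η` of the optimum `o`, and the threshold rule and the sampling errors cost further terms in
`η`. -/
theorem arith_ratio {b η ε v o x : ℝ} (hb0 : 0 ≤ b) (hb1 : b ≤ 1) (hη : 0 < η) (hη1 : η ≤ 1 / 2)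
    (hε : η ≤ ε) (ho : 0 ≤ o) (hx0 : 0 ≤ x) (hv : o * (1 - η) ≤ v)
    (hx : v * ((1 - η) * b / 2 - η / 2) ≤ x) : (b / 2 - 3 * ε) * o ≤ x := by
  rcases le_or_gt 0 ((1 - η) * b / 2 - η / 2) with hq | hq
  · have h1 : o * (1 - η) * ((1 - η) * b / 2 - η / 2) ≤ x :=
      (mul_le_mul_of_nonneg_right hv hq).trans hx
    have h2 : b / 2 - 3 * ε ≤ (1 - η) * ((1 - η) * b / 2 - η / 2) := by
      nlinarith [mul_nonneg hη.le (sub_nonneg.2 hb1), mul_nonneg (sq_nonneg η) hb0, sq_nonneg η]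
    nlinarith [mul_le_mul_of_nonneg_left h2 ho]
  · have : b / 2 - 3 * ε ≤ 0 := by nlinarith
    nlinarith

/-- A successful instance with a guess at least as large as the right one yields a good
approximation: an overestimate of the optimum only raises the amount that success certifies. -/
theorem isApprox_of_succ (hGood : I.Good V.sets α) {φ ε : ℝ} (hφ : 1 ≤ φ)
    (hε : 1 / (I.E : ℝ) ≤ ε) {g b : ℕ} (hgb : g ≤ b) (hbG : b < I.G) (hsucc : I.Succ V α b)
    (h1 : 2 ^ (g / I.E) ≤ opt V.sets I.k) (h2 : opt V.sets I.k < 2 ^ (g / I.E + 1))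
    (h4 : opt V.sets I.k * I.E ≤ I.v g + 2 ^ (g / I.E))
    (B : Finset (Fin (I.ids V α b).length))
    (hB : ((cover (I.family V α b).sets Finset.univ).card : ℝ) ≤
      φ * ((uniqueCover (I.family V α b).sets B).card : ℝ)) :
    IsApprox V.sets I.k (1 / (2 * φ) - 3 * ε) (B.map (I.idEmb V α b)) := by
  have hBk : (B.map (I.idEmb V α b)).card ≤ I.k := by
    rw [Finset.card_map]
    refine (Finset.card_le_univ _).trans ?_
    rw [Fintype.card_fin]
    exact I.ids_length_le _
  refine ⟨hBk, ?_⟩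
  have hj := I.div_lt_s hbG
  set U := uniqueCover V.sets (B.map (I.idEmb V α b)) with hU
  have hUopt : U.card ≤ opt V.sets I.k := card_uniqueCover_le_opt V.sets hBk
  have hU2 : U.card ≤ 2 ^ (b / I.E + 1) := by
    have : 2 ^ (g / I.E + 1) ≤ 2 ^ (b / I.E + 1) :=
      Nat.pow_le_pow_right (by norm_num) (Nat.add_le_add_right (Nat.div_le_div_right hgb) 1)
    omega
  have hacc := (abs_lt.1 (hGood _ hj _ hBk hU2)).2
  rw [card_uniqueCover_family, ← run_snd] at hB
  rw [← hU] at hB hacc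
  set j := b / I.E with hjdef
  have hP : (0 : ℝ) < I.P := Nat.cast_pos.2 I.P_prime.pos
  have hT : (0 : ℝ) < I.T j := Nat.cast_pos.2 (I.T_pos _)
  have hE : (2 : ℝ) ≤ I.E := by exact_mod_cast I.two_le_E
  have hE0 : (0 : ℝ) < I.E := by linarith
  have hφ0 : 0 < φ := by linarith
  have hsuccR : (I.T j : ℝ) * I.v b * (I.E - 1) ≤ 2 * I.E * I.E * I.P * (I.run V α b I.m).2 := by
    unfold Succ at hsucc
    have hE1 : ((I.E - 1 : ℕ) : ℝ) = I.E - 1 := by rw [Nat.cast_sub I.E_pos, Nat.cast_one]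
    rw [← hE1]
    exact_mod_cast hsucc
  have hpR : (2 : ℝ) ^ j * I.E ≤ I.v b := by exact_mod_cast I.two_pow_mul_E_le_v b
  have hvv : (I.v g : ℝ) ≤ I.v b := by exact_mod_cast I.v_mono hgb
  have h4R : (opt V.sets I.k : ℝ) * I.E ≤ I.v g + 2 ^ (g / I.E) := by exact_mod_cast h4
  have h1R : (2 : ℝ) ^ (g / I.E) ≤ opt V.sets I.k := by exact_mod_cast h1
  -- The sample of the unique cover, bounded below through the ratio and above through accuracy.
  have hX : (I.T j : ℝ) * I.v b * (I.E - 1) ≤ 2 * I.E * I.E * I.P * (φ *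
      ((I.T j : ℝ) / I.P * U.card + (I.T j : ℝ) / I.P * 2 ^ j / (2 * I.E))) := by
    refine hsuccR.trans (mul_le_mul_of_nonneg_left (hB.trans ?_) (by positivity))
    refine mul_le_mul_of_nonneg_left ?_ hφ0.le
    linarith
  have e : 2 * (I.E : ℝ) * I.E * I.P * (φ *
      ((I.T j : ℝ) / I.P * U.card + (I.T j : ℝ) / I.P * 2 ^ j / (2 * I.E))) =
      I.T j * (φ * (2 * I.E * I.E * U.card + I.E * 2 ^ j)) := by
    field_simp
  rw [e, mul_assoc, mul_le_mul_iff_right₀ hT] at hX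
  have hφv : φ * (2 ^ j * I.E) ≤ φ * I.v b := mul_le_mul_of_nonneg_left hpR hφ0.le
  have hX' : (I.v b : ℝ) * (I.E - 1) ≤ φ * (2 * I.E * I.E * U.card) + φ * I.v b := by
    linarith
  rw [show 1 / (2 * φ) = 1 / φ / 2 by rw [div_div, mul_comm]]
  refine arith_ratio (b := 1 / φ) (η := 1 / I.E) (v := I.v b / I.E) (by positivity)
    (by rw [div_le_one hφ0]; exact hφ) (by positivity)
    (one_div_le_one_div_of_le (by norm_num) hE) hε (by positivity) (by positivity) ?_ ?_
  · rw [le_div_iff₀ hE0]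
    have : (opt V.sets I.k : ℝ) * (1 - 1 / I.E) * I.E = opt V.sets I.k * I.E - opt V.sets I.k := by
      field_simp
    rw [this]
    -- `opt * E ≤ v + 2 ^ j` and `2 ^ j ≤ opt`
    linarith
  · have e2 : (I.v b : ℝ) / I.E * ((1 - 1 / I.E) * (1 / φ) / 2 - 1 / I.E / 2) =
        (I.v b * (I.E - 1) - φ * I.v b) / (φ * (2 * I.E * I.E)) := by
      field_simp
    rw [e2, div_le_iff₀ (by positivity)]
    linarith

/-- If all samples are accurate, then any subcollection of the selected family that covers uniquely
at least `1 / φ` of it is a good approximation in the whole universe. -/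
theorem isApprox_of_good (hGood : I.Good V.sets α) (hd : 2 ≤ maxSize V.sets) {φ ε : ℝ}
    (hφ : 1 ≤ φ) (hε : 1 / (I.E : ℝ) ≤ ε) (B : Finset (Fin (I.ids V α (I.best V α)).length))
    (hB : ((cover (I.family V α (I.best V α)).sets Finset.univ).card : ℝ) ≤
      φ * ((uniqueCover (I.family V α (I.best V α)).sets B).card : ℝ)) :
    IsApprox V.sets I.k (1 / (2 * φ) - 3 * ε) (B.map (I.idEmb V α (I.best V α))) := by
  obtain ⟨g, hg, h1, h2, h3, h4⟩ := I.exists_guess (I.opt_pos hd) I.opt_le_n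
  obtain ⟨hgb, hsucc⟩ := lastIndex_spec (I.Succ V α) hg (I.succ_of_guess hGood hg h2 h3)
  exact I.isApprox_of_succ hGood hφ hε hgb I.best_lt hsucc h1 h2 h4 B hB

end Params

end MUC

namespace MUC

/-! ### Writing programs -/

instance : Add Expr := ⟨.bin .add⟩
instance : Sub Expr := ⟨.bin .sub⟩
instance : Mul Expr := ⟨.bin .mul⟩
instance : Div Expr := ⟨.bin .div⟩
instance : Mod Expr := ⟨.bin .mod⟩

section Eval

variable (μ : Mem)

@[simp] theorem eval_lit (c : ℕ) : (Expr.lit c).eval μ = c := rfl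
@[simp] theorem eval_get (a : ℕ) (e : Expr) : (Expr.get a e).eval μ = μ (a, e.eval μ) := rfl
@[simp] theorem eval_add (e f : Expr) : (e + f).eval μ = e.eval μ + f.eval μ := rfl
@[simp] theorem eval_sub (e f : Expr) : (e - f).eval μ = e.eval μ - f.eval μ := rfl
@[simp] theorem eval_mul (e f : Expr) : (e * f).eval μ = e.eval μ * f.eval μ := rfl
@[simp] theorem eval_div (e f : Expr) : (e / f).eval μ = e.eval μ / f.eval μ := rfl
@[simp] theorem eval_mod (e f : Expr) : (e % f).eval μ = e.eval μ % f.eval μ := rfl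
@[simp] theorem eval_lt (e f : Expr) :
    (Expr.bin .lt e f).eval μ = if e.eval μ < f.eval μ then 1 else 0 := rfl
@[simp] theorem eval_eq (e f : Expr) :
    (Expr.bin .eq e f).eval μ = if e.eval μ = f.eval μ then 1 else 0 := rfl

@[simp] theorem update_cell (a i v b j : ℕ) :
    (Finsupp.update μ (a, i) v) (b, j) = if b = a ∧ j = i then v else μ (b, j) := by
  rw [Finsupp.coe_update, Function.update_apply]
  simp only [Prod.mk.injEq]

end Eval

/-- An input cell: `n`, `m`, `k`, `⌈1 / ε⌉`. -/
abbrev inp (i : ℕ) : Expr := .get 0 (.lit i)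
/-- A cell of the array `3` of parameters. -/
abbrev par (i : ℕ) : Expr := .get 3 (.lit i)
/-- A cell of the array `4` of temporary values. -/
abbrev tmp (i : ℕ) : Expr := .get 4 (.lit i)
/-- Assignment of a parameter. -/
abbrev setPar (i : ℕ) (e : Expr) : Prog := .assign 3 (.lit i) e
/-- Assignment of a temporary value. -/
abbrev setTmp (i : ℕ) (e : Expr) : Prog := .assign 4 (.lit i) e

namespace Params

variable (I : Params)

/-- The lengths of the arrays. The arrays `0`, `3`, `4` hold the input, the parameters and temporary
values. For each instance `g`, the arrays `5` to `9` hold the ends of its log and of the set being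
read, the number of new elements of this set, the number of selected sets, and the size of their
cover; its log occupies `C` cells of the array `10`, and its IDs occupy `k` cells of the array `11`.
The array `12` holds the coefficients of the hash function, and `13`, `14` hold the numbers `T` and
`v` of the instances. -/
def len : ℕ → ℕ
  | 0 => 4
  | 3 => 8
  | 4 => 12
  | 5 => I.G
  | 6 => I.G
  | 7 => I.G
  | 8 => I.G
  | 9 => I.G
  | 10 => I.G * I.C
  | 11 => I.G * I.k
  | 12 => I.t
  | 13 => I.G
  | 14 => I.G
  | _ => 0

/-- The cells of the arrays below `15` with given lengths. -/
def cells (len : ℕ → ℕ) : Finset (ℕ × ℕ) :=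
  (Finset.range 15).biUnion fun a => {a} ×ˢ Finset.range (len a)

theorem mem_cells {len : ℕ → ℕ} {a i : ℕ} : (a, i) ∈ cells len ↔ a < 15 ∧ i < len a := by
  simp [cells]

/-- A bound on all numbers stored, and on the numbers of rounds of all loops. -/
noncomputable def N : ℕ :=
  2 * (I.P * I.P) + 8 * (I.m * I.n * I.E) + I.G * I.C + I.C + I.G * I.k + I.t + I.Λ + I.cap + I.m +
    I.n + I.k + 20

theorem mn_le_mnE : I.m * I.n ≤ I.m * I.n * I.E := Nat.le_mul_of_pos_right _ I.E_pos

theorem E_le_mnE : I.E ≤ I.m * I.n * I.E :=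
  Nat.le_mul_of_pos_left _ (by have := I.four_le; omega)

theorem C_pos : 0 < I.C := Nat.mul_pos (Nat.succ_pos _) (Nat.succ_pos _)

theorem G_le : I.G ≤ I.G * I.C := Nat.le_mul_of_pos_right _ I.C_pos

theorem s_lt_mn : I.s < 2 * (I.m * I.n) := Nat.lt_two_pow_self.trans_le I.two_pow_s_le

/-- The region of the memory that the pass uses. -/
noncomputable def region : Region where
  F := cells I.len
  N := I.N
  w := Nat.size I.N
  ν := 0
  one_le := Nat.size_pos.2 (by unfold N; omega)
  size_N := le_rfl
  size_ν := fun _ => by simp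

@[simp] theorem region_N : I.region.N = I.N := rfl

theorem mem_region {a i : ℕ} (h : i < I.len a) : (a, i) ∈ I.region.F := by
  refine mem_cells.2 ⟨?_, h⟩
  by_contra ha
  have : I.len a = 0 := by
    unfold len
    split <;> first | rfl | omega
  omega

/-- The memory contains the input and the parameters other than `P`. -/
structure Consts (μ : Mem) : Prop where
  n : μ (0, 0) = I.n
  m : μ (0, 1) = I.m
  k : μ (0, 2) = I.k
  E : μ (0, 3) = I.E
  s : μ (3, 0) = I.s
  t : μ (3, 1) = I.t
  Λ : μ (3, 2) = I.Λ
  cap : μ (3, 4) = I.cap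
  C : μ (3, 5) = I.C
  G : μ (3, 6) = I.G

variable {I} in
theorem Consts.update {μ : Mem} (h : I.Consts μ) {a i v : ℕ}
    (ha : 4 ≤ a ∨ (a = 3 ∧ (i = 3 ∨ i = 7))) : I.Consts (Finsupp.update μ (a, i) v) := by
  constructor <;> rw [update_cell, if_neg (by omega)]
  exacts [h.n, h.m, h.k, h.E, h.s, h.t, h.Λ, h.cap, h.C, h.G]

/-- The arrays of the instances are empty. -/
def Clean (μ : Mem) : Prop := ∀ a i, 5 ≤ a → a ≤ 11 → μ (a, i) = 0

theorem Clean.update {μ : Mem} (h : Clean μ) {a i v : ℕ} (ha : a < 5 ∨ 11 < a) :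
    Clean (Finsupp.update μ (a, i) v) := by
  intro b j h1 h2
  rw [update_cell, if_neg (by omega)]
  exact h b j h1 h2

end Params

/-! ### Initialization -/

/-- Computes `s` as the least number with `m * n < 2 ^ s`. -/
def initScale : Prog :=
  .seq (setPar 0 (.lit 0)) <| .seq (setTmp 0 (.lit 1)) <|
  .while (.bin .lt (tmp 0) (inp 1 * inp 0 + .lit 1)) <|
    .seq (setTmp 0 (tmp 0 * .lit 2)) (setPar 0 (par 0 + .lit 1))

/-- Computes the parameters other than `s` and `P`. -/
def initParams (c : ℕ) : Prog :=
  .seq (setPar 1 (.lit (2 * (c + 2)) * inp 2 * par 0)) <|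
  .seq (setPar 2 (.lit 4096 * par 1 * inp 3 * inp 3)) <|
  .seq (setPar 4 (.lit 3 * (par 2 + .lit 1))) <|
  .seq (setPar 5 ((inp 2 + .lit 1) * (par 4 + .lit 1))) <|
  setPar 6 (par 0 * inp 3)

/-- Computes `P` by trial division. -/
def initPrime : Prog :=
  .seq (setPar 3 (inp 1 * inp 0 + .lit 1)) <| .seq (setTmp 1 (.lit 2)) <|
  .while (.bin .lt (tmp 1) (par 3)) <|
    .ite (par 3 % tmp 1) (setTmp 1 (tmp 1 + .lit 1))
      (.seq (setPar 3 (par 3 + .lit 1)) (setTmp 1 (.lit 2)))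

/-- Draws the coefficients of the hash function. -/
def initCoeffs : Prog :=
  .loop 2 (par 1) <|
    .seq (setTmp 0 (.lit 0)) <|
    .seq (.loop 3 (par 0 + .lit 1) <|
      .seq (.flip 4 (.lit 1)) (setTmp 0 (.lit 2 * tmp 0 + tmp 1))) <|
    .assign 12 (tmp 2) (tmp 0 % par 3)

/-- Computes the tables of `T` and `v`, with `2 ^ (g / E)` as a temporary value. -/
def initTables : Prog :=
  .seq (setTmp 0 (.lit 1)) <|
  .loop 2 (par 6) <|
    .seq (.assign 13 (tmp 2) (par 3 - (par 3 - (par 3 * par 2 / tmp 0 + .lit 1)))) <|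
    .seq (.assign 14 (tmp 2) ((tmp 2 % inp 3 + inp 3) * tmp 0)) <|
    .ite ((tmp 2 + .lit 1) % inp 3) .skip (setTmp 0 (tmp 0 * .lit 2))

namespace Params

variable {I : Params} {s : State} {Q : State → Prop}

theorem wp_initScale (hn : s.mem (0, 0) = I.n) (hm : s.mem (0, 1) = I.m) (hk : s.mem (0, 2) = I.k)
    (hE : s.mem (0, 3) = I.E) (hc : Clean s.mem)
    (hQ : ∀ μ : Mem, μ (0, 0) = I.n → μ (0, 1) = I.m → μ (0, 2) = I.k → μ (0, 3) = I.E →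
      μ (3, 0) = I.s → Clean μ → Q ⟨μ, s.input, s.coins⟩) :
    Wp I.region initScale Q s := by
  have h4 := I.four_le
  have hmn := I.mn_le_mnE
  refine wp_seq (wp_assign (I.mem_region (by simp [len])) (by simp) ?_)
  refine wp_seq (wp_assign (I.mem_region (by simp [len])) (by simp [N]) ?_)
  refine wp_while (fun i s' => i ≤ I.s ∧ s'.mem (0, 0) = I.n ∧ s'.mem (0, 1) = I.m ∧
    s'.mem (0, 2) = I.k ∧ s'.mem (0, 3) = I.E ∧ s'.mem (3, 0) = i ∧ s'.mem (4, 0) = 2 ^ i ∧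
    Clean s'.mem ∧ s'.input = s.input ∧ s'.coins = s.coins) I.s ?_ ?_ ?_
  · have := I.s_lt_mn
    simp [N]; omega
  · simp [hn, hm, hk, hE]
    exact (hc.update (by omega)).update (by omega)
  · rintro i ⟨μ, inp', coins'⟩ - ⟨hi, h1, h2, h3, h4, h5, h6, h7, h8, h9⟩
    dsimp only at *
    subst h8 h9
    simp only [eval_lt, eval_get, eval_lit, eval_add, eval_mul, h1, h2, h6]
    constructor
    · intro h
      have hlt : I.m * I.n < 2 ^ i := by
        by_contra hge
        rw [if_pos (by omega)] at h
        omega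
      have : I.s = i := le_antisymm (Nat.size_le.2 hlt) hi
      exact hQ μ h1 h2 h3 h4 (by rw [h5, this]) h7
    · intro h
      have hle : 2 ^ i ≤ I.m * I.n := by
        by_contra hge
        rw [if_neg (by omega)] at h
        omega
      have hi' : i < I.s := Nat.lt_size.2 hle
      refine ⟨hi', ?_⟩
      refine wp_seq (wp_assign (I.mem_region (by simp [len])) ?_ ?_)
      · simp [h6, N]; omega
      refine wp_assign (I.mem_region (by simp [len])) ?_ ?_
      · have := I.s_lt_mn
        simp [h5, N]; omega
      · refine ⟨hi', ?_⟩
        simp [h1, h2, h3, h4, h5, h6, pow_succ]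
        exact (h7.update (by omega)).update (by omega)

theorem wp_initParams (hn : s.mem (0, 0) = I.n) (hm : s.mem (0, 1) = I.m)
    (hk : s.mem (0, 2) = I.k) (hE : s.mem (0, 3) = I.E) (hs : s.mem (3, 0) = I.s)
    (hc : Clean s.mem)
    (hQ : ∀ μ : Mem, I.Consts μ → Clean μ → Q ⟨μ, s.input, s.coins⟩) :
    Wp I.region (initParams I.c) Q s := by
  have ht : 2 * (I.c + 2) * I.k * I.s = I.t := rfl
  have hΛ : 4096 * I.t * I.E * I.E = I.Λ := rfl
  have hcap : 3 * (I.Λ + 1) = I.cap := rfl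
  have hC : (I.k + 1) * (I.cap + 1) = I.C := rfl
  have hG : I.s * I.E = I.G := rfl
  have hGC := I.G_le
  refine wp_seq (wp_assign (I.mem_region (by simp [len])) ?_ ?_)
  · simp only [eval_mul, eval_lit, eval_get, hk, hs, ht, region_N]; unfold N; omega
  simp only [eval_mul, eval_lit, eval_get, hk, hs, ht]
  refine wp_seq (wp_assign (I.mem_region (by simp [len])) ?_ ?_)
  · simp [hE, hΛ]; unfold N; omega
  simp only [eval_mul, eval_lit, eval_get, update_cell, hE]
  simp only [reduceCtorEq, Nat.reduceEqDiff, and_self, if_true,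
    if_false, hΛ]
  refine wp_seq (wp_assign (I.mem_region (by simp [len])) ?_ ?_)
  · simp [hcap]; unfold N; omega
  refine wp_seq (wp_assign (I.mem_region (by simp [len])) ?_ ?_)
  · simp [hcap, hk, hC]; unfold N; omega
  refine wp_assign (I.mem_region (by simp [len])) ?_ ?_
  · simp [hs, hE, hG]; unfold N; omega
  refine hQ _ ?_ ?_
  · constructor <;> simp [hn, hm, hk, hE, hs, hcap, hC, hG]
  · exact ((((hc.update (by omega)).update (by omega)).update (by omega)).update
      (by omega)).update (by omega)

/-- Trial division by `d` of a candidate `p`: no prime lies strictly between `m * n` and `p`, and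
`p` has no divisor from `2` to `d - 1`. -/
theorem wp_initPrime (hC : I.Consts s.mem) (hc : Clean s.mem)
    (hQ : ∀ μ : Mem, I.Consts μ → Clean μ → μ (3, 3) = I.P → Q ⟨μ, s.input, s.coins⟩) :
    Wp I.region initPrime Q s := by
  have h4 := I.four_le
  have hmn := I.mn_le_mnE
  have hP := I.lt_P
  have hPN : I.P * I.P + I.P ≤ 2 * (I.P * I.P) := by nlinarith
  refine wp_seq (wp_assign (I.mem_region (by simp [len])) ?_ ?_)
  · simp [hC.n, hC.m, N]; omega
  refine wp_seq (wp_assign (I.mem_region (by simp [len])) (by simp [N]) ?_)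
  refine wp_while (fun i s' => ∃ p d, I.Consts s'.mem ∧ Clean s'.mem ∧ s'.mem (3, 3) = p ∧
    s'.mem (4, 1) = d ∧ I.m * I.n < p ∧ p ≤ I.P ∧ 2 ≤ d ∧ d ≤ p ∧ (∀ e, 2 ≤ e → e < d → ¬ e ∣ p) ∧
    i ≤ (p - (I.m * I.n + 1)) * I.P + d ∧ s'.input = s.input ∧ s'.coins = s.coins)
    (I.P * I.P + I.P) (by simp [N]; omega) ?_ ?_
  · refine ⟨I.m * I.n + 1, 2, (hC.update (by simp)).update (by omega),
      (hc.update (by omega)).update (by omega), by simp [hC.n, hC.m], by simp, by omega, by omega,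
      le_rfl, by omega, by omega, by omega, rfl, rfl⟩
  · rintro i ⟨μ, inp', coins'⟩ - ⟨p, d, h1, h2, h3, h4, h5, h6, h7, h8, h9, h10, h11, h12⟩
    dsimp only at *
    subst h11 h12
    simp only [eval_lt, eval_get, eval_lit, h3, h4]
    constructor
    · intro h
      have hdp : d = p := by
        by_contra hne
        rw [if_pos (by omega)] at h
        omega
      have hprime : p.Prime := by
        rw [Nat.prime_def_lt']
        exact ⟨by omega, fun e he hep => h9 e he (by omega)⟩
      have : I.P ≤ p := Nat.find_min' _ ⟨h5, hprime⟩
      exact hQ μ h1 h2 (by omega)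
    · intro h
      have hdp : d < p := by
        by_contra hne
        rw [if_neg hne] at h
        omega
      refine ⟨?_, wp_ite ?_ ?_⟩
      · have : (p - (I.m * I.n + 1)) * I.P ≤ I.P * I.P := Nat.mul_le_mul_right _ (by omega)
        omega
      · intro hmod
        simp only [eval_mod, eval_get, eval_lit, h3, h4] at hmod
        refine wp_assign (I.mem_region (by simp [len])) ?_ ?_
        · simp [h4, N]; omega
        · refine ⟨p, d + 1, h1.update (by omega), h2.update (by omega), by simp [h3],
            by simp [h4], h5, h6, by omega, by omega, ?_, by omega, rfl, rfl⟩
          intro e he hed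
          rcases Nat.lt_succ_iff_lt_or_eq.1 hed with hed | rfl
          · exact h9 e he hed
          · exact fun hdvd => hmod (Nat.mod_eq_zero_of_dvd hdvd)
      · intro hmod
        simp only [eval_mod, eval_get, eval_lit, h3, h4] at hmod
        have hne : p ≠ I.P := by
          rintro rfl
          exact Nat.prime_def_lt'.1 I.P_prime |>.2 d h7 hdp (Nat.dvd_of_mod_eq_zero hmod)
        refine wp_seq (wp_assign (I.mem_region (by simp [len])) ?_ ?_)
        · simp [h3, N]; omega
        refine wp_assign (I.mem_region (by simp [len])) (by simp [N]) ?_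
        refine ⟨p + 1, 2, (h1.update (by simp)).update (by omega),
          (h2.update (by omega)).update (by omega), by simp [h3], by simp, by omega, by omega,
          le_rfl, by omega, by omega, ?_, rfl, rfl⟩
        have : p + 1 - (I.m * I.n + 1) = (p - (I.m * I.n + 1)) + 1 := by omega
        rw [this, add_mul, one_mul]
        omega

theorem wp_initCoeffs (hC : I.Consts s.mem) (hc : Clean s.mem) (hP : s.mem (3, 3) = I.P)
    (hQ : ∀ (μ : Mem) (ω : ℕ → Bool), I.Consts μ → Clean μ → μ (3, 3) = I.P →
      (∀ q < I.t, μ (12, q) = draw s.coins (q * (I.s + 1)) (I.s + 1) % I.P) →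
      Q ⟨μ, s.input, ω⟩) :
    Wp I.region initCoeffs Q s := by
  have h4 := I.four_le
  have hmn := I.mn_le_mnE
  have hPp := I.P_prime.pos
  have hPN : I.P ≤ I.P * I.P := Nat.le_mul_self _
  have hs := I.s_lt_mn
  refine wp_loop (fun q s' => I.Consts s'.mem ∧ Clean s'.mem ∧ s'.mem (3, 3) = I.P ∧
    (∀ p < q, s'.mem (12, p) = draw s.coins (p * (I.s + 1)) (I.s + 1) % I.P) ∧
    s'.input = s.input ∧ s'.coins = fun j => s.coins (q * (I.s + 1) + j)) I.t
    (by simp [N]; omega) (I.mem_region (by simp [len])) ?_ ?_ ?_ ?_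
  · exact ⟨hC.update (by omega), hc.update (by omega), by simp [hP], by omega, rfl, by simp⟩
  · rintro i s' ⟨h1, -⟩
    exact h1.t
  · rintro q ⟨μ, inp', ω⟩ - hq hx ⟨h1, h2, h3, h5, h6, h7⟩
    dsimp only at *
    subst h6 h7
    refine wp_seq (wp_assign (I.mem_region (by simp [len])) (by simp) ?_)
    simp only [eval_lit]
    refine wp_seq (wp_loop (fun w s' => I.Consts s'.mem ∧ Clean s'.mem ∧ s'.mem (3, 3) = I.P ∧
      (∀ p < q, s'.mem (12, p) = draw s.coins (p * (I.s + 1)) (I.s + 1) % I.P) ∧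
      s'.mem (4, 0) = draw s.coins (q * (I.s + 1)) w ∧ s'.mem (4, 2) = q ∧
      s'.input = s.input ∧ s'.coins = fun j => s.coins (q * (I.s + 1) + w + j)) (I.s + 1)
      (by simp [N]; omega) (I.mem_region (by simp [len])) ?_ ?_ ?_ ?_)
    · exact ⟨(h1.update (by omega)).update (by omega), (h2.update (by omega)).update (by omega),
        by simp [h3], by simpa using h5, by simp [draw], by simp [hx], rfl, by simp⟩
    · rintro i s' ⟨h1, -⟩
      simp [h1.s]
    · rintro w ⟨μ, inp', ω⟩ - hw hx ⟨h1, h2, h3, h5, h6, h7, h8, h9⟩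
      dsimp only at *
      subst h8 h9
      have hd := draw_lt s.coins (q * (I.s + 1)) (w + 1)
      have hd' : 2 ^ (w + 1) ≤ 2 ^ (I.s + 1) := Nat.pow_le_pow_right (by norm_num) (by omega)
      rw [pow_succ 2 I.s] at hd'
      have hd2 := I.two_pow_s_le
      refine wp_seq (wp_flip (I.mem_region (by simp [len])) (by simp [N]) ?_)
      refine wp_assign (I.mem_region (by simp [len])) ?_ ?_
      · rw [draw] at hd
        simp [h6, N]
        omega
      · refine ⟨by simp [hx], ((h1.update (by omega)).update (by omega)).update (by omega),
          ((h2.update (by omega)).update (by omega)).update (by omega), by simp [h3],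
          by simpa using h5, by simp [h6, draw], by simp [h7], rfl, ?_⟩
        funext j
        dsimp only
        congr 1
        ring
    · rintro ⟨μ, inp', ω⟩ - hx ⟨h1, h2, h3, h5, h6, h7, h8, h9⟩
      dsimp only at *
      subst h8 h9
      have hmod := Nat.mod_lt (draw s.coins (q * (I.s + 1)) (I.s + 1)) hPp
      refine wp_assign (I.mem_region (by simpa [len, h7] using hq)) ?_ ?_
      · simp [h6, h3, N]
        omega
      · simp only [eval_get, eval_lit, eval_mod, h6, h7, h3]
        refine ⟨by simp [h7], (h1.update (by omega)).update (by omega),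
          (h2.update (by omega)).update (by omega), by simp [h3], ?_, trivial, ?_⟩
        · intro p hp
          rcases Nat.lt_succ_iff_lt_or_eq.1 hp with hp | rfl
          · have : p ≠ q := by omega
            simpa [this] using h5 p hp
          · simp
        · funext j
          congr 1
          ring
  · rintro ⟨μ, inp', ω⟩ - hx ⟨h1, h2, h3, h5, h6, h7⟩
    dsimp only at *
    subst h6
    exact hQ μ ω h1 h2 h3 h5

variable (I) in
/-- The memory contains everything that the pass reads and does not change: the input, the
parameters, the hash function `α`, and the tables. -/
structure Ready (α : Fin I.t → ZMod I.P) (μ : Mem) : Prop extends I.Consts μ where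
  P : μ (3, 3) = I.P
  coeff : ∀ q : Fin I.t, μ (12, q.val) = (α q).val
  T : ∀ g < I.G, μ (13, g) = I.T (g / I.E)
  v : ∀ g < I.G, μ (14, g) = I.v g

theorem Ready.update {α : Fin I.t → ZMod I.P} {μ : Mem} (h : I.Ready α μ) {a i v : ℕ}
    (ha : (4 ≤ a ∧ a ≤ 11) ∨ 15 ≤ a ∨ (a = 3 ∧ i = 7)) :
    I.Ready α (Finsupp.update μ (a, i) v) where
  toConsts := h.toConsts.update (by omega)
  P := by rw [update_cell, if_neg (by omega)]; exact h.P
  coeff q := by rw [update_cell, if_neg (by omega)]; exact h.coeff q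
  T g hg := by rw [update_cell, if_neg (by omega)]; exact h.T g hg
  v g hg := by rw [update_cell, if_neg (by omega)]; exact h.v g hg

theorem v_le {g : ℕ} (hg : g < I.G) : I.v g ≤ 2 * (I.m * I.n * I.E) := by
  have h1 := I.two_pow_le (I.div_lt_s hg)
  have h2 := Nat.mod_lt g I.E_pos
  unfold v
  calc _ ≤ (2 * I.E) * (I.m * I.n) := Nat.mul_le_mul (by omega) h1
    _ = _ := by ring

theorem wp_initTables {α : Fin I.t → ZMod I.P} (hC : I.Consts s.mem) (hc : Clean s.mem)
    (hP : s.mem (3, 3) = I.P) (hα : ∀ q : Fin I.t, s.mem (12, q.val) = (α q).val)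
    (hQ : ∀ μ : Mem, I.Ready α μ → Clean μ → Q ⟨μ, s.input, s.coins⟩) :
    Wp I.region initTables Q s := by
  have h4 := I.four_le
  have hmn := I.mn_le_mnE
  have hPN : I.P ≤ I.P * I.P := Nat.le_mul_self _
  have hE := I.E_pos
  have hGC := I.G_le
  refine wp_seq (wp_assign (I.mem_region (by simp [len])) (by simp [N]) ?_)
  simp only [eval_lit]
  refine wp_loop (fun g s' => I.Consts s'.mem ∧ Clean s'.mem ∧ s'.mem (3, 3) = I.P ∧
    (∀ q : Fin I.t, s'.mem (12, q.val) = (α q).val) ∧ s'.mem (4, 0) = 2 ^ (g / I.E) ∧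
    (∀ g' < g, s'.mem (13, g') = I.T (g' / I.E)) ∧ (∀ g' < g, s'.mem (14, g') = I.v g') ∧
    s'.input = s.input ∧ s'.coins = s.coins) I.G (by simp [N]; omega)
    (I.mem_region (by simp [len])) ?_ ?_ ?_ ?_
  · exact ⟨(hC.update (by omega)).update (by omega), (hc.update (by omega)).update (by omega),
      by simp [hP], by simpa using hα, by simp, by omega, by omega, rfl, rfl⟩
  · rintro i s' ⟨h1, -⟩
    exact h1.G
  · rintro g ⟨μ, inp', ω⟩ - hg hx ⟨h1, h2, h3, h5, h6, h7, h8, h9, h10⟩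
    dsimp only at *
    subst h9 h10
    have hTN : I.T (g / I.E) ≤ I.N := by
      have := I.T_le (g / I.E)
      unfold N
      omega
    have hvN : I.v g ≤ I.N := by
      have := I.v_le hg
      unfold N
      omega
    have hTeq : I.P - (I.P - (I.P * I.Λ / 2 ^ (g / I.E) + 1)) = I.T (g / I.E) :=
      (by omega : ∀ a b : ℕ, a - (a - b) = min a b) _ _
    have hveq : (g % I.E + I.E) * 2 ^ (g / I.E) = I.v g := rfl
    have hscale := I.two_pow_le (I.div_lt_s hg)
    refine wp_seq (wp_assign (I.mem_region (by simpa [len, hx] using hg)) ?_ ?_)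
    · simp only [eval_sub, eval_add, eval_mul, eval_div, eval_get, eval_lit, h3, h1.Λ, h6, hTeq,
        region_N]
      exact hTN
    simp only [eval_sub, eval_add, eval_mul, eval_div, eval_get, eval_lit, h3, h1.Λ, h6, hTeq, hx]
    refine wp_seq (wp_assign (I.mem_region (by simpa [len, hx] using hg)) ?_ ?_)
    · simpa [h1.E, h6, hx, hveq] using hvN
    simp only [eval_add, eval_mul, eval_mod, eval_get, eval_lit, update_cell, hx, h1.E, h6,
      Nat.reduceEqDiff, false_and, if_false, hveq]
    have hT' : ∀ g' < g + 1, (if g' = g then I.T (g / I.E) else μ (13, g')) = I.T (g' / I.E) := by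
      intro g' hg'
      split_ifs with e
      · rw [e]
      · exact h7 g' (by omega)
    have hv' : ∀ g' < g + 1, (if g' = g then I.v g else μ (14, g')) = I.v g' := by
      intro g' hg'
      split_ifs with e
      · rw [e]
      · exact h8 g' (by omega)
    refine wp_ite ?_ ?_
    · intro hmod
      have hdvd : ¬ I.E ∣ g + 1 := by
        intro hd
        refine hmod ?_
        simpa [hx, h1.E] using Nat.mod_eq_zero_of_dvd hd
      refine wp_skip ⟨by simp [hx], ((h1.update (by omega)).update (by omega)).update (by omega),
        ((h2.update (by omega)).update (by omega)).update (by omega), by simp [h3],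
        by simpa using h5, ?_, by simpa using hT', by simpa using hv', rfl, rfl⟩
      rw [Nat.succ_div, if_neg hdvd]
      simp [h6]
    · intro hmod
      have hdvd : I.E ∣ g + 1 := by
        refine Nat.dvd_of_mod_eq_zero ?_
        simpa [hx, h1.E] using hmod
      refine wp_assign (I.mem_region (by simp [len])) ?_ ?_
      · simp [h6, N]
        omega
      refine ⟨by simp [hx], (((h1.update (by omega)).update (by omega)).update (by omega)).update
        (by omega), (((h2.update (by omega)).update (by omega)).update (by omega)).update
        (by omega), by simp [h3], by simpa using h5, ?_, by simpa using hT', by simpa using hv',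
        rfl, rfl⟩
      rw [Nat.succ_div, if_pos hdvd, pow_succ]
      simp [h6]
  · rintro ⟨μ, inp', ω⟩ - hx ⟨h1, h2, h3, h5, h6, h7, h8, h9, h10⟩
    dsimp only at *
    subst h9 h10
    exact hQ μ ⟨h1, h3, h5, h7, h8⟩ h2

end Params

end MUC

namespace MUC

/-! ### The pass over the stream -/

/-- Computes the hash value of the token read. -/
def evalHash : Prog :=
  .seq (setTmp 7 (.lit 0)) <|
  .loop 8 (par 1) <| setTmp 7 ((tmp 7 * tmp 6 + .get 12 (tmp 8)) % par 3)

/-- Lets an instance process a token: if it is sampled, it is compared with the log of the instance,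
and appended to the set being read if there is room. -/
def tokenStep : Prog :=
  .ite (.bin .lt (tmp 7) (.get 13 (tmp 9)))
    (.seq (setTmp 10 (.lit 0)) <|
    .seq (.loop 11 (.get 5 (tmp 9)) <|
      setTmp 10 (tmp 10 + .bin .eq (.get 10 (tmp 9 * par 5 + tmp 11)) (tmp 6))) <|
    .seq (.assign 7 (tmp 9) (.get 7 (tmp 9) + .bin .eq (tmp 10) (.lit 0))) <|
    .seq (.ite (.bin .lt (.get 6 (tmp 9) - .get 5 (tmp 9)) (par 4))
      (.assign 10 (tmp 9 * par 5 + .get 6 (tmp 9)) (tmp 6)) .skip) <|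
    .assign 6 (tmp 9) (.get 6 (tmp 9) + .lit 1))
    .skip

/-- Lets an instance decide on the set that has been read. -/
def setStep : Prog :=
  .seq (.ite (.bin .lt (.get 8 (tmp 9)) (inp 2) *
        .bin .lt (.get 6 (tmp 9) - .get 5 (tmp 9)) (par 4 + .lit 1) *
        .bin .lt (.get 13 (tmp 9) * .get 14 (tmp 9))
          (inp 2 * (.lit 2 * inp 3 * par 3) * .get 7 (tmp 9) + .lit 1))
    (.seq (.assign 10 (tmp 9 * par 5 + .get 6 (tmp 9)) (.lit 0)) <|
    .seq (.assign 5 (tmp 9) (.get 6 (tmp 9) + .lit 1)) <|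
    .seq (.assign 11 (tmp 9 * inp 2 + .get 8 (tmp 9)) (tmp 5)) <|
    .seq (.assign 8 (tmp 9) (.get 8 (tmp 9) + .lit 1)) <|
    .assign 9 (tmp 9) (.get 9 (tmp 9) + .get 7 (tmp 9)))
    .skip) <|
  .seq (.assign 6 (tmp 9) (.get 5 (tmp 9))) (.assign 7 (tmp 9) (.lit 0))

/-- Processes the stream set by set. -/
def mainLoop : Prog :=
  .loop 5 (inp 1) <|
    .seq (.read 4 (.lit 6)) <|
    .seq (.while (tmp 6) <|
      .seq evalHash <| .seq (.loop 9 (par 6) tokenStep) (.read 4 (.lit 6))) <|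
    .loop 9 (par 6) setStep

/-- The program for the pass. -/
def passProg (c : ℕ) : Prog :=
  .seq initScale <| .seq (initParams c) <| .seq initPrime <| .seq initCoeffs <|
  .seq initTables mainLoop

namespace Params

variable {I : Params} {V : Family I.n I.m} {α : Fin I.t → ZMod I.P} {s : State} {Q : State → Prop}

/-- Horner's rule modulo `P`. -/
def horner (P x : ℕ) (a : ℕ → ℕ) : ℕ → ℕ
  | 0 => 0
  | q + 1 => (horner P x a q * x + a q) % P

theorem horner_cast (P x : ℕ) (a : ℕ → ℕ) (q : ℕ) :
    (horner P x a q : ZMod P) =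
      ∑ i ∈ Finset.range q, (a i : ZMod P) * (x : ZMod P) ^ (q - 1 - i) := by
  induction q with
  | zero => simp [horner]
  | succ q ih =>
    rw [horner, ZMod.natCast_mod, Finset.sum_range_succ]
    push_cast
    rw [ih, Finset.sum_mul]
    congr 1
    · refine Finset.sum_congr rfl fun i hi => ?_
      have := Finset.mem_range.1 hi
      rw [mul_assoc, ← pow_succ, show q - 1 - i + 1 = q - i by omega]
    · simp

theorem horner_eq_hash (x : ℕ) (a : ℕ → ℕ) (ha : ∀ q : Fin I.t, a q.val = (α q).val) :
    horner I.P x a I.t = (hash α (x : ZMod I.P)).val := by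
  have hlt : horner I.P x a I.t < I.P := by
    obtain ⟨q, hq⟩ := Nat.exists_eq_succ_of_ne_zero I.t_pos.ne'
    rw [hq]
    exact Nat.mod_lt _ I.P_prime.pos
  rw [← ZMod.val_cast_of_lt hlt, horner_cast,
    ← Fin.sum_univ_eq_sum_range (fun i => (a i : ZMod I.P) * (x : ZMod I.P) ^ (I.t - 1 - i)), hash]
  congr 1
  refine Finset.sum_congr rfl fun q _ => ?_
  rw [ha, ZMod.natCast_zmod_val]

theorem wp_evalHash {x : ℕ} (hR : I.Ready α s.mem) (hx : s.mem (4, 6) = x)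
    (hQ : ∀ μ : Mem, (∀ a i, ¬ (a = 4 ∧ (i = 7 ∨ i = 8)) → μ (a, i) = s.mem (a, i)) →
      μ (4, 7) = (hash α (x : ZMod I.P)).val → I.Ready α μ → Q ⟨μ, s.input, s.coins⟩) :
    Wp I.region evalHash Q s := by
  have hPN : I.P ≤ I.P * I.P := Nat.le_mul_self _
  have hPpos := I.P_prime.pos
  refine wp_seq (wp_assign (I.mem_region (by simp [len])) (by simp) ?_)
  simp only [eval_lit]
  refine wp_loop (fun q s' => (∀ a i, ¬ (a = 4 ∧ (i = 7 ∨ i = 8)) → s'.mem (a, i) = s.mem (a, i)) ∧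
    s'.mem (4, 7) = horner I.P x (fun q => s.mem (12, q)) q ∧ I.Ready α s'.mem ∧
    s'.input = s.input ∧ s'.coins = s.coins) I.t (by simp [N]; omega)
    (I.mem_region (by simp [len])) ?_ ?_ ?_ ?_
  · refine ⟨?_, by simp [horner], (hR.update (by omega)).update (by omega), rfl, rfl⟩
    intro a i h
    rw [update_cell, update_cell, if_neg (by omega), if_neg (by omega)]
  · rintro q s' ⟨-, -, h3, -⟩
    exact h3.t
  · rintro q ⟨μ, inp', ω⟩ - hq hx' ⟨h1, h2, h3, h4, h5⟩
    dsimp only at *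
    subst h4 h5
    have h6 : μ (4, 6) = x := by rw [h1 _ _ (by omega), hx]
    have hval : ((tmp 7 * tmp 6 + .get 12 (tmp 8)) % par 3 : Expr).eval μ =
        horner I.P x (fun q => s.mem (12, q)) (q + 1) := by
      simp [horner, h2, h6, hx', h1 12 q (by omega), h3.P]
    refine wp_assign (I.mem_region (by simp [len])) ?_ ?_
    · rw [hval, horner]
      have := Nat.mod_lt (horner I.P x (fun q => s.mem (12, q)) q * x + s.mem (12, q)) hPpos
      simp [N]; omega
    · rw [hval]
      refine ⟨by simp [hx'], ?_, by simp, (h3.update (by simp)).update (by omega), rfl, rfl⟩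
      intro a i h
      simp only [eval_lit]
      rw [update_cell, update_cell, if_neg (by omega), if_neg (by omega)]
      exact h1 a i h
  · rintro ⟨μ, inp', ω⟩ - - ⟨h1, h2, h3, h4, h5⟩
    dsimp only at *
    subst h4 h5
    exact hQ μ h1 (by rw [h2]; exact horner_eq_hash x _ hR.coeff) h3

/-- The memory represents the state `a` of the instance `g`, which has read the sampled elements
`buf` of a further set, in terms of the sampled sets `S`. Of `buf`, only the first `cap` elements
are stored, but all are counted, so that a set that is too large is recognized. -/
structure Rep (I : Params) (μ : Mem) (g : ℕ) (S : ℕ → List ℕ) (a : List ℕ × ℕ) (buf : List ℕ) :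
    Prop where
  pos : μ (5, g) = (logOf S a.1).length
  cur : μ (6, g) = (logOf S a.1).length + buf.length
  marg : μ (7, g) = newCount (logOf S a.1) buf
  num : μ (8, g) = a.1.length
  cov : μ (9, g) = a.2
  store : ∀ q < (logOf S a.1).length + buf.length, q < (logOf S a.1).length + I.cap →
    μ (10, g * I.C + q) = (logOf S a.1 ++ buf).getD q 0
  ids : ∀ q < a.1.length, μ (11, g * I.k + q) = a.1.getD q 0
  log_le : (logOf S a.1).length ≤ I.k * (I.cap + 1)
  num_le : a.1.length ≤ I.k

variable {μ : Mem} {g : ℕ} {S : ℕ → List ℕ} {a : List ℕ × ℕ} {buf : List ℕ}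

theorem C_eq : I.C = I.k * (I.cap + 1) + I.cap + 1 := by unfold C; ring

/-- Cells of other instances, and cells that do not belong to instances, do not matter. -/
theorem Rep.update (h : Rep I μ g S a buf) {b i v : ℕ}
    (hb : b < 5 ∨ 11 < b ∨ (b ≤ 9 ∧ i ≠ g) ∨ (b = 10 ∧ ∀ q < I.C, i ≠ g * I.C + q) ∨
      (b = 11 ∧ ∀ q < I.k, i ≠ g * I.k + q)) :
    Rep I (Finsupp.update μ (b, i) v) g S a buf := by
  have hC := I.C_eq
  have h1 := h.log_le
  have h2 := h.num_le
  refine ⟨?_, ?_, ?_, ?_, ?_, ?_, ?_, h1, h2⟩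
  · rw [update_cell, if_neg (by omega)]; exact h.pos
  · rw [update_cell, if_neg (by omega)]; exact h.cur
  · rw [update_cell, if_neg (by omega)]; exact h.marg
  · rw [update_cell, if_neg (by omega)]; exact h.num
  · rw [update_cell, if_neg (by omega)]; exact h.cov
  · intro q hq hq'
    rw [update_cell, if_neg]
    · exact h.store q hq hq'
    · rintro ⟨rfl, hi⟩
      rcases hb with hb | hb | hb | ⟨-, hb⟩ | ⟨hb, -⟩ <;> [omega; omega; omega; skip; omega]
      exact hb q (by omega) hi.symm
  · intro q hq
    rw [update_cell, if_neg]
    · exact h.ids q hq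
    · rintro ⟨rfl, hi⟩
      rcases hb with hb | hb | hb | ⟨hb, -⟩ | ⟨-, hb⟩ <;> [omega; omega; omega; omega; skip]
      exact hb q (by omega) hi.symm

theorem Rep.congr (h : Rep I μ g S a buf) {μ' : Mem}
    (hμ : ∀ b i, 5 ≤ b → b ≤ 11 → μ' (b, i) = μ (b, i)) : Rep I μ' g S a buf := by
  refine ⟨?_, ?_, ?_, ?_, ?_, ?_, ?_, h.log_le, h.num_le⟩
  · rw [hμ _ _ (by omega) (by omega)]; exact h.pos
  · rw [hμ _ _ (by omega) (by omega)]; exact h.cur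
  · rw [hμ _ _ (by omega) (by omega)]; exact h.marg
  · rw [hμ _ _ (by omega) (by omega)]; exact h.num
  · rw [hμ _ _ (by omega) (by omega)]; exact h.cov
  · intro q hq hq'
    rw [hμ _ _ (by omega) (by omega)]; exact h.store q hq hq'
  · intro q hq
    rw [hμ _ _ (by omega) (by omega)]; exact h.ids q hq

theorem block_ne {g g' C q q' : ℕ} (h : g ≠ g') (hq : q < C) (hq' : q' < C) :
    g' * C + q' ≠ g * C + q := by
  intro e
  have h1 : (g' * C + q') / C = g' := by
    rw [add_comm, Nat.add_mul_div_right _ _ (by omega), Nat.div_eq_of_lt hq', zero_add]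
  have h2 : (g * C + q) / C = g := by
    rw [add_comm, Nat.add_mul_div_right _ _ (by omega), Nat.div_eq_of_lt hq, zero_add]
  rw [e] at h1
  omega

theorem block_lt {g G C q : ℕ} (hg : g < G) (hq : q < C) : g * C + q < G * C := by
  calc g * C + q < g * C + C := by omega
    _ = (g + 1) * C := by ring
    _ ≤ G * C := Nat.mul_le_mul_right _ hg

variable (I) in
/-- Passing from `μ` to `μ'` leaves all instances but `g`, and the temporary values in use, as they
are. -/
def Keeps (g : ℕ) (μ μ' : Mem) : Prop :=
  (∀ g' S a buf, g' ≠ g → Rep I μ g' S a buf → Rep I μ' g' S a buf) ∧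
  μ' (4, 5) = μ (4, 5) ∧ μ' (4, 6) = μ (4, 6) ∧ μ' (4, 7) = μ (4, 7) ∧ μ' (4, 9) = μ (4, 9)

theorem Keeps.refl (g : ℕ) (μ : Mem) : Keeps I g μ μ :=
  ⟨fun _ _ _ _ _ h => h, rfl, rfl, rfl, rfl⟩

theorem Keeps.update {μ' : Mem} (h : Keeps I g μ μ') {b i v : ℕ}
    (hb : (b = 4 ∧ 10 ≤ i) ∨ (5 ≤ b ∧ b ≤ 9 ∧ i = g) ∨ (b = 10 ∧ ∃ q < I.C, i = g * I.C + q) ∨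
      (b = 11 ∧ ∃ q < I.k, i = g * I.k + q)) :
    Keeps I g μ (Finsupp.update μ' (b, i) v) := by
  obtain ⟨h1, h2, h3, h4, h5⟩ := h
  refine ⟨fun g' S a buf hg hRep => (h1 g' S a buf hg hRep).update ?_, ?_, ?_, ?_, ?_⟩
  · rcases hb with hb | hb | ⟨hb, q, hq, rfl⟩ | ⟨hb, q, hq, rfl⟩
    · omega
    · omega
    · exact Or.inr (Or.inr (Or.inr (Or.inl ⟨hb, fun q' hq' => block_ne hg hq' hq⟩)))
    · exact Or.inr (Or.inr (Or.inr (Or.inr ⟨hb, fun q' hq' => block_ne hg hq' hq⟩)))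
  all_goals
    rw [update_cell, if_neg (by omega)]
    assumption

theorem getD_append_singleton (l : List ℕ) (x : ℕ) : (l ++ [x]).getD l.length 0 = x := by
  simp

theorem getD_append_of_lt {l l' : List ℕ} {q : ℕ} (hq : q < l.length) :
    (l ++ l').getD q 0 = l.getD q 0 := List.getD_append _ _ _ _ hq

/-- Reading a token `x`, an instance appends it to the set being read if `x` is sampled. -/
theorem wp_tokenStep {x : ℕ} (hR : I.Ready α s.mem) (hx : s.mem (4, 6) = x) (hxn : x ≤ I.n)
    (hh : s.mem (4, 7) = (hash α (x : ZMod I.P)).val) (hg : s.mem (4, 9) = g) (hgG : g < I.G)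
    (hRep : Rep I s.mem g S a buf) (hbuf : buf.length ≤ I.n)
    (hQ : ∀ μ : Mem, I.Ready α μ → Keeps I g s.mem μ →
      Rep I μ g S a (if I.Smp α (g / I.E) x then buf ++ [x] else buf) →
      Q ⟨μ, s.input, s.coins⟩) :
    Wp I.region tokenStep Q s := by
  have hC := I.C_eq
  have hlog := hRep.log_le
  have hCG : I.C ≤ I.G * I.C := Nat.le_mul_of_pos_left _ I.G_pos
  have hnew : newCount (logOf S a.1) buf ≤ buf.length := List.countP_le_length
  set log := logOf S a.1 with hlogdef
  have hcond : (Expr.bin .lt (tmp 7) (.get 13 (tmp 9))).eval s.mem ≠ 0 ↔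
      I.Smp α (g / I.E) x := by
    simp [hh, hg, hR.T g hgG, Smp]
  refine wp_ite ?_ ?_
  · intro hne
    rw [if_pos (hcond.1 hne)] at hQ
    refine wp_seq (wp_assign (I.mem_region (by simp [len])) (by simp) ?_)
    simp only [eval_lit]
    refine wp_seq (wp_loop (fun q s' => I.Ready α s'.mem ∧ Keeps I g s.mem s'.mem ∧
      Rep I s'.mem g S a buf ∧ s'.mem (4, 10) = (log.take q).count x ∧
      s'.input = s.input ∧ s'.coins = s.coins) log.length (by simp [N]; omega)
      (I.mem_region (by simp [len])) ?_ ?_ ?_ ?_)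
    · exact ⟨(hR.update (by omega)).update (by omega),
        ((Keeps.refl _ _).update (by omega)).update (by omega),
        (hRep.update (by omega)).update (by omega), by simp, rfl, rfl⟩
    · rintro q s' ⟨-, h2, h3, -⟩
      simp [h2.2.2.2.2, hg, h3.pos, hlogdef]
    · rintro q ⟨μ, inp', ω⟩ - hq hx' ⟨h1, h2, h3, h4, h5, h6⟩
      dsimp only at *
      subst h5 h6
      have hcell : μ (10, g * I.C + q) = log[q] := by
        have hst : ∀ q < log.length + buf.length, q < log.length + I.cap →
          μ (10, g * I.C + q) = (log ++ buf).getD q 0 := h3.store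
        rw [hst q (by omega) (by omega), getD_append_of_lt hq, List.getD_eq_getElem _ _ hq]
      have hval : (tmp 10 + .bin .eq (.get 10 (tmp 9 * par 5 + tmp 11)) (tmp 6) : Expr).eval μ =
          (log.take (q + 1)).count x := by
        rw [List.take_succ_eq_append_getElem hq, List.count_append, List.count_singleton]
        simp [h4, h2.2.2.2.2, hg, h1.C, hx', hcell, h2.2.2.1, hx]
      have hcount : (log.take (q + 1)).count x ≤ log.length :=
        List.count_le_length.trans (by simp)
      refine wp_assign (I.mem_region (by simp [len])) ?_ ?_
      · rw [hval]
        simp [N]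
        omega
      · rw [hval]
        exact ⟨by simp [hx'], (h1.update (by simp)).update (by omega),
          (h2.update (by simp)).update (by omega), (h3.update (by simp)).update (by omega),
          by simp, rfl, rfl⟩
    · rintro ⟨μ, inp', ω⟩ - - ⟨h1, h2, h3, h4, h5, h6⟩
      dsimp only at *
      subst h5 h6
      rw [List.take_length] at h4
      have hst : ∀ q < log.length + buf.length, q < log.length + I.cap →
        μ (10, g * I.C + q) = (log ++ buf).getD q 0 := h3.store
      have hg' : μ (4, 9) = g := h2.2.2.2.2.trans hg
      have hx' : μ (4, 6) = x := h2.2.2.1.trans hx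
      have hmarg : (Expr.get 7 (tmp 9) + .bin .eq (tmp 10) (.lit 0) : Expr).eval μ =
          newCount log (buf ++ [x]) := by
        rw [newCount_append]
        simp [hg', h3.marg, h4, ← hlogdef, List.count_eq_zero]
      refine wp_seq (wp_assign (I.mem_region (by simpa [len, hg'] using hgG)) ?_ ?_)
      · rw [hmarg, newCount_append]
        have : (if x ∈ log then 0 else 1) ≤ 1 := by split_ifs <;> omega
        simp only [region_N]
        unfold N
        omega
      rw [hmarg]
      simp only [eval_get, eval_lit, hg']
      -- The state before the last assignment, whether or not the token has been stored.
      have hlast : ∀ μ' : Mem, I.Ready α μ' → Keeps I g s.mem μ' →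
          (∀ b, b = 5 ∨ b = 6 ∨ b = 8 ∨ b = 9 → μ' (b, g) = μ (b, g)) →
          μ' (7, g) = newCount log (buf ++ [x]) →
          (∀ q < log.length + (buf.length + 1), q < log.length + I.cap →
            μ' (10, g * I.C + q) = (log ++ (buf ++ [x])).getD q 0) →
          (∀ q < a.1.length, μ' (11, g * I.k + q) = a.1.getD q 0) →
          Wp I.region (.assign 6 (tmp 9) (.get 6 (tmp 9) + .lit 1)) Q ⟨μ', s.input, s.coins⟩ := by
        intro μ' k1 k2 k3 k4 k5 k6
        have hg'' : μ' (4, 9) = g := k2.2.2.2.2.trans hg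
        have hcur : μ' (6, g) = log.length + buf.length := by rw [k3 6 (by omega), h3.cur]
        refine wp_assign (I.mem_region (by simpa [len, hg''] using hgG)) ?_ ?_
        · simp [hg'', hcur, N]
          omega
        · simp only [eval_get, eval_lit, eval_add, hg'', hcur]
          refine hQ _ (k1.update (by omega)) (k2.update (by omega)) ⟨?_, ?_, ?_, ?_, ?_, ?_, ?_,
            hlog, h3.num_le⟩
          · rw [update_cell, if_neg (by omega), k3 5 (by omega), h3.pos]
          · rw [update_cell, if_pos ⟨rfl, rfl⟩]
            simp [hlogdef, add_assoc]
          · rw [update_cell, if_neg (by omega), k4]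
          · rw [update_cell, if_neg (by omega), k3 8 (by omega), h3.num]
          · rw [update_cell, if_neg (by omega), k3 9 (by omega), h3.cov]
          · intro q hq hq'
            rw [update_cell, if_neg (by omega)]
            exact k5 q (by simpa using hq) hq'
          · intro q hq
            rw [update_cell, if_neg (by omega)]
            exact k6 q hq
      have hR1 : I.Ready α (Finsupp.update μ (7, g) (newCount log (buf ++ [x]))) :=
        h1.update (by omega)
      have hK1 : Keeps I g s.mem (Finsupp.update μ (7, g) (newCount log (buf ++ [x]))) :=
        h2.update (by omega)
      have hdiff : (Expr.bin .lt (.get 6 (tmp 9) - .get 5 (tmp 9)) (par 4)).eval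
          (Finsupp.update μ (7, g) (newCount log (buf ++ [x]))) =
          if buf.length < I.cap then 1 else 0 := by
        simp [hg', h3.cur, h3.pos, h1.cap]
      refine wp_seq (wp_ite ?_ ?_)
      · intro hlt
        rw [hdiff] at hlt
        have hlt' : buf.length < I.cap := by
          by_contra hge
          rw [if_neg hge] at hlt
          omega
        have hidx : (tmp 9 * par 5 + .get 6 (tmp 9) : Expr).eval
            (Finsupp.update μ (7, g) (newCount log (buf ++ [x]))) =
            g * I.C + (log.length + buf.length) := by
          simp [hg', h3.cur, h1.C, hlogdef]
        refine wp_assign (I.mem_region ?_) ?_ ?_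
        · rw [hidx]
          exact block_lt hgG (by omega)
        · simp [hx', N]
          omega
        · rw [hidx]
          have hxe : (tmp 6).eval (Finsupp.update μ (7, g) (newCount log (buf ++ [x]))) = x := by
            simp [hx']
          rw [hxe]
          refine hlast _ (hR1.update (by omega))
            (hK1.update (Or.inr (Or.inr (Or.inl ⟨rfl, _, by omega, rfl⟩)))) ?_ ?_ ?_ ?_
          · intro b hb
            rw [update_cell, update_cell, if_neg (by omega), if_neg (by omega)]
          · simp
          · intro q hq hq'
            rw [update_cell]
            split_ifs with e
            · have : q = (log ++ buf).length := by simp; omega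
              rw [← List.append_assoc, this, getD_append_singleton]
            · have hq2 : q < log.length + buf.length := by
                by_contra hge
                exact e ⟨rfl, by rw [show q = log.length + buf.length by omega]⟩
              rw [update_cell, if_neg (by omega), hst q hq2 hq', ← List.append_assoc,
                getD_append_of_lt (l := log ++ buf) (l' := [x]) (by simpa using hq2)]
          · intro q hq
            rw [update_cell, update_cell, if_neg (by omega), if_neg (by omega)]
            exact h3.ids q hq
      · intro hge
        rw [hdiff] at hge
        have hge' : ¬ buf.length < I.cap := by
          intro hlt
          rw [if_pos hlt] at hge
          omega
        refine wp_skip (hlast _ hR1 hK1 ?_ ?_ ?_ ?_)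
        · intro b hb
          rw [update_cell, if_neg (by omega)]
        · simp
        · intro q hq hq'
          rw [update_cell, if_neg (by omega), hst q (by omega) hq', ← List.append_assoc,
            getD_append_of_lt (l := log ++ buf) (l' := [x]) (by simp; omega)]
        · intro q hq
          rw [update_cell, if_neg (by omega)]
          exact h3.ids q hq
  · intro h0
    have hns : ¬ I.Smp α (g / I.E) x := fun h => hcond.2 h h0
    rw [if_neg hns] at hQ
    exact wp_skip (hQ s.mem hR (Keeps.refl _ _) hRep)

end Params

end MUC

namespace MUC

/-! ### Decisions of the instances at the end of a set -/

/-- The rule for assignments, with the address and the value computed. -/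
theorem wp_set {L : Region} {Q : State → Prop} {μ : Mem} {l : List ℕ} {ω : ℕ → Bool} {a j v : ℕ}
    {i e : Expr} (hi : i.eval μ = j) (he : e.eval μ = v) (hF : (a, j) ∈ L.F) (hv : v ≤ L.N)
    (h : Q ⟨Finsupp.update μ (a, j) v, l, ω⟩) : Wp L (.assign a i e) Q ⟨μ, l, ω⟩ := by
  subst hi he
  exact wp_assign hF hv h

namespace Params

variable {I : Params} {V : Family I.n I.m} {α : Fin I.t → ZMod I.P} {s : State} {Q : State → Prop}
  {g i : ℕ}

theorem run_snd_le (g i : ℕ) : (I.run V α g i).2 ≤ I.n := by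
  have h : (I.run V α g i).2 = (unionOf (I.smp V α g) (I.run V α g i).1.toFinset).card :=
    sieve_card (I.zero_notMem_smp g) (I.smp_nodup g) i
  rw [h]
  have hsub : unionOf (I.smp V α g) (I.run V α g i).1.toFinset ⊆ Finset.Icc 1 I.n := by
    intro x hx
    obtain ⟨i, -, hxi⟩ := Finset.mem_biUnion.1 hx
    exact Finset.mem_Icc.2 (mem_tok V (List.mem_filter.1 (List.mem_toFinset.1 hxi)).1)
  simpa using Finset.card_le_card hsub

theorem run_length_le (g i : ℕ) : (I.run V α g i).1.length ≤ I.k := (sieve_basic i).1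

theorem length_smp_le (g i : ℕ) : (I.smp V α g i).length ≤ I.n :=
  (List.length_filter_le _ _).trans (length_tok_le V i)

/-- At the end of a set, an instance performs one step of the threshold rule. -/
theorem wp_setStep (hR : I.Ready α s.mem) (hi : s.mem (4, 5) = i) (him : i < I.m)
    (hg : s.mem (4, 9) = g) (hgG : g < I.G)
    (hRep : Rep I s.mem g (I.smp V α g) (I.run V α g i) (I.smp V α g i))
    (hQ : ∀ μ : Mem, I.Ready α μ → Keeps I g s.mem μ →
      Rep I μ g (I.smp V α g) (I.run V α g (i + 1)) [] → Q ⟨μ, s.input, s.coins⟩) :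
    Wp I.region setStep Q s := by
  obtain ⟨μ, l, ω⟩ := s
  dsimp only at *
  have hC := I.C_eq
  have hlog := hRep.log_le
  have hCG : I.C ≤ I.G * I.C := Nat.le_mul_of_pos_left _ I.G_pos
  have hkG : I.k ≤ I.G * I.k := Nat.le_mul_of_pos_left _ I.G_pos
  have hn1 := I.run_snd_le (V := V) (α := α) g (i + 1)
  have hk1 := I.run_length_le (V := V) (α := α) g (i + 1)
  have hlog1 := I.logOf_length_le (V := V) (α := α) g (i + 1)
  have hblen := I.length_smp_le (V := V) (α := α) g i
  set S := I.smp V α g with hS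
  set a := I.run V α g i with ha
  have hst : ∀ q < (logOf S a.1).length + (S i).length, q < (logOf S a.1).length + I.cap →
    μ (10, g * I.C + q) = (logOf S a.1 ++ S i).getD q 0 := hRep.store
  have hids := hRep.ids
  have hpos := hRep.pos
  have hcur := hRep.cur
  have hmarg := hRep.marg
  have hnum := hRep.num
  have hcov := hRep.cov
  -- After the decision, the set being read is forgotten.
  have hlast : ∀ μ' : Mem, I.Ready α μ' → Keeps I g μ μ' →
      μ' (5, g) = (logOf S (I.run V α g (i + 1)).1).length →
      μ' (8, g) = (I.run V α g (i + 1)).1.length → μ' (9, g) = (I.run V α g (i + 1)).2 →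
      (∀ q < (logOf S (I.run V α g (i + 1)).1).length,
        μ' (10, g * I.C + q) = (logOf S (I.run V α g (i + 1)).1).getD q 0) →
      (∀ q < (I.run V α g (i + 1)).1.length,
        μ' (11, g * I.k + q) = (I.run V α g (i + 1)).1.getD q 0) →
      Wp I.region (.seq (.assign 6 (tmp 9) (.get 5 (tmp 9))) (.assign 7 (tmp 9) (.lit 0))) Q
        ⟨μ', l, ω⟩ := by
    intro μ' k1 k2 k3 k4 k5 k6 k7
    have hg' : μ' (4, 9) = g := k2.2.2.2.2.trans hg
    refine wp_seq (wp_set (j := g) (v := (logOf S (I.run V α g (i + 1)).1).length)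
      (by simp [hg']) (by simp [hg', k3]) (I.mem_region (by simpa [len] using hgG))
      (by simp [N]; omega) ?_)
    refine wp_set (j := g) (v := 0) (by simp [hg']) (by simp)
      (I.mem_region (by simpa [len] using hgG)) (by simp) ?_
    refine hQ _ ((k1.update (by omega)).update (by omega)) ((k2.update (by omega)).update
      (by omega)) ⟨?_, ?_, ?_, ?_, ?_, ?_, ?_, hlog1, hk1⟩
    · simp [k3]
    · simp
    · simp [newCount]
    · simp [k4]
    · simp [k5]
    · intro q hq _
      rw [List.append_nil, update_cell, update_cell, if_neg (by omega), if_neg (by omega)]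
      exact k6 q (by simpa using hq)
    · intro q hq
      rw [update_cell, update_cell, if_neg (by omega), if_neg (by omega)]
      exact k7 q hq
  have hcond : (Expr.bin .lt (.get 8 (tmp 9)) (inp 2) *
      .bin .lt (.get 6 (tmp 9) - .get 5 (tmp 9)) (par 4 + .lit 1) *
      .bin .lt (.get 13 (tmp 9) * .get 14 (tmp 9))
        (inp 2 * (.lit 2 * inp 3 * par 3) * .get 7 (tmp 9) + .lit 1) : Expr).eval μ ≠ 0 ↔
      (a.1.length < I.k ∧ (S i).length ≤ I.cap ∧
        I.T (g / I.E) * I.v g ≤ I.k * (2 * I.E * I.P) * newCount (logOf S a.1) (S i)) := by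
    have aux : ∀ x y : ℕ, (if x < y then 1 else 0) ≠ 0 ↔ x < y := by simp
    simp only [eval_mul, eval_lt, eval_add, eval_sub, eval_get, eval_lit, hg, hnum, hcur, hpos,
      hmarg, hR.k, hR.cap, hR.T g hgG, hR.v g hgG, hR.E, hR.P]
    rw [mul_ne_zero_iff, mul_ne_zero_iff, aux, aux, aux, and_assoc, Nat.lt_succ_iff,
      Nat.lt_succ_iff, Nat.add_sub_cancel_left]
  refine wp_seq (wp_ite ?_ ?_)
  · intro hne
    have hpass := hcond.1 hne
    have hrun : I.run V α g (i + 1) =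
        (a.1 ++ [i], a.2 + newCount (logOf S a.1) (S i)) := sieve_succ_of_pos hpass
    rw [hrun] at hn1 hk1 hlog1 hlast
    dsimp only at hn1 hk1 hlog1 hlast
    rw [logOf_append] at hlog1 hlast
    simp only [List.length_append, List.length_singleton] at hlog1 hlast hk1
    have hlt : (logOf S a.1).length + (S i).length < I.C := by omega
    refine wp_seq (wp_set (j := g * I.C + ((logOf S a.1).length + (S i).length)) (v := 0)
      (by simp [hg, hcur, hR.C]) (by simp) (I.mem_region (block_lt hgG hlt)) (by simp) ?_)
    refine wp_seq (wp_set (j := g) (v := (logOf S a.1).length + (S i).length + 1)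
      (by simp [hg]) (by simp [hg, hcur]) (I.mem_region (by simpa [len] using hgG))
      (by simp [N]; omega) ?_)
    refine wp_seq (wp_set (j := g * I.k + a.1.length) (v := i)
      (by simp [hg, hnum, hR.k]) (by simp [hi]) (I.mem_region (block_lt hgG hpass.1))
      (by simp [N]; omega) ?_)
    refine wp_seq (wp_set (j := g) (v := a.1.length + 1)
      (by simp [hg]) (by simp [hg, hnum]) (I.mem_region (by simpa [len] using hgG))
      (by simp [N]; omega) ?_)
    refine wp_set (j := g) (v := a.2 + newCount (logOf S a.1) (S i))
      (by simp [hg]) (by simp [hg, hcov, hmarg]) (I.mem_region (by simpa [len] using hgG))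
      (by simp [N]; omega) ?_
    refine hlast _ (((((hR.update (by omega)).update (by omega)).update (by omega)).update
      (by omega)).update (by omega)) ?_ ?_ ?_ ?_ ?_ ?_
    · refine (((((Keeps.refl g μ).update ?_).update (by omega)).update ?_).update
        (by omega)).update (by omega)
      · exact Or.inr (Or.inr (Or.inl ⟨rfl, _, hlt, rfl⟩))
      · exact Or.inr (Or.inr (Or.inr ⟨rfl, _, hpass.1, rfl⟩))
    · simp [add_assoc]
    · simp
    · simp
    · intro q hq
      rw [update_cell, if_neg (by omega), update_cell, if_neg (by omega), update_cell,
        if_neg (by omega), update_cell, if_neg (by omega), update_cell, ← List.append_assoc]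
      split_ifs with e
      · have : q = (logOf S a.1 ++ S i).length := by simp; omega
        rw [this, getD_append_singleton]
      · have hq2 : q < (logOf S a.1).length + (S i).length := by
          by_contra hge
          exact e ⟨rfl, by rw [show q = (logOf S a.1).length + (S i).length by omega]⟩
        rw [hst q hq2 (by omega),
          getD_append_of_lt (l := logOf S a.1 ++ S i) (l' := [0]) (by simpa using hq2)]
    · intro q hq
      rw [update_cell, if_neg (by omega), update_cell, if_neg (by omega), update_cell]
      split_ifs with e
      · have : q = a.1.length := by omega
        rw [this, getD_append_singleton]
      · have hq2 : q < a.1.length := by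
          by_contra hge
          exact e ⟨rfl, by rw [show q = a.1.length by omega]⟩
        rw [update_cell, if_neg (by omega), update_cell, if_neg (by omega), hids q hq2,
          getD_append_of_lt hq2]
  · intro h0
    have hfail := fun h => hcond.2 h h0
    have hrun : I.run V α g (i + 1) = a := sieve_succ_of_neg hfail
    rw [hrun] at hlast
    refine wp_skip (hlast μ hR (Keeps.refl _ _) hpos hnum hcov (fun q hq => ?_) hids)
    by_cases hcap : I.cap = 0
    · -- The capacity is positive.
      unfold cap at hcap
      omega
    · rw [hst q (by omega) (by omega), getD_append_of_lt hq]

/-! ### The loop over the stream -/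

theorem tokens_eq {n m : ℕ} (V : Family n m) :
    V.tokens = (List.range m).flatMap (fun i => tok V i ++ [0]) := by
  unfold Family.tokens
  rw [← List.map_coe_finRange_eq_range, List.flatMap_map, ← List.ofFn_id,
    show V.elems = V.elems ∘ id from rfl, ← List.map_ofFn, List.flatMap_map]
  refine List.flatMap_congr fun i _ => ?_
  simp [tok]

/-- After the stream, every instance represents the outcome of the threshold rule on all sets. -/
theorem wp_mainLoop (V : Family I.n I.m) (hR : I.Ready α s.mem) (hc : Clean s.mem)
    (hin : s.input = V.tokens)
    (hQ : ∀ (μ : Mem) (l : List ℕ), I.Ready α μ →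
      (∀ g < I.G, Rep I μ g (I.smp V α g) (I.run V α g I.m) []) → Q ⟨μ, l, s.coins⟩) :
    Wp I.region mainLoop Q s := by
  have hGC := I.G_le
  refine wp_loop (fun i s' => I.Ready α s'.mem ∧
    (∀ g < I.G, Rep I s'.mem g (I.smp V α g) (I.run V α g i) []) ∧
    s'.input = ((List.range I.m).drop i).flatMap (fun i => tok V i ++ [0]) ∧
    s'.coins = s.coins) I.m (by simp [N]; omega) (I.mem_region (by simp [len])) ?_ ?_ ?_ ?_
  · refine ⟨hR.update (by omega), fun g hg => Rep.update ?_ (by omega), ?_, rfl⟩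
    · refine ⟨?_, ?_, ?_, ?_, ?_, ?_, ?_, ?_, ?_⟩ <;>
        simp [run, sieve, logOf, newCount, hc _ _]
    · simp [hin, tokens_eq]
  · rintro i s' ⟨h1, -⟩
    exact h1.m
  · rintro i ⟨μ, l, ω⟩ - hi hx ⟨h1, h2, h3, h4⟩
    dsimp only at *
    subst h4
    rw [List.drop_eq_getElem_cons (by simpa using hi), List.getElem_range, List.flatMap_cons,
      List.append_assoc, List.singleton_append] at h3
    set rest := ((List.range I.m).drop (i + 1)).flatMap (fun i => tok V i ++ [0]) with hrest
    have htok : ∀ p, (tok V i ++ [0]).getD p 0 ≤ I.n := by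
      intro p
      by_cases hp : p < (tok V i).length
      · rw [getD_append_of_lt hp, List.getD_eq_getElem _ _ hp]
        exact (mem_tok V (List.getElem_mem hp)).2
      · rw [List.getD_append_right _ _ _ _ (by omega)]
        rcases Nat.eq_zero_or_pos (p - (tok V i).length) with e | e
        · simp [e]
        · rw [List.getD_eq_default _ _ (by simp only [List.length_singleton]; omega)]
          exact Nat.zero_le _
    have hhead : ∀ p, p ≤ (tok V i).length →
        ((tok V i ++ 0 :: rest).drop p).headD 0 = (tok V i ++ [0]).getD p 0 := by
      intro p hp
      rcases hp.lt_or_eq with hp | hp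
      · rw [List.drop_eq_getElem_cons (by simp; omega), List.headD_cons, getD_append_of_lt hp,
          List.getD_eq_getElem _ _ hp, List.getElem_append_left hp]
      · simp [hp]
    subst h3
    refine wp_seq (wp_read (I.mem_region (by simp [len])) ?_ ?_)
    · have := htok 0
      have h0 := hhead 0 (Nat.zero_le _)
      rw [List.drop_zero] at h0
      rw [h0]
      simp only [region_N]
      unfold N
      omega
    have hlen := length_tok_le V i
    refine wp_seq (wp_while (fun p s' => p ≤ (tok V i).length ∧ I.Ready α s'.mem ∧
      (∀ g < I.G, Rep I s'.mem g (I.smp V α g) (I.run V α g i)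
        (((tok V i).take p).filter (fun x => I.Smp α (g / I.E) x))) ∧
      s'.mem (4, 6) = (tok V i ++ [0]).getD p 0 ∧ s'.mem (4, 5) = i ∧
      s'.input = (tok V i ++ 0 :: rest).drop (p + 1) ∧ s'.coins = s.coins)
      (tok V i).length (by simp [N]; omega) ?_ ?_)
    · have h0 := hhead 0 (Nat.zero_le _)
      rw [List.drop_zero] at h0
      refine ⟨Nat.zero_le _, h1.update (by simp), fun g hg => (h2 g hg).update (by simp),
        ?_, ?_, ?_, rfl⟩
      · simp only [eval_lit, h0]
        rw [update_cell, if_pos ⟨rfl, rfl⟩]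
      · simp [hx]
      · simp
    · rintro p ⟨μ, l, ω⟩ - ⟨hp, k1, k2, k3, k4, k5, k6⟩
      dsimp only at *
      subst k5 k6
      simp only [eval_get, eval_lit, k3]
      constructor
      · intro h0
        have hpe : p = (tok V i).length := by
          by_contra hne
          have hp' : p < (tok V i).length := by omega
          rw [getD_append_of_lt hp', List.getD_eq_getElem _ _ hp'] at h0
          have := (mem_tok V (List.getElem_mem hp')).1
          omega
        subst hpe
        rw [List.take_length] at k2
        -- The set has been read: the instances decide on it.
        refine wp_loop (fun j s' => I.Ready α s'.mem ∧
          (∀ g < I.G, if g < j then Rep I s'.mem g (I.smp V α g) (I.run V α g (i + 1)) []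
            else Rep I s'.mem g (I.smp V α g) (I.run V α g i) (I.smp V α g i)) ∧
          s'.mem (4, 5) = i ∧ s'.input = rest ∧ s'.coins = s.coins) I.G (by simp [N]; omega)
          (I.mem_region (by simp [len])) ?_ ?_ ?_ ?_
        · refine ⟨k1.update (by omega), fun g hg => ?_, by simp [k4], by simp, rfl⟩
          rw [if_neg (by omega)]
          exact (k2 g hg).update (by omega)
        · rintro j s' ⟨h1, -⟩
          exact h1.G
        · rintro j ⟨μ, l, ω⟩ - hj hx ⟨m1, m2, m3, m4, m5⟩
          dsimp only at *
          subst m4 m5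
          have hRepj := m2 j hj
          rw [if_neg (lt_irrefl j)] at hRepj
          refine wp_setStep (V := V) m1 m3 hi hx hj hRepj fun μ' n1 n2 n3 => ?_
          refine ⟨n2.2.2.2.2.trans hx, n1.update (by omega), fun g hg => ?_, ?_, rfl, rfl⟩
          · have hm := m2 g hg
            rcases lt_trichotomy g j with hgj | hgj | hgj
            · rw [if_pos hgj] at hm
              rw [if_pos (by omega)]
              exact (n2.1 g _ _ _ (by omega) hm).update (by omega)
            · subst hgj
              rw [if_pos (by omega)]
              exact n3.update (by omega)
            · rw [if_neg (by omega)] at hm ⊢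
              exact (n2.1 g _ _ _ (by omega) hm).update (by omega)
          · simp [n2.2.1.trans m3]
        · rintro ⟨μ, l, ω⟩ - hx ⟨m1, m2, m3, m4, m5⟩
          dsimp only at *
          subst m4 m5
          refine ⟨m3, m1.update (by omega), fun g hg => ?_, rfl, rfl⟩
          have := m2 g hg
          rw [if_pos hg] at this
          exact this.update (by omega)
      · intro hne
        have hp' : p < (tok V i).length := by
          by_contra hge
          have hpe : p = (tok V i).length := by omega
          rw [hpe, getD_append_singleton] at hne
          exact hne rfl
        refine ⟨hp', ?_⟩
        have hxv : (tok V i ++ [0]).getD p 0 = (tok V i)[p] := by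
          rw [getD_append_of_lt hp', List.getD_eq_getElem _ _ hp']
        have hxn := (mem_tok V (List.getElem_mem hp')).2
        rw [hxv] at k3
        set x := (tok V i)[p] with hxdef
        have hbl : ∀ g, (((tok V i).take p).filter (fun x => I.Smp α (g / I.E) x)).length ≤ I.n :=
          fun g => (List.length_filter_le _ _).trans ((List.length_take_le' _ _).trans hlen)
        refine wp_seq (wp_evalHash k1 k3 fun μ₁ l1 l2 l3 => ?_)
        refine wp_seq (wp_loop (fun j s' => I.Ready α s'.mem ∧
          (∀ g < I.G, Rep I s'.mem g (I.smp V α g) (I.run V α g i) (if g < j then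
            ((tok V i).take (p + 1)).filter (fun x => I.Smp α (g / I.E) x) else
            ((tok V i).take p).filter (fun x => I.Smp α (g / I.E) x))) ∧
          s'.mem (4, 5) = i ∧ s'.mem (4, 6) = x ∧
          s'.mem (4, 7) = (hash α (x : ZMod I.P)).val ∧
          s'.input = (tok V i ++ 0 :: rest).drop (p + 1) ∧ s'.coins = s.coins) I.G
          (by simp [N]; omega) (I.mem_region (by simp [len])) ?_ ?_ ?_ ?_)
        · refine ⟨l3.update (by omega), fun g hg => ?_, ?_, ?_, by simp [l2], rfl, rfl⟩
          · rw [if_neg (by omega)]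
            exact ((k2 g hg).congr fun b i h5 _ => l1 b i (by omega)).update (by omega)
          · simp [l1 4 5 (by omega), k4]
          · simp [l1 4 6 (by omega), k3]
        · rintro j s' ⟨h1, -⟩
          exact h1.G
        · rintro j ⟨μ, l, ω⟩ - hj hx ⟨m1, m2, m3, m4, m5, m6, m7⟩
          dsimp only at *
          subst m6 m7
          have hRepj := m2 j hj
          rw [if_neg (lt_irrefl j)] at hRepj
          refine wp_tokenStep m1 m4 hxn m5 hx hj hRepj (hbl j) fun μ' n1 n2 n3 => ?_
          refine ⟨n2.2.2.2.2.trans hx, n1.update (by omega), fun g hg => ?_, ?_, ?_, ?_, rfl, rfl⟩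
          · have hm := m2 g hg
            rcases lt_trichotomy g j with hgj | hgj | hgj
            · rw [if_pos hgj] at hm
              rw [if_pos (by omega)]
              exact (n2.1 g _ _ _ (by omega) hm).update (by omega)
            · subst hgj
              rw [if_pos (by omega), List.take_succ_eq_append_getElem hp', List.filter_append]
              refine Rep.update ?_ (by omega)
              by_cases hs : I.Smp α (g / I.E) x
              · rw [if_pos hs] at n3
                simpa [hs, ← hxdef] using n3
              · rw [if_neg hs] at n3
                simpa [hs, ← hxdef] using n3
            · rw [if_neg (by omega)] at hm ⊢
              exact (n2.1 g _ _ _ (by omega) hm).update (by omega)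
          · simp [n2.2.1.trans m3]
          · simp [n2.2.2.1.trans m4]
          · simp [n2.2.2.2.1.trans m5]
        · rintro ⟨μ, l, ω⟩ - hx ⟨m1, m2, m3, m4, m5, m6, m7⟩
          dsimp only at *
          subst m6 m7
          refine wp_read (I.mem_region (by simp [len])) ?_ ?_
          · rw [hhead (p + 1) hp']
            have := htok (p + 1)
            simp only [region_N]
            unfold N
            omega
          · simp only [eval_lit, hhead (p + 1) hp']
            refine ⟨hp', m1.update (by omega), fun g hg => ?_, by simp,
              by simp [m3], by simp, trivial⟩
            have := m2 g hg
            rw [if_pos hg] at this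
            exact this.update (by omega)
  · rintro ⟨μ, l, ω⟩ - hx ⟨h1, h2, h3, h4⟩
    dsimp only at *
    subst h4
    exact hQ μ l h1 h2

end Params

end MUC

namespace MUC

theorem ofList_apply (a : ℕ) (l : List ℕ) (b i : ℕ) :
    Mem.ofList a l (b, i) = if b = a then l.getD i 0 else 0 := by
  unfold Mem.ofList
  rw [Finsupp.finsetSum_apply]
  simp only [Finsupp.single_apply, Prod.mk.injEq]
  by_cases hb : b = a
  · subst hb
    simp only [true_and, if_true]
    rw [Finset.sum_ite_eq' (Finset.range l.length) i]
    split_ifs with h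
    · rfl
    · exact (List.getD_eq_default _ _ (by simpa using h)).symm
  · rw [if_neg hb]
    exact Finset.sum_eq_zero fun j _ => if_neg fun h => hb h.1.symm

namespace Params

variable {I : Params} {V : Family I.n I.m} {α : Fin I.t → ZMod I.P} {Q : State → Prop}

theorem fits_start : I.region.Fits (Mem.ofList 0 [I.n, I.m, I.k, I.E]) := by
  have hE := I.E_le_mnE
  constructor
  · rintro ⟨a, i⟩ -
    rw [ofList_apply]
    split_ifs with h
    · rcases i with _ | _ | _ | _ | i <;> simp [N] <;> omega
    · exact Nat.zero_le _
  · rintro ⟨a, i⟩ h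
    rw [ofList_apply]
    split_ifs with ha
    · subst ha
      have : ¬ i < 4 := fun hi => h (I.mem_region (a := 0) hi)
      rw [List.getD_eq_default _ _ (by simpa using this)]
      rfl
    · rfl

/-- At the end of the pass the memory represents the states of all instances, for the hash function
given by the first coins. -/
theorem wp_passProg (V : Family I.n I.m) (ω : ℕ → Bool)
    (hQ : ∀ (μ : Mem) (l : List ℕ) (ω' : ℕ → Bool), I.Ready (coeffs I.P I.t (I.s + 1) ω) μ →
      (∀ g < I.G, Rep I μ g (I.smp V (coeffs I.P I.t (I.s + 1) ω) g)
        (I.run V (coeffs I.P I.t (I.s + 1) ω) g I.m) []) → Q ⟨μ, l, ω'⟩) :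
    Wp I.region (passProg I.c) Q ⟨Mem.ofList 0 [I.n, I.m, I.k, I.E], V.tokens, ω⟩ := by
  have hclean : Clean (Mem.ofList 0 [I.n, I.m, I.k, I.E]) := by
    intro a i h1 h2
    rw [ofList_apply, if_neg (by omega)]
  refine wp_seq (wp_initScale (by simp [ofList_apply]) (by simp [ofList_apply])
    (by simp [ofList_apply]) (by simp [ofList_apply]) hclean fun μ h1 h2 h3 h4 h5 h6 => ?_)
  refine wp_seq (wp_initParams h1 h2 h3 h4 h5 h6 fun μ h1 h2 => ?_)
  refine wp_seq (wp_initPrime h1 h2 fun μ h1 h2 h3 => ?_)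
  refine wp_seq (wp_initCoeffs h1 h2 h3 fun μ ω' h1 h2 h3 h4 => ?_)
  refine wp_seq (wp_initTables (α := coeffs I.P I.t (I.s + 1) ω) h1 h2 h3 (fun q => ?_)
    fun μ h1 h2 => ?_)
  · rw [h4 q q.isLt, coeffs, ZMod.val_natCast]
  · exact wp_mainLoop V h1 h2 rfl fun μ l h1 h2 => hQ μ l ω' h1 h2

end Params

/-! ### The computation after the pass -/

/-- Finds the last successful instance. -/
def selectInstance : Prog :=
  .seq (setPar 7 (.lit 0)) <| .loop 9 (par 6) <|
    .ite (.bin .lt (.get 13 (tmp 9) * .get 14 (tmp 9) * (inp 3 - .lit 1))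
        (.lit 2 * inp 3 * inp 3 * par 3 * .get 9 (tmp 9) + .lit 1))
      (setPar 7 (tmp 9)) .skip

/-- Copies the log of this instance to the arrays from `20` on, as an input of the offline
algorithm. -/
def copyLog : Prog :=
  .seq (.assign 20 (.lit 0) (inp 0)) <| .seq (.assign 20 (.lit 1) (.get 8 (par 7))) <|
  .loop 11 (.get 5 (par 7)) <| .assign 21 (tmp 11) (.get 10 (par 7 * par 5 + tmp 11))

/-- Translates the output of the offline algorithm to the IDs of the stream. -/
def writeOutput : Prog :=
  .loop 11 (.get 8 (par 7)) <|
    .ite (.get 22 (tmp 11)) (.assign 2 (.get 11 (par 7 * inp 2 + tmp 11)) (.lit 1)) .skip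

/-- The program after the pass. The offline algorithm runs in the arrays from `20` on. -/
def postProg (A : Prog) : Prog :=
  .seq (.seq selectInstance copyLog) (.seq (A.shift 20) writeOutput)

namespace Params

variable (I : Params)

/-- The region of the pass, with additional cells `X`, next to a memory `ν`. -/
noncomputable def extend (X : Finset (ℕ × ℕ)) (ν : Mem) : Region where
  F := I.region.F ∪ X
  N := I.N
  w := Nat.size I.N + ν.bits
  ν := ν
  one_le := I.region.one_le.trans (Nat.le_add_right _ _)
  size_N := Nat.le_add_right _ _
  size_ν := fun p => (size_le_bits ν p).trans (Nat.le_add_left _ _)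

variable {I} {V : Family I.n I.m} {α : Fin I.t → ZMod I.P} {s : State} {Q : State → Prop}
  {X : Finset (ℕ × ℕ)} {ν : Mem}

@[simp] theorem extend_N : (I.extend X ν).N = I.N := rfl

theorem mem_extend {a i : ℕ} (h : i < I.len a) : (a, i) ∈ (I.extend X ν).F :=
  Finset.mem_union_left _ (I.mem_region h)

theorem array_lt {p : ℕ × ℕ} (h : p ∈ I.region.F) : p.1 < 15 ∧ p.1 ≠ 2 ∧ p.2 < I.len p.1 := by
  obtain ⟨a, i⟩ := p
  have hl : i < I.len a := (mem_cells.1 h).2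
  refine ⟨(mem_cells.1 h).1, ?_, hl⟩
  rintro rfl
  exact absurd hl (Nat.not_lt_zero _)

variable (I V α) in
/-- The memory represents the final states of all instances. -/
def Final (μ : Mem) : Prop :=
  I.Ready α μ ∧ ∀ g < I.G, Rep I μ g (I.smp V α g) (I.run V α g I.m) []

theorem Final.congr {μ μ' : Mem} (h : I.Final V α μ)
    (he : ∀ a i, a < 15 → a ≠ 2 → μ' (a, i) = μ (a, i)) : I.Final V α μ' := by
  refine ⟨?_, fun g hg => (h.2 g hg).congr fun b i h1 h2 => he b i (by omega) (by omega)⟩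
  have h1 := h.1
  constructor
  · constructor <;> rw [he _ _ (by omega) (by omega)]
    exacts [h1.n, h1.m, h1.k, h1.E, h1.s, h1.t, h1.Λ, h1.cap, h1.C, h1.G]
  · rw [he _ _ (by omega) (by omega)]; exact h1.P
  · intro q; rw [he _ _ (by omega) (by omega)]; exact h1.coeff q
  · intro g hg; rw [he _ _ (by omega) (by omega)]; exact h1.T g hg
  · intro g hg; rw [he _ _ (by omega) (by omega)]; exact h1.v g hg

theorem Final.update {μ : Mem} (h : I.Final V α μ) {a i v : ℕ}
    (ha : a = 2 ∨ a = 4 ∨ 15 ≤ a ∨ (a = 3 ∧ i = 7)) :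
    I.Final V α (Finsupp.update μ (a, i) v) := by
  rcases eq_or_ne a 2 with rfl | h2
  · exact h.congr fun b j h1 h2 => by rw [update_cell, if_neg (by omega)]
  · exact ⟨h.1.update (by omega), fun g hg => (h.2 g hg).update (by omega)⟩

theorem G_le_N : I.G ≤ I.N := by
  have := I.G_le
  unfold N
  omega

theorem wp_selectInstance (hF : I.Final V α s.mem)
    (hQ : ∀ μ : Mem, I.Final V α μ → μ (3, 7) = I.best V α → Q ⟨μ, s.input, s.coins⟩) :
    Wp (I.extend X ν) selectInstance Q s := by
  have hGN := I.G_le_N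
  refine wp_seq (wp_set (j := 7) (v := 0) (by simp) (by simp) (mem_extend (by simp [len]))
    (Nat.zero_le _) ?_)
  refine wp_loop (fun g s' => I.Final V α s'.mem ∧ s'.mem (3, 7) = lastIndex (I.Succ V α) g ∧
    s'.input = s.input ∧ s'.coins = s.coins) I.G hGN (mem_extend (by simp [len])) ?_ ?_ ?_ ?_
  · exact ⟨(hF.update (by omega)).update (by omega), by simp [lastIndex], rfl, rfl⟩
  · rintro g s' ⟨h1, -⟩
    exact h1.1.G
  · rintro g ⟨μ, l, ω⟩ - hg hx ⟨h1, h2, h3, h4⟩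
    dsimp only at *
    subst h3 h4
    have hcond : (Expr.bin .lt (.get 13 (tmp 9) * .get 14 (tmp 9) * (inp 3 - .lit 1))
        (.lit 2 * inp 3 * inp 3 * par 3 * .get 9 (tmp 9) + .lit 1) : Expr).eval μ ≠ 0 ↔
        I.Succ V α g := by
      simp only [eval_mul, eval_lt, eval_add, eval_sub, eval_get, eval_lit, hx, h1.1.T g hg,
        h1.1.v g hg, h1.1.E, h1.1.P, (h1.2 g hg).cov]
      simp [Succ]
    refine wp_ite ?_ ?_
    · intro hne
      refine wp_set (j := 7) (v := g) (by simp) (by simp [hx]) (mem_extend (by simp [len]))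
        (by simp; omega) ?_
      refine ⟨by simp [hx], (h1.update (by omega)).update (by omega), ?_, rfl, rfl⟩
      rw [lastIndex, if_pos (hcond.1 hne)]
      simp
    · intro h0
      refine wp_skip ⟨hx, h1.update (by omega), ?_, rfl, rfl⟩
      rw [lastIndex, if_neg fun h => hcond.2 h h0]
      simpa using h2
  · rintro ⟨μ, l, ω⟩ - hx ⟨h1, h2, h3, h4⟩
    dsimp only at *
    subst h3 h4
    exact hQ μ h1 h2

variable (I V α) in
/-- The cells of the arrays `20` and `21` that hold the input of the offline algorithm. -/
noncomputable def inputCells : Finset (ℕ × ℕ) :=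
  {20} ×ˢ Finset.range 2 ∪
    {21} ×ˢ Finset.range (I.family V α (I.best V α)).tokens.length

theorem mem_inputCells {a i : ℕ} : (a, i) ∈ I.inputCells V α ↔
    (a = 20 ∧ i < 2) ∨ (a = 21 ∧ i < (I.family V α (I.best V α)).tokens.length) := by
  simp only [inputCells, Finset.mem_union, Finset.mem_product, Finset.mem_singleton,
    Finset.mem_range]

theorem tokens_length_le : (I.family V α (I.best V α)).tokens.length ≤ I.k * (I.cap + 1) := by
  rw [family_tokens]
  exact I.logOf_length_le _ _

theorem wp_copyLog (hF : I.Final V α s.mem) (hb : s.mem (3, 7) = I.best V α)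
    (hQ : ∀ μ : Mem, I.Final V α μ → μ (3, 7) = I.best V α → μ (20, 0) = I.n →
      μ (20, 1) = (I.ids V α (I.best V α)).length →
      (∀ q < (I.family V α (I.best V α)).tokens.length,
        μ (21, q) = (I.family V α (I.best V α)).tokens.getD q 0) → Q ⟨μ, s.input, s.coins⟩) :
    Wp (I.extend (I.inputCells V α) ν) copyLog Q s := by
  have hGN := I.G_le_N
  have hbG := I.best_lt (V := V) (α := α)
  have hrep := hF.2 _ hbG
  have hl : (I.run V α (I.best V α) I.m).1.length = (I.ids V α (I.best V α)).length := rfl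
  have hlk := I.ids_length_le (V := V) (α := α) (I.best V α)
  have htl := tokens_length_le (I := I) (V := V) (α := α)
  have htok := I.family_tokens (V := V) (α := α) (I.best V α)
  have hC := I.C_eq
  set b := I.best V α with hbdef
  set toks := (I.family V α b).tokens with htoks
  have hin : ∀ {a i}, (a = 20 ∧ i < 2) ∨ (a = 21 ∧ i < toks.length) →
      (a, i) ∈ (I.extend (I.inputCells V α) ν).F :=
    fun h => Finset.mem_union_right _ (mem_inputCells.2 h)
  refine wp_seq (wp_set (j := 0) (v := I.n) (by simp) (by simp [hF.1.n]) (hin (by simp))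
    (by simp [N]; omega) ?_)
  refine wp_seq (wp_set (j := 1) (v := (I.ids V α b).length) (by simp)
    (by simp [hb, hrep.num, hl]) (hin (by simp)) (by simp only [extend_N]; unfold N; omega) ?_)
  refine wp_loop (fun q s' => I.Final V α s'.mem ∧ s'.mem (3, 7) = b ∧ s'.mem (20, 0) = I.n ∧
    s'.mem (20, 1) = (I.ids V α b).length ∧ (∀ p < q, s'.mem (21, p) = toks.getD p 0) ∧
    s'.input = s.input ∧ s'.coins = s.coins) toks.length
    (by simp only [extend_N]; unfold N; omega) (mem_extend (by simp [len])) ?_ ?_ ?_ ?_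
  · exact ⟨((hF.update (by omega)).update (by omega)).update (by omega), by simp [hb], by simp,
      by simp, by omega, rfl, rfl⟩
  · rintro q s' ⟨h1, h2, -⟩
    simp only [eval_get, eval_lit, h2, (h1.2 b hbG).pos, htok]
    rfl
  · rintro q ⟨μ, l, ω⟩ hFit hq hx ⟨h1, h2, h3, h4, h5, h6, h7⟩
    dsimp only at *
    subst h6 h7
    have hst := (h1.2 b hbG).store
    have hval : μ (10, b * I.C + q) = toks.getD q 0 := by
      rw [htok] at hq ⊢
      have hq' : q < (logOf (I.smp V α b) (I.run V α b I.m).1).length := hq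
      rw [hst q (by simpa using hq') (by omega), List.append_nil]
      rfl
    refine wp_set (j := q) (v := toks.getD q 0) (by simp [hx])
      (by simp [h2, h1.1.C, hx, hval]) (hin (Or.inr ⟨rfl, hq⟩)) ?_ ?_
    · rw [← hval]
      exact hFit.1 _ (mem_extend (block_lt hbG (by omega)))
    · refine ⟨by simp [hx], (h1.update (by omega)).update (by omega), by simp [h2], by simp [h3],
        by simp [h4], ?_, rfl, rfl⟩
      intro p hp
      dsimp only
      rw [update_cell, if_neg (by omega), update_cell]
      split_ifs with e
      · rw [e.2]
      · exact h5 p (by omega)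
  · rintro ⟨μ, l, ω⟩ - hx ⟨h1, h2, h3, h4, h5, h6, h7⟩
    dsimp only at *
    subst h6 h7
    exact hQ μ h1 h2 h3 h4 h5

variable (I V α) in
/-- The cells of the array `2` that belong to the selected sets. -/
noncomputable def outputCells : Finset (ℕ × ℕ) :=
  (I.ids V α (I.best V α)).toFinset.image fun i => (2, i)

theorem wp_writeOutput {B : ℕ → ℕ} (hF : I.Final V α s.mem) (hb : s.mem (3, 7) = I.best V α)
    (hB : ∀ q, s.mem (22, q) = B q) (h0 : ∀ i, s.mem (2, i) = 0)
    (hQ : ∀ s' : State, (∀ i, s'.mem (2, i) ≠ 0 ↔ ∃ q < (I.ids V α (I.best V α)).length,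
      (I.ids V α (I.best V α)).getD q 0 = i ∧ B q ≠ 0) → Q s') :
    Wp (I.extend (I.outputCells V α) ν) writeOutput Q s := by
  have hGN := I.G_le_N
  have hbG := I.best_lt (V := V) (α := α)
  have hlk := I.ids_length_le (V := V) (α := α) (I.best V α)
  have hout : ∀ {q}, q < (I.ids V α (I.best V α)).length →
      (2, (I.ids V α (I.best V α)).getD q 0) ∈ (I.extend (I.outputCells V α) ν).F := by
    intro q hq
    refine Finset.mem_union_right _ (Finset.mem_image_of_mem _ (List.mem_toFinset.2 ?_))
    rw [List.getD_eq_getElem _ _ hq]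
    exact List.getElem_mem hq
  set b := I.best V α with hbdef
  set ids := I.ids V α b with hids
  refine wp_loop (fun q s' => I.Final V α s'.mem ∧ s'.mem (3, 7) = b ∧
    (∀ q, s'.mem (22, q) = B q) ∧
    (∀ i, s'.mem (2, i) ≠ 0 ↔ ∃ p < q, ids.getD p 0 = i ∧ B p ≠ 0)) ids.length
    (by simp only [extend_N]; unfold N; omega) (mem_extend (by simp [len])) ?_ ?_ ?_ ?_
  · exact ⟨hF.update (by omega), by simp [hb], by simpa using hB, by simp [h0]⟩
  · rintro q s' ⟨h1, h2, -⟩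
    simp only [eval_get, eval_lit, h2, (h1.2 b hbG).num]
    rfl
  · rintro q ⟨μ, l, ω⟩ - hq hx ⟨h1, h2, h3, h4⟩
    dsimp only at *
    have hid : μ (11, b * I.k + q) = ids.getD q 0 := (h1.2 b hbG).ids q hq
    refine wp_ite ?_ ?_
    · intro hne
      simp only [eval_get, eval_lit, hx, h3] at hne
      refine wp_set (j := ids.getD q 0) (v := 1) (by simp [h2, h1.1.k, hx, hid]) (by simp)
        (hout hq) (by simp [N]) ?_
      refine ⟨by simp [hx], (h1.update (by omega)).update (by omega), by simp [h2],
        by simpa using h3, ?_⟩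
      intro i
      dsimp only
      rw [update_cell, if_neg (by omega), update_cell]
      constructor
      · intro h
        split_ifs at h with e
        · exact ⟨q, by omega, e.2.symm, hne⟩
        · obtain ⟨p, hp, hp'⟩ := (h4 i).1 h
          exact ⟨p, by omega, hp'⟩
      · rintro ⟨p, hp, hp1, hp2⟩
        split_ifs with e
        · exact one_ne_zero
        · refine (h4 i).2 ⟨p, ?_, hp1, hp2⟩
          rcases Nat.lt_succ_iff_lt_or_eq.1 hp with hp | rfl
          · exact hp
          · exact absurd ⟨rfl, hp1.symm⟩ e
    · intro he
      simp only [eval_get, eval_lit, hx, h3] at he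
      refine wp_skip ⟨hx, h1.update (by omega), by simpa using h2, by simpa using h3, ?_⟩
      intro i
      dsimp only
      rw [update_cell, if_neg (by omega), h4]
      constructor
      · rintro ⟨p, hp, hp'⟩
        exact ⟨p, by omega, hp'⟩
      · rintro ⟨p, hp, hp1, hp2⟩
        refine ⟨p, ?_, hp1, hp2⟩
        rcases Nat.lt_succ_iff_lt_or_eq.1 hp with hp | rfl
        · exact hp
        · exact absurd he hp2
  · rintro ⟨μ, l, ω⟩ - hx ⟨h1, h2, h3, h4⟩
    exact hQ _ h4

end Params

end MUC

namespace MUC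

/-! ### Runs of the streaming algorithm -/

namespace Params

variable {I : Params} {V : Family I.n I.m} {α : Fin I.t → ZMod I.P} {X : Finset (ℕ × ℕ)} {ν : Mem}

variable (I) in
/-- A bound on the memory of the streaming algorithm, not counting that of the offline
algorithm. -/
noncomputable def space : ℕ := 80 * (I.G * I.C) * Nat.size I.N

theorem t_le_C : I.t ≤ I.C := by
  have hE := I.E_pos
  have h1 : I.t ≤ I.Λ := by
    unfold Λ
    have : 0 < 4096 * I.E * I.E := by positivity
    calc I.t ≤ I.t * (4096 * I.E * I.E) := Nat.le_mul_of_pos_right _ this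
      _ = _ := by ring
  have h2 := I.C_eq
  unfold cap at h2
  omega

theorem k_le_C : I.k ≤ I.C := by
  have h2 := I.C_eq
  have : I.k ≤ I.k * (I.cap + 1) := Nat.le_mul_of_pos_right _ (Nat.succ_pos _)
  omega

theorem card_region_le : I.region.F.card ≤ 34 * (I.G * I.C) := by
  have h1 : I.region.F.card ≤ ∑ a ∈ Finset.range 15, I.len a := by
    refine Finset.card_biUnion_le.trans (Finset.sum_le_sum fun a _ => ?_)
    simp
  have h2 : ∑ a ∈ Finset.range 15, I.len a =
      24 + 7 * I.G + I.G * I.C + I.G * I.k + I.t := by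
    simp only [Finset.sum_range_succ, Finset.sum_range_zero, len]
    ring
  have h3 : I.G * I.k ≤ I.G * I.C := Nat.mul_le_mul_left _ I.k_le_C
  have h4 : I.t ≤ I.G * I.C := I.t_le_C.trans (Nat.le_mul_of_pos_left _ I.G_pos)
  have h5 := I.G_le
  have h6 := I.G_pos
  omega

theorem region_address_le {p : ℕ × ℕ} (hp : p ∈ I.region.F) : p.2 ≤ I.N := by
  obtain ⟨a, i⟩ := p
  have h := (array_lt hp).2.2
  have h1 := I.G_le
  refine h.le.trans ?_
  dsimp only
  unfold len N
  split <;> omega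

theorem sum_size_le (hX : ∀ p ∈ X, p.2 ≤ I.N) (hc : X.card ≤ I.C + 2) :
    ∑ p ∈ I.region.F ∪ X, (Nat.size p.2 + Nat.size I.N) ≤ I.space := by
  have h1 := I.G_pos
  have h2 : I.C ≤ I.G * I.C := Nat.le_mul_of_pos_left _ h1
  have h3 := I.G_le
  have h4 := I.card_region_le
  have hcard : (I.region.F ∪ X).card ≤ 40 * (I.G * I.C) := by
    refine (Finset.card_union_le _ _).trans ?_
    omega
  refine (Finset.sum_le_card_nsmul _ _ (2 * Nat.size I.N) fun p hp => ?_).trans ?_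
  · have : p.2 ≤ I.N := (Finset.mem_union.1 hp).elim region_address_le (hX p)
    have := Nat.size_le_size this
    omega
  · rw [smul_eq_mul]
    calc _ ≤ 40 * (I.G * I.C) * (2 * Nat.size I.N) := Nat.mul_le_mul_right _ hcard
      _ = I.space := by unfold space; ring

theorem region_bits_le : I.region.bits ≤ I.space := by
  have h := sum_size_le (I := I) (X := ∅) (by simp) (by simp)
  rw [Finset.union_empty] at h
  have h0 : I.region.ν.bits = 0 := Finsupp.sum_zero_index
  unfold Region.bits
  rw [h0, add_zero, region_N]
  exact h

theorem extend_bits_le (hX : ∀ p ∈ X, p.2 ≤ I.N) (hc : X.card ≤ I.C + 2) :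
    (I.extend X ν).bits ≤ I.space + ν.bits :=
  Nat.add_le_add_right (sum_size_le hX hc) _

theorem extend_input_bits_le : (I.extend (I.inputCells V α) 0).bits ≤ I.space := by
  have htl := tokens_length_le (I := I) (V := V) (α := α)
  have hC := I.C_eq
  have hGC : I.C ≤ I.G * I.C := Nat.le_mul_of_pos_left _ I.G_pos
  refine (extend_bits_le (fun p hp => ?_) ?_).trans ?_
  · obtain ⟨a, i⟩ := p
    have := mem_inputCells.1 hp
    dsimp only
    unfold N
    omega
  · refine (Finset.card_union_le _ _).trans ?_
    simp
    omega
  · have h0 : Mem.bits 0 = 0 := Finsupp.sum_zero_index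
    rw [h0, add_zero]

theorem extend_output_bits_le :
    (I.extend (I.outputCells V α) ν).bits ≤ I.space + ν.bits := by
  refine extend_bits_le (fun p hp => ?_) ?_
  · obtain ⟨i, hi, rfl⟩ := Finset.mem_image.1 hp
    have := I.ids_lt (List.mem_toFinset.1 hi)
    dsimp only
    unfold N
    omega
  · have h1 := I.ids_length_le (V := V) (α := α) (I.best V α)
    have h2 := I.k_le_C
    have h3 : (I.outputCells V α).card ≤ (I.ids V α (I.best V α)).length :=
      Finset.card_image_le.trans (List.toFinset_card_le _)
    omega

/-- The memory below the arrays of the offline algorithm. -/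
noncomputable def lower (μ : Mem) : Mem := μ.filter fun p => p.1 < 20

theorem lower_of_lt (μ : Mem) {a i : ℕ} (h : a < 20) : lower μ (a, i) = μ (a, i) :=
  Finsupp.filter_apply_pos (fun p : ℕ × ℕ => p.1 < 20) μ h

theorem lower_of_le (μ : Mem) (a i : ℕ) (h : 20 ≤ a) : lower μ (a, i) = 0 :=
  Finsupp.filter_apply_neg (fun p : ℕ × ℕ => p.1 < 20) μ (by simpa using h)

/-- Once the log is copied, the memory is that of the start of the offline algorithm, next to the
memory of the streaming algorithm. -/
theorem eq_lower_add {μ : Mem} (ω : ℕ → Bool) (hFit : (I.extend (I.inputCells V α) 0).Fits μ)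
    (h1 : μ (20, 0) = I.n) (h2 : μ (20, 1) = (I.ids V α (I.best V α)).length)
    (h3 : ∀ q < (I.family V α (I.best V α)).tokens.length,
      μ (21, q) = (I.family V α (I.best V α)).tokens.getD q 0) :
    μ = lower μ + Mem.shift 20 (offlineStart (I.family V α (I.best V α)) ω).mem := by
  have hout : ∀ {a i}, 15 ≤ a → (a, i) ∉ I.inputCells V α → μ (a, i) = 0 := by
    intro a i ha h
    refine hFit.2 _ fun hmem => ?_
    rcases Finset.mem_union.1 hmem with hmem | hmem
    · have := (array_lt hmem).1
      dsimp only at this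
      omega
    · exact h hmem
  ext ⟨a, i⟩
  by_cases ha : a < 20
  · rw [Finsupp.add_apply, Mem.shift_of_lt _ _ _ ha, lower_of_lt μ ha, add_zero]
  · obtain ⟨a, rfl⟩ := Nat.exists_eq_add_of_le' (not_lt.1 ha)
    rw [Finsupp.add_apply, lower_of_le μ _ _ (by omega), zero_add, Mem.shift_apply]
    simp only [offlineStart, Finsupp.add_apply, ofList_apply]
    by_cases hmem : (a + 20, i) ∈ I.inputCells V α
    · rcases mem_inputCells.1 hmem with ⟨e, hi⟩ | ⟨e, hi⟩
      · obtain rfl : a = 0 := by omega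
        rcases (by omega : i = 0 ∨ i = 1) with rfl | rfl
        · simpa using h1
        · simpa using h2
      · obtain rfl : a = 1 := by omega
        simpa using h3 i hi
    · rw [hout (by omega) hmem]
      rw [mem_inputCells] at hmem
      push Not at hmem
      split_ifs with e e' e'
      · omega
      · rw [List.getD_eq_default _ _ (by simp; omega)]
      · rw [List.getD_eq_default _ _ (hmem.2 (by omega))]
      · rfl

theorem selected_eq {s s' : State} (h : ∀ i, s'.mem (2, i) ≠ 0 ↔
      ∃ q < (I.ids V α (I.best V α)).length,
        (I.ids V α (I.best V α)).getD q 0 = i ∧ s.mem (2, q) ≠ 0) :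
    s'.selected I.m =
      (s.selected (I.ids V α (I.best V α)).length).map (I.idEmb V α (I.best V α)) := by
  ext i
  simp only [State.selected, Finset.mem_filter, Finset.mem_univ, true_and, Finset.mem_map, h]
  constructor
  · rintro ⟨q, hq, h1, h2⟩
    refine ⟨⟨q, hq⟩, h2, Fin.ext ?_⟩
    rw [← h1, List.getD_eq_getElem _ _ hq]
    rfl
  · rintro ⟨q, h1, rfl⟩
    exact ⟨q, q.isLt, List.getD_eq_getElem _ _ q.isLt, h1⟩

variable (I) in
/-- A bound on the running time of the streaming algorithm, if the offline algorithm takes the time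
`τ`. -/
noncomputable def time (τ : ℕ) : ℕ :=
  (passProg I.c).timeBound I.N (Nat.size I.N) +
    (Prog.seq selectInstance copyLog).timeBound I.N (Nat.size I.N) + τ +
    writeOutput.timeBound I.N (Nat.size I.N + (I.space + τ))

theorem timeBound_mono (p : Prog) (N : ℕ) {w w' : ℕ} (h : w ≤ w') :
    p.timeBound N w ≤ p.timeBound N w' := by
  induction p with
  | skip => exact h
  | assign => exact Nat.mul_le_mul_left _ h
  | read => exact Nat.mul_le_mul_left _ h
  | flip => exact Nat.mul_le_mul_left _ h
  | seq p q hp hq => exact add_le_add hp hq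
  | ite e p q hp hq => exact add_le_add (add_le_add (Nat.mul_le_mul_left _ h) hp) hq
  | _ e p hp =>
    exact Nat.mul_le_mul_left _ (add_le_add (Nat.mul_le_mul_left _ h) hp)

/-- A run of the offline algorithm on the selected family becomes a part of a run after the pass: it
needs its own memory in addition to that of the pass, and its output is translated to IDs. -/
theorem exists_post_run (A : Prog) {μ : Mem} (ω : ℕ → Bool) (hFit : I.region.Fits μ)
    (hF : I.Final V α μ) {σ : State} {τ a : ℕ}
    (hA : Exec A (offlineStart (I.family V α (I.best V α)) ω) σ τ a) :
    ∃ s t b, Exec (postProg A) ⟨μ, [], ω⟩ s t b ∧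
      t ≤ (Prog.seq selectInstance copyLog).timeBound I.N (Nat.size I.N) + τ +
        writeOutput.timeBound I.N (Nat.size I.N + (I.space + τ)) ∧
      b ≤ I.space + a ∧
      s.selected I.m =
        (σ.selected (I.ids V α (I.best V α)).length).map (I.idEmb V α (I.best V α)) := by
  have hFit' : (I.extend (I.inputCells V α) 0).Fits μ := by
    constructor
    · intro p _
      by_cases h : p ∈ I.region.F
      · exact hFit.1 p h
      · rw [hFit.2 p h]; exact Nat.zero_le _
    · exact fun p hp => hFit.2 p fun h => hp (Finset.mem_union_left _ h)
  have hw : Wp (I.extend (I.inputCells V α) 0) (.seq selectInstance copyLog)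
      (fun s => I.Final V α s.mem ∧ s.mem (3, 7) = I.best V α ∧ s.mem (20, 0) = I.n ∧
        s.mem (20, 1) = (I.ids V α (I.best V α)).length ∧
        (∀ q < (I.family V α (I.best V α)).tokens.length,
          s.mem (21, q) = (I.family V α (I.best V α)).tokens.getD q 0) ∧
        s.input = [] ∧ s.coins = ω) ⟨μ, [], ω⟩ :=
    wp_seq (wp_selectInstance hF fun μ h1 h2 => wp_copyLog h1 h2 fun μ h1 h2 h3 h4 h5 =>
      ⟨h1, h2, h3, h4, h5, rfl, rfl⟩)
  obtain ⟨⟨μ₁, l₁, ω₁⟩, t₁, b₁, e₁, ht₁, hb₁, hFit₁, k1, k2, k3, k4, k5, k6, k7⟩ := hw hFit'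
  dsimp only at *
  subst k6 k7
  have hμ := eq_lower_add ω₁ hFit₁ k3 k4 k5
  have hν := lower_of_le μ₁
  set ν := lower μ₁ with hνdef
  have e₂ := hA.frame hν
  rw [← hμ] at e₂
  have hbits := bits_frame hν (offlineStart (I.family V α (I.best V α)) ω₁).mem
  rw [← hμ] at hbits
  have hμ₁ : μ₁.bits ≤ I.space := hFit₁.bits_le.trans extend_input_bits_le
  obtain ⟨hσa, -, hστ⟩ := hA.bits_le
  have hlow : ∀ a i, a < 20 → (ν + σ.mem.shift 20) (a, i) = μ₁ (a, i) := by
    intro a i ha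
    rw [Finsupp.add_apply, Mem.shift_of_lt _ _ _ ha, hνdef, lower_of_lt μ₁ ha, add_zero]
  have hzero : ∀ a i, a < 20 → (a, i) ∉ I.region.F → μ₁ (a, i) = 0 := by
    intro a i ha h
    refine hFit₁.2 _ fun hmem => ?_
    rcases Finset.mem_union.1 hmem with hmem | hmem
    · exact h hmem
    · have := mem_inputCells.1 hmem
      omega
  have hFit₂ : (I.extend (I.outputCells V α) (σ.mem.shift 20)).Fits (ν + σ.mem.shift 20) := by
    constructor
    · rintro ⟨a, i⟩ hp
      have ha : a < 20 := by
        rcases Finset.mem_union.1 hp with h | h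
        · have := (array_lt h).1
          dsimp only at this
          omega
        · obtain ⟨j, -, hj⟩ := Finset.mem_image.1 h
          have := congrArg Prod.fst hj
          dsimp only at this
          omega
      rw [hlow a i ha]
      by_cases h : (a, i) ∈ I.region.F
      · exact hFit₁.1 _ (Finset.mem_union_left _ h)
      · rw [hzero a i ha h]; exact Nat.zero_le _
    · rintro ⟨a, i⟩ hp
      by_cases ha : a < 20
      · rw [hlow a i ha, hzero a i ha fun h => hp (Finset.mem_union_left _ h)]
        exact (Mem.shift_of_lt _ _ _ ha).symm
      · rw [Finsupp.add_apply, hν _ _ (by omega), zero_add]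
        rfl
  have hw₂ : Wp (I.extend (I.outputCells V α) (σ.mem.shift 20)) writeOutput
      (fun s => ∀ i, s.mem (2, i) ≠ 0 ↔ ∃ q < (I.ids V α (I.best V α)).length,
        (I.ids V α (I.best V α)).getD q 0 = i ∧ σ.mem (2, q) ≠ 0)
      ⟨ν + σ.mem.shift 20, σ.input, σ.coins⟩ := by
    refine wp_writeOutput (V := V) (α := α) (B := fun q => σ.mem (2, q)) ?_ ?_ ?_ ?_ fun s h => h
    · exact k1.congr fun a i ha _ => hlow a i (by omega)
    · exact (hlow 3 7 (by omega)).trans k2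
    · exact fun q => frame_apply hν σ.mem 2 q
    · intro i
      refine (hlow 2 i (by omega)).trans (hzero 2 i (by omega) fun h => (array_lt h).2.1 rfl)
  obtain ⟨s, t₃, b₃, e₃, ht₃, hb₃, -, hs⟩ := hw₂ hFit₂
  have hb₃' := hb₃.trans extend_output_bits_le
  rw [bits_shift] at hb₃'
  have h0 : Mem.bits 0 = 0 := Finsupp.sum_zero_index
  refine ⟨s, _, _, .seq e₁ (.seq e₂ e₃), ?_, ?_, selected_eq hs⟩
  · have h1 : (I.extend (I.inputCells V α) 0).w = Nat.size I.N := by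
      change Nat.size I.N + Mem.bits 0 = _
      rw [h0, add_zero]
    have h2 : (I.extend (I.outputCells V α) (σ.mem.shift 20)).w = Nat.size I.N + σ.mem.bits := by
      rw [← bits_shift 20]
      rfl
    rw [h1] at ht₁
    rw [h2] at ht₃
    have h3 := ht₃.trans (timeBound_mono _ _
      (show _ ≤ Nat.size I.N + (I.space + τ) by omega))
    rw [← add_assoc]
    exact add_le_add (Nat.add_le_add_right ht₁ _) h3
  · refine max_le ?_ (max_le ?_ ?_)
    · exact (hb₁.trans extend_input_bits_le).trans (Nat.le_add_right _ _)
    · omega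
    · omega

/-- Whatever the coins are, a run of the offline algorithm on the family selected by the best
instance extends to a run of the streaming algorithm. -/
theorem exists_run (A : Prog) (V : Family I.n I.m) (ω : ℕ → Bool) :
    ∃ ω' : ℕ → Bool, ∀ (σ : State) (τ a : ℕ),
      Exec A (offlineStart (I.family V (coeffs I.P I.t (I.s + 1) ω)
        (I.best V (coeffs I.P I.t (I.s + 1) ω))) ω') σ τ a →
      ∃ s t b b', (StreamAlg.mk (passProg I.c) (postProg A)).Run
          ⟨Mem.ofList 0 [I.n, I.m, I.k, I.E], V.tokens, ω⟩ s t b b' ∧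
        t ≤ I.time τ ∧ b ≤ I.space ∧ b' ≤ I.space + a ∧
        s.selected I.m = (σ.selected _).map (I.idEmb V (coeffs I.P I.t (I.s + 1) ω)
          (I.best V (coeffs I.P I.t (I.s + 1) ω))) := by
  have hw : Wp I.region (passProg I.c)
      (fun s => I.Final V (coeffs I.P I.t (I.s + 1) ω) s.mem)
      ⟨Mem.ofList 0 [I.n, I.m, I.k, I.E], V.tokens, ω⟩ :=
    wp_passProg V ω fun μ l ω' h1 h2 => ⟨h1, h2⟩
  obtain ⟨⟨μ, l, ω'⟩, t₁, b, e₁, ht₁, hb, hFit, hF⟩ := hw fits_start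
  refine ⟨ω', fun σ τ a hA => ?_⟩
  obtain ⟨s, t₂, b', e₂, ht₂, hb', hs⟩ := exists_post_run A ω' hFit hF hA
  refine ⟨s, _, b, b', ⟨_, t₁, t₂, e₁, e₂, rfl⟩, ?_, hb.trans region_bits_le, hb', hs⟩
  have ht₁' : t₁ ≤ (passProg I.c).timeBound I.N (Nat.size I.N) := ht₁
  unfold time
  omega

end Params

end MUC

namespace MUC

/-! ### Asymptotic bounds -/

namespace Params

variable {c : ℕ} {f g : Params → ℕ}

/-- The quantity in terms of which polynomial bounds are stated. -/
def scale (I : Params) : ℕ := I.m * I.n * I.E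

/-- For a fixed exponent `c` of the error probability, `f` is bounded by a polynomial in
`m * n * E`. -/
def PolyBdd (c : ℕ) (f : Params → ℕ) : Prop :=
  ∃ K : ℕ, ∀ I : Params, I.c = c → f I ≤ K * I.scale ^ K

theorem scale_pos (I : Params) : 0 < I.scale :=
  Nat.mul_pos (by have := I.four_le; omega) I.E_pos

theorem PolyBdd.mono (hg : PolyBdd c g) (h : ∀ I : Params, I.c = c → f I ≤ g I) : PolyBdd c f := by
  obtain ⟨K, hK⟩ := hg
  exact ⟨K, fun I hI => (h I hI).trans (hK I hI)⟩

theorem PolyBdd.const (a : ℕ) : PolyBdd c fun _ => a :=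
  ⟨a, fun I _ => Nat.le_mul_of_pos_right _ (pow_pos I.scale_pos _)⟩

theorem polyBdd_scale : PolyBdd c scale := ⟨1, fun I _ => by simp⟩

theorem PolyBdd.add (hf : PolyBdd c f) (hg : PolyBdd c g) : PolyBdd c fun I => f I + g I := by
  obtain ⟨K, hK⟩ := hf
  obtain ⟨K', hK'⟩ := hg
  refine ⟨K + K', fun I hI => ?_⟩
  have h1 := I.scale_pos
  calc f I + g I ≤ K * I.scale ^ K + K' * I.scale ^ K' := add_le_add (hK I hI) (hK' I hI)
    _ ≤ K * I.scale ^ (K + K') + K' * I.scale ^ (K + K') :=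
      add_le_add (Nat.mul_le_mul_left _ (Nat.pow_le_pow_right h1 (by omega)))
        (Nat.mul_le_mul_left _ (Nat.pow_le_pow_right h1 (by omega)))
    _ = _ := by ring

theorem PolyBdd.mul (hf : PolyBdd c f) (hg : PolyBdd c g) : PolyBdd c fun I => f I * g I := by
  obtain ⟨K, hK⟩ := hf
  obtain ⟨K', hK'⟩ := hg
  refine ⟨K * K' + (K + K'), fun I hI => ?_⟩
  have h1 := I.scale_pos
  calc f I * g I ≤ K * I.scale ^ K * (K' * I.scale ^ K') := Nat.mul_le_mul (hK I hI) (hK' I hI)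
    _ = K * K' * I.scale ^ (K + K') := by ring
    _ ≤ _ := Nat.mul_le_mul (by omega) (Nat.pow_le_pow_right h1 (by omega))

theorem PolyBdd.pow (hf : PolyBdd c f) : ∀ j : ℕ, PolyBdd c fun I => f I ^ j
  | 0 => (PolyBdd.const 1).mono fun I _ => by simp
  | j + 1 => ((hf.pow j).mul hf).mono fun I _ => by rw [pow_succ]

theorem PolyBdd.size (hf : PolyBdd c f) : PolyBdd c fun I => Nat.size (f I) :=
  hf.mono fun _ _ => Nat.size_le.2 Nat.lt_two_pow_self

theorem PolyBdd.timeBound (p : Prog) (hf : PolyBdd c f) (hg : PolyBdd c g) :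
    PolyBdd c fun I => p.timeBound (f I) (g I) := by
  obtain ⟨K, hK⟩ := p.timeBound_poly
  exact (((PolyBdd.const K).mul ((hf.add (.const 1)).pow K)).mul hg).mono fun I _ => hK _ _

theorem mn_le_scale (I : Params) : I.m * I.n ≤ I.scale := I.mn_le_mnE

theorem m_le_scale (I : Params) : I.m ≤ I.scale :=
  (Nat.le_mul_of_pos_right _ (by have := I.two_le_n; omega)).trans I.mn_le_mnE

theorem n_le_scale (I : Params) : I.n ≤ I.scale :=
  (Nat.le_mul_of_pos_left _ (by have := I.two_le_m; omega)).trans I.mn_le_mnE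

theorem k_le_scale (I : Params) : I.k ≤ I.scale := I.k_le_m.trans I.m_le_scale

theorem polyBdd_E : PolyBdd c Params.E := polyBdd_scale.mono fun I _ => I.E_le_mnE

theorem polyBdd_s : PolyBdd c Params.s :=
  ((PolyBdd.const 2).mul polyBdd_scale).mono fun I _ =>
    I.s_lt_mn.le.trans (Nat.mul_le_mul_left _ I.mn_le_scale)

theorem polyBdd_t : PolyBdd c t := by
  refine (((PolyBdd.const (2 * (c + 2))).mul polyBdd_scale).mul polyBdd_s).mono fun I hI => ?_
  subst hI
  exact Nat.mul_le_mul_right _ (Nat.mul_le_mul_left _ I.k_le_scale)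

theorem polyBdd_Λ : PolyBdd c Λ :=
  (((PolyBdd.const 4096).mul polyBdd_t).mul polyBdd_E).mul polyBdd_E

theorem polyBdd_cap : PolyBdd c cap := (PolyBdd.const 3).mul (polyBdd_Λ.add (.const 1))

theorem polyBdd_k : PolyBdd c Params.k := polyBdd_scale.mono fun I _ => I.k_le_scale

theorem polyBdd_C : PolyBdd c C := (polyBdd_k.add (.const 1)).mul (polyBdd_cap.add (.const 1))

theorem polyBdd_G : PolyBdd c G := polyBdd_s.mul polyBdd_E

theorem polyBdd_P : PolyBdd c P :=
  ((PolyBdd.const 2).mul polyBdd_scale).mono fun I _ =>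
    I.P_le.trans (Nat.mul_le_mul_left _ I.mn_le_scale)

theorem polyBdd_N : PolyBdd c N :=
  ((((((((((((PolyBdd.const 2).mul (polyBdd_P.mul polyBdd_P)).add
    ((PolyBdd.const 8).mul polyBdd_scale)).add (polyBdd_G.mul polyBdd_C)).add polyBdd_C).add
    (polyBdd_G.mul polyBdd_k)).add polyBdd_t).add polyBdd_Λ).add polyBdd_cap).add
    (polyBdd_scale.mono fun I _ => I.m_le_scale)).add
    (polyBdd_scale.mono fun I _ => I.n_le_scale)).add polyBdd_k).add (.const 20)

theorem polyBdd_space : PolyBdd c space :=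
  ((PolyBdd.const 80).mul (polyBdd_G.mul polyBdd_C)).mul polyBdd_N.size

theorem polyBdd_time (hf : PolyBdd c f) : PolyBdd c fun I => I.time (f I) := by
  refine ((((polyBdd_N.timeBound (passProg c) polyBdd_N.size).add
    (polyBdd_N.timeBound (.seq selectInstance copyLog) polyBdd_N.size)).add hf).add
    (polyBdd_N.timeBound writeOutput (polyBdd_N.size.add (polyBdd_space.add hf)))).mono
    fun I hI => ?_
  subst hI
  exact le_rfl

theorem time_mono (I : Params) {τ τ' : ℕ} (h : τ ≤ τ') : I.time τ ≤ I.time τ' :=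
  add_le_add (Nat.add_le_add_left h _) (timeBound_mono _ _ (by omega))

/-! ### Bounds in terms of the precision -/

section Real

variable {I : Params} {ε : ℝ}

theorem four_le_real (hε : 0 < ε) (hε1 : ε < 1) : (4 : ℝ) ≤ I.m * I.n / ε := by
  rw [le_div_iff₀ hε]
  have : (4 : ℝ) ≤ I.m * I.n := by exact_mod_cast I.four_le
  linarith

/-- This makes the logarithm absorb constants, and its powers increase with the exponent. -/
theorem one_le_log (hε : 0 < ε) (hε1 : ε < 1) : 1 ≤ Real.log (I.m * I.n / ε) := by
  have h4 := four_le_real (I := I) hε hε1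
  rw [Real.le_log_iff_exp_le (by linarith)]
  have := Real.exp_one_lt_d9
  linarith

theorem scale_le (hE : (I.E : ℝ) ≤ 2 / ε) :
    (I.scale : ℝ) ≤ 2 * (I.m * I.n / ε) := by
  unfold scale
  push_cast
  calc (I.m : ℝ) * I.n * I.E ≤ I.m * I.n * (2 / ε) := by gcongr
    _ = _ := by ring

/-- The binary length of a polynomially bounded number is at most logarithmic. -/
theorem size_le_log (hf : PolyBdd c f) : ∃ K : ℕ, ∀ (I : Params) (ε : ℝ), I.c = c → 0 < ε → ε < 1 →
    (I.E : ℝ) ≤ 2 / ε → (Nat.size (f I) : ℝ) ≤ K * Real.log (I.m * I.n / ε) := by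
  obtain ⟨K, hK⟩ := hf
  refine ⟨1 + 6 * K, fun I ε hI hε hε1 hE => ?_⟩
  have hL := one_le_log (I := I) hε hε1
  have h4 := four_le_real (I := I) hε hε1
  rcases Nat.eq_zero_or_pos (f I) with h0 | h0
  · rw [h0, Nat.size_zero, Nat.cast_zero]
    positivity
  obtain ⟨j, hj⟩ : ∃ j, Nat.size (f I) = j + 1 := ⟨Nat.size (f I) - 1, by
    have := Nat.size_pos.2 h0; omega⟩
  have hpow : 2 ^ j ≤ K * I.scale ^ K := (Nat.lt_size.1 (by omega)).trans (hK I hI)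
  have hKpos : 0 < K := by
    rcases Nat.eq_zero_or_pos K with rfl | h
    · simp at hpow
    · exact h
  have hX : (0 : ℝ) < I.scale := Nat.cast_pos.2 I.scale_pos
  have hlogX : Real.log I.scale ≤ 2 * Real.log (I.m * I.n / ε) := by
    rw [two_mul, ← Real.log_mul (by linarith) (by linarith)]
    refine Real.log_le_log hX ((scale_le hE).trans ?_)
    exact mul_le_mul_of_nonneg_right (by linarith) (by linarith)
  have h1 : (j : ℝ) * Real.log 2 ≤ K + K * (2 * Real.log (I.m * I.n / ε)) := by
    have hKR : (0 : ℝ) < K := Nat.cast_pos.2 hKpos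
    calc (j : ℝ) * Real.log 2 = Real.log (2 ^ j) := by rw [Real.log_pow]
      _ ≤ Real.log (K * (I.scale : ℝ) ^ K) :=
        Real.log_le_log (by positivity) (by exact_mod_cast hpow)
      _ = Real.log K + K * Real.log I.scale := by
        rw [Real.log_mul hKR.ne' (by positivity), Real.log_pow]
      _ ≤ _ := add_le_add (Real.log_le_self hKR.le) (mul_le_mul_of_nonneg_left hlogX hKR.le)
  have h2 := Real.log_two_gt_d9
  have h3 : (j : ℝ) ≤ 2 * (j * Real.log 2) := by nlinarith [Nat.cast_nonneg (α := ℝ) j]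
  rw [hj]
  push_cast
  nlinarith [Nat.cast_nonneg (α := ℝ) K]

theorem cap_le (I : Params) : I.cap + 1 ≤ 7 * (4096 * (2 * (I.c + 2) * I.k * I.s) * I.E * I.E) := by
  have h : 0 < I.Λ := by
    have h1 := I.t_pos
    have h2 := I.E_pos
    unfold Λ
    positivity
  have : I.cap + 1 ≤ 7 * I.Λ := by
    unfold cap
    omega
  exact this

/-- The memory is dominated by the logs: `s * E` instances store `O(k)` sets of `O(k * s * E ^ 2)`
sampled elements each, in words of logarithmic length. -/
theorem space_le (c : ℕ) : ∃ K : ℕ, ∀ (I : Params) (ε : ℝ), I.c = c → 0 < ε → ε < 1 →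
    (I.E : ℝ) ≤ 2 / ε →
    (I.space : ℝ) ≤ K * ((I.k : ℝ) ^ 2 / ε ^ 3) * Real.log (I.m * I.n / ε) ^ 3 := by
  obtain ⟨K₁, h₁⟩ := size_le_log (c := c) (f := fun I => I.m * I.n)
    (polyBdd_scale.mono fun I _ => I.mn_le_scale)
  obtain ⟨K₂, h₂⟩ := size_le_log (c := c) polyBdd_N
  refine ⟨80 * 2 * 7 * 4096 * (2 * (c + 2)) * 8 * K₁ ^ 2 * K₂, fun I ε hI hε hε1 hE => ?_⟩
  have hs : (I.s : ℝ) ≤ K₁ * Real.log (I.m * I.n / ε) := h₁ I ε hI hε hε1 hE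
  have hN := h₂ I ε hI hε hε1 hE
  have hL := one_le_log (I := I) hε hε1
  have hnat : I.space ≤ 80 * 2 * 7 * 4096 * (2 * (c + 2)) * I.k ^ 2 * I.s ^ 2 * I.E ^ 3 *
      Nat.size I.N := by
    have hk : I.k + 1 ≤ 2 * I.k := by have := I.two_le_k; omega
    subst hI
    calc I.space = 80 * (I.s * I.E * ((I.k + 1) * (I.cap + 1))) * Nat.size I.N := rfl
      _ ≤ 80 * (I.s * I.E * (2 * I.k *
          (7 * (4096 * (2 * (I.c + 2) * I.k * I.s) * I.E * I.E)))) * Nat.size I.N := by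
        gcongr
        exact I.cap_le
      _ = _ := by ring
  calc (I.space : ℝ) ≤ 80 * 2 * 7 * 4096 * (2 * (c + 2)) * (I.k : ℝ) ^ 2 * (I.s : ℝ) ^ 2 *
        (I.E : ℝ) ^ 3 * Nat.size I.N := by exact_mod_cast hnat
    _ ≤ 80 * 2 * 7 * 4096 * (2 * (c + 2)) * (I.k : ℝ) ^ 2 *
        (K₁ * Real.log (I.m * I.n / ε)) ^ 2 * (2 / ε) ^ 3 *
        (K₂ * Real.log (I.m * I.n / ε)) := by gcongr
    _ = _ := by
      push_cast
      ring

/-- The selected family has at most `k` sets of `O(k * s * E ^ 2)` sampled elements each. -/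
theorem input_le (c : ℕ) : ∃ K : ℕ, ∀ (I : Params) (ε : ℝ), I.c = c → 0 < ε → ε < 1 →
    (I.E : ℝ) ≤ 2 / ε → ((I.k * (I.cap + 1) : ℕ) : ℝ) ≤
      K * ((I.k : ℝ) ^ 2 / ε ^ 2) * Real.log (I.m * I.n / ε) ^ 1 := by
  obtain ⟨K₁, h₁⟩ := size_le_log (c := c) (f := fun I => I.m * I.n)
    (polyBdd_scale.mono fun I _ => I.mn_le_scale)
  refine ⟨7 * 4096 * (2 * (c + 2)) * 4 * K₁, fun I ε hI hε hε1 hE => ?_⟩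
  have hs : (I.s : ℝ) ≤ K₁ * Real.log (I.m * I.n / ε) := h₁ I ε hI hε hε1 hE
  have hL := one_le_log (I := I) hε hε1
  have hnat : I.k * (I.cap + 1) ≤ 7 * 4096 * (2 * (c + 2)) * I.k ^ 2 * I.s * I.E ^ 2 := by
    subst hI
    calc _ ≤ I.k * (7 * (4096 * (2 * (I.c + 2) * I.k * I.s) * I.E * I.E)) :=
          Nat.mul_le_mul_left _ I.cap_le
      _ = _ := by ring
  calc ((I.k * (I.cap + 1) : ℕ) : ℝ) ≤
        7 * 4096 * (2 * (c + 2)) * (I.k : ℝ) ^ 2 * (I.s : ℝ) * (I.E : ℝ) ^ 2 := by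
        exact_mod_cast hnat
    _ ≤ 7 * 4096 * (2 * (c + 2)) * (I.k : ℝ) ^ 2 * (K₁ * Real.log (I.m * I.n / ε)) *
        (2 / ε) ^ 2 := by gcongr
    _ = _ := by
      push_cast
      ring

/-- Polynomials in `m * n * E` are polynomials in `m + n + 1 / ε`. -/
theorem scale_pow_le (hε : 0 < ε) (hE : (I.E : ℝ) ≤ 2 / ε) (K : ℕ) :
    ((K * I.scale ^ K : ℕ) : ℝ) ≤ (K * 2 ^ K : ℕ) * ((I.m : ℝ) + I.n + 1 / ε) ^ (3 * K) := by
  have h0 : 0 < 1 / ε := by positivity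
  set Y := (I.m : ℝ) + I.n + 1 / ε with hY
  have hm : (I.m : ℝ) ≤ Y := by rw [hY]; linarith [Nat.cast_nonneg (α := ℝ) I.n]
  have hn : (I.n : ℝ) ≤ Y := by rw [hY]; linarith [Nat.cast_nonneg (α := ℝ) I.m]
  have he : 1 / ε ≤ Y := by
    rw [hY]; linarith [Nat.cast_nonneg (α := ℝ) I.n, Nat.cast_nonneg (α := ℝ) I.m]
  have hs : (I.scale : ℝ) ≤ 2 * Y ^ 3 := by
    have hY0 : 0 ≤ Y := h0.le.trans he
    calc (I.scale : ℝ) ≤ 2 * (I.m * I.n / ε) := scale_le hE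
      _ = 2 * (I.m * I.n * (1 / ε)) := by ring
      _ ≤ 2 * (Y * Y * Y) := by gcongr
      _ = _ := by ring
  push_cast
  calc (K : ℝ) * (I.scale : ℝ) ^ K ≤ K * (2 * Y ^ 3) ^ K := by gcongr
    _ = _ := by rw [mul_pow, ← pow_mul]; ring

end Real

end Params

/-- A unique coverage ratio is at least `1`, as a family with a single element shows. -/
theorem one_le_ratio {A : Prog} {φ : ℕ → ℕ → ℕ → ℝ} (hφ : HasUniqueCoverageRatio A φ) {k r d : ℕ}
    (hk : 2 ≤ k) (hr : 2 ≤ r) (hd : 2 ≤ d) : 1 ≤ φ k r d := by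
  let C : Family 1 1 := ⟨fun _ => [0], fun _ => List.nodup_singleton _⟩
  have hf : maxFreq C.sets ≤ r := Finset.sup_le fun x _ =>
    (Finset.card_le_univ _).trans (by simp; omega)
  have hs : maxSize C.sets ≤ d := Finset.sup_le fun i _ =>
    (Finset.card_le_univ _).trans (by simp; omega)
  obtain ⟨s, -, -, -, h⟩ := hφ k r d hk hr hd 1 1 C (fun _ => false) (by omega) hf hs
  have hc : (cover C.sets Finset.univ).card = 1 := by
    have : cover C.sets Finset.univ = {0} := by
      ext x
      simp [cover, Family.sets, C]
    rw [this, Finset.card_singleton]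
  have hu : (uniqueCover C.sets (s.selected 1)).card ≤ 1 :=
    (Finset.card_le_univ _).trans (by simp)
  rw [hc, Nat.cast_one] at h
  rcases (by omega : (uniqueCover C.sets (s.selected 1)).card = 0 ∨
    (uniqueCover C.sets (s.selected 1)).card = 1) with e | e
  · rw [e, Nat.cast_zero, mul_zero] at h
    linarith
  · rwa [e, Nat.cast_one, mul_one] at h

theorem mul_pow_mono {a K j : ℕ} {x L : ℝ} (ha : a ≤ K) (hj : j ≤ K) (hx : 0 ≤ x) (hL : 1 ≤ L) :
    a * x * L ^ j ≤ K * x * L ^ K := by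
  have h1 : (a : ℝ) ≤ K := by exact_mod_cast ha
  have h2 : L ^ j ≤ L ^ K := pow_le_pow_right₀ hL hj
  gcongr

end MUC

theorem theorem3p4 (A : MUC.Prog) (φ : ℕ → ℕ → ℕ → ℝ)
    (hA : MUC.PolyTime A) (hφ : MUC.HasUniqueCoverageRatio A φ) (c : ℕ) :
    ∃ (P : MUC.StreamAlg) (K : ℕ),
      ∀ (n m : ℕ) (V : MUC.Family n m) (k r d : ℕ) (ε : ℝ),
        2 ≤ k → k ≤ m →
        MUC.maxFreq V.sets = r → 2 ≤ r →
        MUC.maxSize V.sets = d → 2 ≤ d →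
        0 < ε → ε < 1 →
        -- approximation with probability at least `1 - 1 / m ^ c`
        1 - 1 / (m : ℝ) ^ c ≤
            MUC.coinLaw.real {ω | ∃ s t b b', P.Run (MUC.streamStart V k ε ω) s t b b' ∧
              MUC.IsApprox V.sets k (1 / (2 * φ k r d) - 3 * ε) (s.selected m)} ∧
        -- time and space on all outcomes of the coin flips
        ∀ ω, ∃ s t b b', P.Run (MUC.streamStart V k ε ω) s t b b' ∧
          (t : ℝ) ≤ K * (m + n + 1 / ε) ^ K ∧
          -- space throughout the pass
          (b : ℝ) ≤ K * ((k : ℝ) ^ 2 / ε ^ 3) * Real.log (m * n / ε) ^ K ∧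
          -- space after the pass: the same, apart from the memory of one call of `A`
          ∃ (l : ℕ) (C : MUC.Family n l) (ρ : ℕ → Bool) (s' : MUC.State) (t' a : ℕ),
            l ≤ k ∧
            (C.totalSize : ℝ) ≤ K * ((k : ℝ) ^ 2 / ε ^ 2) * Real.log (m * n / ε) ^ K ∧
            MUC.Exec A (MUC.offlineStart C ρ) s' t' a ∧
            (b' : ℝ) ≤ K * ((k : ℝ) ^ 2 / ε ^ 3) * Real.log (m * n / ε) ^ K + a := by
  obtain ⟨κ, hκ⟩ := hA
  obtain ⟨K₁, h₁⟩ := MUC.Params.polyBdd_time (c := c) (f := fun I => κ * (3 * I.scale) ^ κ)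
    ((MUC.Params.PolyBdd.const κ).mul
      (((MUC.Params.PolyBdd.const 3).mul MUC.Params.polyBdd_scale).pow κ))
  obtain ⟨K₂, h₂⟩ := MUC.Params.space_le c
  obtain ⟨K₃, h₃⟩ := MUC.Params.input_le c
  refine ⟨⟨MUC.passProg c, MUC.postProg A⟩, K₁ * 2 ^ K₁ + 3 * K₁ + K₂ + K₃ + 3, ?_⟩
  intro n m V k r d ε hk hkm hr hr2 hd hd2 hε hε1
  set K := K₁ * 2 ^ K₁ + 3 * K₁ + K₂ + K₃ + 3 with hK
  have hinv : 1 < 1 / ε := by rw [lt_div_iff₀ hε]; linarith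
  have hn : 2 ≤ n := by
    obtain ⟨i, -, hi⟩ := Finset.lt_sup_iff.1 (show 1 < MUC.maxSize V.sets by omega)
    have h := (Finset.card_le_univ (V.sets i)).trans_eq (Fintype.card_fin n)
    omega
  let I : MUC.Params := ⟨c, n, m, k, ⌈1 / ε⌉₊, hn, hk, hkm, Nat.lt_ceil.2 (by simpa using hinv)⟩
  have hE : (I.E : ℝ) ≤ 2 / ε := by
    have h := (Nat.ceil_lt_add_one (show 0 ≤ 1 / ε by positivity)).le
    calc (I.E : ℝ) ≤ 1 / ε + 1 := h
      _ ≤ 1 / ε + 1 / ε := by linarith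
      _ = _ := by ring
  have hεE : 1 / (I.E : ℝ) ≤ ε := by
    have h : 1 / ε ≤ (I.E : ℝ) := Nat.le_ceil _
    rw [div_le_iff₀ (by linarith)]
    rw [div_le_iff₀ hε] at h
    linarith
  have hL : 1 ≤ Real.log (m * n / ε) := MUC.Params.one_le_log (I := I) hε hε1
  refine ⟨?_, fun ω => ?_⟩
  · have hprob : MeasureTheory.IsProbabilityMeasure MUC.coinLaw := by
      unfold MUC.coinLaw; infer_instance
    refine (I.good_probability V.sets).trans (MeasureTheory.measureReal_mono fun ω hω => ?_)
    obtain ⟨ω', h⟩ := I.exists_run A V ω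
    set α := MUC.coeffs I.P I.t (I.s + 1) ω
    set C := I.family V α (I.best V α)
    obtain ⟨σ, τ, a, hσ, hratio⟩ := hφ k r d hk hr2 hd2 n _ C ω' (I.ids_length_le _)
      ((I.family_maxFreq_le _).trans hr.le) ((I.family_maxSize_le _).trans hd.le)
    obtain ⟨s, t, b, b', hrun, -, -, -, hsel⟩ := h σ τ a hσ
    refine ⟨s, t, b, b', hrun, ?_⟩
    rw [show s.selected m = _ from hsel]
    exact I.isApprox_of_good hω (hd2.trans hd.ge) (MUC.one_le_ratio hφ hk hr2 hd2) hεE _ hratio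
  · obtain ⟨ω', h⟩ := I.exists_run A V ω
    set α := MUC.coeffs I.P I.t (I.s + 1) ω
    obtain ⟨σ, τ, a, hσ, hτ⟩ := hκ n _ (I.family V α (I.best V α)) ω'
    obtain ⟨s, t, b, b', hrun, ht, hb, hb', -⟩ := h σ τ a hσ
    have hspace : (I.space : ℝ) ≤ K * ((k : ℝ) ^ 2 / ε ^ 3) * Real.log (m * n / ε) ^ K :=
      (h₂ I ε rfl hε hε1 hE).trans (MUC.mul_pow_mono (by omega) (by omega) (by positivity) hL)
    refine ⟨s, t, b, b', hrun, ?_, le_trans (by exact_mod_cast hb) hspace, _,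
      I.family V α (I.best V α), ω', σ, τ, a, I.ids_length_le _, ?_, hσ, ?_⟩
    · have hl : (I.ids V α (I.best V α)).length ≤ I.scale :=
        (I.ids_length_le _).trans I.k_le_scale
      have hn' : n ≤ I.scale := I.n_le_scale
      have hsc := I.scale_pos
      have hτ' : τ ≤ κ * (3 * I.scale) ^ κ :=
        hτ.trans (Nat.mul_le_mul_left _ (Nat.pow_le_pow_left (by omega) _))
      have ht' : t ≤ K₁ * I.scale ^ K₁ := (ht.trans (I.time_mono hτ')).trans (h₁ I rfl)
      have hY : 1 ≤ (m : ℝ) + n + 1 / ε := by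
        linarith [Nat.cast_nonneg (α := ℝ) m, Nat.cast_nonneg (α := ℝ) n]
      calc (t : ℝ) ≤ ((K₁ * I.scale ^ K₁ : ℕ) : ℝ) := by exact_mod_cast ht'
        _ ≤ (K₁ * 2 ^ K₁ : ℕ) * ((m : ℝ) + n + 1 / ε) ^ (3 * K₁) := MUC.Params.scale_pow_le hε hE K₁
        _ ≤ K * (m + n + 1 / ε) ^ K := by
          have := MUC.mul_pow_mono (x := 1) (show K₁ * 2 ^ K₁ ≤ K by omega)
            (show 3 * K₁ ≤ K by omega) zero_le_one hY
          simpa only [mul_one] using this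
    · have hts := I.family_totalSize_le (V := V) (α := α) (I.best V α)
      refine le_trans (by exact_mod_cast hts) ((h₃ I ε rfl hε hε1 hE).trans
        (MUC.mul_pow_mono (by omega) (by omega) (by positivity) hL))
    · have : (b' : ℝ) ≤ I.space + a := by exact_mod_cast hb'
      linarith
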